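/- **Language.** Let $Var$ be a (finite or infinite) set of variables and $(Pred,ar)$ a set of predicate symbols with arities. Formulas of $\mathsf{LUD}$ are $$\varphi ::= Px_1\ldots x_n \mid \neg\varphi \mid \varphi\wedge\varphi \mid D_X\varphi \mid D_XY \mid K_X\varphi \mid K_XY \mid U(X;Y),$$ with $n=ar(P)$, $x_i\in Var$, and $X,Y\subseteq Var$ finite. Abbreviate $A\varphi:=D_\emptyset\varphi$, $C(Y):=D_\emptyset Y$, $K\varphi:=K_\emptyset\varphi$, $K(Y):=K_\emptyset Y$, $K(X;Y):=K_\emptyset K_XY$. **Models.** A metric dependence model consists of metric spaces $(\mathbb D_x,d_x)$ for $x\in Var$, for each $P$ an $ar(P)$-ary relation $I(P)$ on $\bigcup_x\mathbb D_x$, a set $S$ of states, and surjections $\mathbf x:S\to\mathbb D_x$. For finite $X\subseteq Var$ put $\mathbf X(s)=(\mathbf x(s))_{x\in X}$, with values in the finite product of the spaces $\mathbb D_x$, and $d_X^S(s,t)=\sup\{d_x(\mathbf x(s),\mathbf x(t)):x\in X\}$ (with $\sup\emptyset=0$); the $X$-topology on $S$ is the one induced by $\mathbf X$ (equivalently by $d^S_X$).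 The model is *concrete* if $S\subseteq\prod_x\mathbb D_x$ and $\mathbf x(s)=s(x)$. A map $F$ between pseudo-metric spaces is *pseudo-locally Lipschitz* if every point $a$ has an open neighbourhood $O$, and $F(a)$ an open neighbourhood $V$, such that $F$ is Lipschitz on $O\cap F^{-1}(V)$. A metric dependence model is *pseudo-locally Lipschitz* if for all $x,y\in Var$ with $\mathbf x$ not constant, the map $\mathbf y:(S,d^S_{\{x\}})\to(\mathbb D_y,d_y)$ is pseudo-locally Lipschitz. **Semantics.** $s\models Px_1\ldots x_n$ iff $(\mathbf x_1(s),\ldots,\mathbf x_n(s))\in I(P)$; Boolean clauses as usual; $s\models D_X\varphi$ iff $w\models\varphi$ for all $w\in S$ with $\mathbf X(w)=\mathbf X(s)$; $s\models D_XY$ iff $\mathbf Y(w)=\mathbf Y(s)$ for all such $w$; $s\models K_X\varphi$ iff $s$ is in the interior of $\{w:w\models\varphi\}$ in the $X$-topology; $s\models K_XY$ iff there are an $X$-open $O\ni s$ and a continuous $F$ on $\mathbf X(O)$ with $F\circ\mathbf X=\mathbf Y$ on $O$; $s\models U(X;Y)$ iff $\forall\varepsilon>0\,\exists\delta>0\,\forall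 s,t\in S\,(d_X^S(s,t)<\delta\Rightarrow d_Y^S(s,t)<\varepsilon)$. A formula is valid on a class of models if it is true at every state of every model of the class. **Proof system $\mathbf{LUD}$.** All instances of propositional tautologies, and modus ponens; * necessitation (from $\varphi$ infer $D_X\varphi$), distribution $D_X(\varphi\to\psi)\to(D_X\varphi\to D_X\psi)$, $D_X\varphi\to\varphi$, $D_X\varphi\to D_XD_X\varphi$, $\neg D_X\varphi\to D_X\neg D_X\varphi$; * $D_XY$ for $Y\subseteq X$; $(D_XY\wedge D_XZ)\to D_X(Y\cup Z)$; $(D_XY\wedge D_YZ)\to D_XZ$; $D_XY\to D_XD_XY$; $D_XY\to(D_Y\varphi\to D_X\varphi)$; $Px_1\ldots x_n\to D_{\{x_1,\ldots,x_n\}}Px_1\ldots x_n$; * necessitation (from $\varphi$ infer $K_X\varphi$), distribution $K_X(\varphi\to\psi)\to(K_X\varphi\to K_X\psi)$, $K_X\varphi\to\varphi$, $K_X\varphi\to K_XK_X\varphi$; * $K_XY$ for $Y\subseteq X$; $(K_XY\wedge K_XZ)\to K_X(Y\cup Z)$; $(K_XY\wedge K_YZ)\to K_XZ$; $K_XY\to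 K_XK_XY$; $K_XY\to(K_Y\varphi\to K_X\varphi)$; * $K_X\varphi\to D_X\varphi$; $K_XY\to D_XY$; $A\varphi\to K\varphi$; $C(Y)\to K(Y)$; * $U(X;Y)$ for $Y\subseteq X$; $(U(X;Y)\wedge U(X;Z))\to U(X;Y\cup Z)$; $(U(X;Y)\wedge U(Y;Z))\to U(X;Z)$; $U(X;Y)\to K\,U(X;Y)$; $U(X;Y)\to K(X;Y)$; $K(Y)\to U(X;Y)$. **Theorem.** For every formula $\varphi$ of $\mathsf{LUD}$ the following are equivalent: (a) $\varphi$ is a theorem of $\mathbf{LUD}$; (b) $\varphi$ is valid on all metric dependence models; (c) $\varphi$ is valid on all concrete metric models; (d) $\varphi$ is valid on all pseudo-locally Lipschitz models. Moreover, the logic is decidable: if $Var$ and $Pred$ are countable (given with injective numberings), there is a total recursive function that decides, from the Gödel number of a formula, whether the formula is valid on all metric dependence models. -/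

import Mathlib

universe u

namespace LUD

/-! ### Syntax -/

/-- Formulas of the logic of uniform dependence, over the variables `Var` and the relational
vocabulary `(Pred, ar)`:
`P x⃗ | ¬φ | φ ∧ φ | D_X φ | D_X Y | K_X φ | K_X Y | U(X;Y)`, with `X`, `Y` finite sets of
variables. -/
inductive Formula (Var : Type u) {Pred : Type u} (ar : Pred → ℕ) : Type u
  | pred (P : Pred) (xs : Fin (ar P) → Var) : Formula Var ar
  | neg (φ : Formula Var ar) : Formula Var ar
  | and (φ ψ : Formula Var ar) : Formula Var ar
  | D (X : Finset Var) (φ : Formula Var ar) : Formula Var ar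
  | Dep (X Y : Finset Var) : Formula Var ar
  | K (X : Finset Var) (φ : Formula Var ar) : Formula Var ar
  | KDep (X Y : Finset Var) : Formula Var ar
  | UDep (X Y : Finset Var) : Formula Var ar

namespace Formula

variable {Var Pred : Type u} {ar : Pred → ℕ}

/-- `φ → ψ := ¬(φ ∧ ¬ψ)`. -/
def imp (φ ψ : Formula Var ar) : Formula Var ar := neg (and φ (neg ψ))

/-- `A φ := D_∅ φ`. -/
def all (φ : Formula Var ar) : Formula Var ar := D ∅ φ

/-- `C(Y) := D_∅ Y`. -/
def const (Y : Finset Var) : Formula Var ar := Dep ∅ Y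

/-- `K φ := K_∅ φ`. -/
def known (φ : Formula Var ar) : Formula Var ar := K ∅ φ

/-- `K(Y) := K_∅ Y`. -/
def knownVal (Y : Finset Var) : Formula Var ar := KDep ∅ Y

/-- `K(X;Y) := K K_X Y`. -/
def knownDep (X Y : Finset Var) : Formula Var ar := known (KDep X Y)

/-- Instances of classical propositional tautologies: formulas true under every truth assignment
to formulas that respects `¬` and `∧`. -/
def IsTautology (φ : Formula Var ar) : Prop :=
  ∀ v : Formula Var ar → Prop, (∀ ψ, v (neg ψ) ↔ ¬ v ψ) →
    (∀ ψ χ, v (and ψ χ) ↔ v ψ ∧ v χ) → v φ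

end Formula

/-! ### The proof system -/

section ProofSystem

open Formula

variable {Var Pred : Type u} [DecidableEq Var] {ar : Pred → ℕ}

/-- The theorems of the proof system **LUD**. -/
inductive Provable : Formula Var ar → Prop
  -- propositional logic
  | taut (φ : Formula Var ar) : IsTautology φ → Provable φ
  | modusPonens (φ ψ : Formula Var ar) : Provable (imp φ ψ) → Provable φ → Provable ψ
  -- `S5` for determination
  | dNec (X : Finset Var) (φ : Formula Var ar) : Provable φ → Provable (D X φ)
  | dDist (X : Finset Var) (φ ψ : Formula Var ar) :
      Provable (imp (D X (imp φ ψ)) (imp (D X φ) (D X ψ)))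
  | dFactivity (X : Finset Var) (φ : Formula Var ar) : Provable (imp (D X φ) φ)
  | dFour (X : Finset Var) (φ : Formula Var ar) : Provable (imp (D X φ) (D X (D X φ)))
  | dFive (X : Finset Var) (φ : Formula Var ar) :
      Provable (imp (neg (D X φ)) (D X (neg (D X φ))))
  -- exact dependence
  | inclusion (X Y : Finset Var) : Y ⊆ X → Provable (Dep X Y)
  | additivity (X Y Z : Finset Var) :
      Provable (imp (and (Dep X Y) (Dep X Z)) (Dep X (Y ∪ Z)))
  | transitivity (X Y Z : Finset Var) :
      Provable (imp (and (Dep X Y) (Dep Y Z)) (Dep X Z))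
  | determinedDep (X Y : Finset Var) : Provable (imp (Dep X Y) (D X (Dep X Y)))
  | transfer (X Y : Finset Var) (φ : Formula Var ar) :
      Provable (imp (Dep X Y) (imp (D Y φ) (D X φ)))
  | determinedAtoms (P : Pred) (xs : Fin (ar P) → Var) :
      Provable (imp (pred P xs) (D (Finset.univ.image xs) (pred P xs)))
  -- `S4` for knowability
  | kNec (X : Finset Var) (φ : Formula Var ar) : Provable φ → Provable (K X φ)
  | kDist (X : Finset Var) (φ ψ : Formula Var ar) :
      Provable (imp (K X (imp φ ψ)) (imp (K X φ) (K X ψ)))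
  | veracity (X : Finset Var) (φ : Formula Var ar) : Provable (imp (K X φ) φ)
  | posIntrospection (X : Finset Var) (φ : Formula Var ar) :
      Provable (imp (K X φ) (K X (K X φ)))
  -- knowable dependence
  | kInclusion (X Y : Finset Var) : Y ⊆ X → Provable (KDep X Y)
  | kAdditivity (X Y Z : Finset Var) :
      Provable (imp (and (KDep X Y) (KDep X Z)) (KDep X (Y ∪ Z)))
  | kTransitivity (X Y Z : Finset Var) :
      Provable (imp (and (KDep X Y) (KDep Y Z)) (KDep X Z))
  | knowabilityOfDep (X Y : Finset Var) : Provable (imp (KDep X Y) (K X (KDep X Y)))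
  | kTransfer (X Y : Finset Var) (φ : Formula Var ar) :
      Provable (imp (KDep X Y) (imp (K Y φ) (K X φ)))
  -- connecting axioms
  | knowableDetermination (X : Finset Var) (φ : Formula Var ar) : Provable (imp (K X φ) (D X φ))
  | knowableDependence (X Y : Finset Var) : Provable (imp (KDep X Y) (Dep X Y))
  | knowledgeOfNecessity (φ : Formula Var ar) : Provable (imp (all φ) (known φ))
  | knowledgeOfConstants (Y : Finset Var) : Provable (imp (const Y) (knownVal Y))
  -- uniform dependence
  | uInclusion (X Y : Finset Var) : Y ⊆ X → Provable (UDep X Y)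
  | uAdditivity (X Y Z : Finset Var) :
      Provable (imp (and (UDep X Y) (UDep X Z)) (UDep X (Y ∪ Z)))
  | uTransitivity (X Y Z : Finset Var) :
      Provable (imp (and (UDep X Y) (UDep Y Z)) (UDep X Z))
  | uKnown (X Y : Finset Var) : Provable (imp (UDep X Y) (known (UDep X Y)))
  | uContinuity (X Y : Finset Var) : Provable (imp (UDep X Y) (knownDep X Y))
  | uKnowledge (X Y : Finset Var) : Provable (imp (knownVal Y) (UDep X Y))

end ProofSystem

/-! ### Models -/

/-- A typed metric model: a range of values `Rng x` with a metric for every variable `x`, and an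
interpretation of each predicate symbol as a relation on the union of all the ranges. The ranges
are subsets of an ambient type `Val`, which may overlap. -/
structure TypedMetricModel (Var : Type u) {Pred : Type u} (ar : Pred → ℕ) where
  Val : Type u
  Rng : Var → Set Val
  metric : ∀ x, MetricSpace (Rng x)
  interp : ∀ P : Pred, Set (Fin (ar P) → (⋃ x, Rng x : Set Val))

attribute [instance] TypedMetricModel.metric

/-- A metric dependence model: a typed metric model, a set of states, and for every variable a
surjective map from the states to its range of values. -/
structure MetricModel (Var : Type u) {Pred : Type u} (ar : Pred → ℕ)
    extends TypedMetricModel Var ar where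
  State : Type u
  val : ∀ x, State → Rng x
  surj : ∀ x, Function.Surjective (val x)

/-- A concrete metric model: a typed metric model and a set of type-respecting assignments of
values to variables, such that every value in each range is taken. -/
structure ConcreteMetricModel (Var : Type u) {Pred : Type u} (ar : Pred → ℕ)
    extends TypedMetricModel Var ar where
  States : Set (∀ x, Rng x)
  range_eq : ∀ x, {a | ∃ s ∈ States, s x = a} = Set.univ

namespace ConcreteMetricModel

variable {Var Pred : Type u} {ar : Pred → ℕ}

/-- A concrete metric model as a metric dependence model, with `𝐱(s) := s(x)`. -/
def toMetricModel (M : ConcreteMetricModel Var ar) : MetricModel Var ar where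
  toTypedMetricModel := M.toTypedMetricModel
  State := M.States
  val x s := s.1 x
  surj x a := by
    have h : a ∈ {a | ∃ s ∈ M.States, s x = a} := by rw [M.range_eq x]; trivial
    obtain ⟨s, hs, rfl⟩ := h
    exact ⟨⟨s, hs⟩, rfl⟩

end ConcreteMetricModel

/-- A map between pseudo-metric spaces is pseudo-locally Lipschitz if every point `a` has an open
neighbourhood `O`, and `F a` an open neighbourhood `V`, such that `F` is Lipschitz on
`O ∩ F⁻¹(V)`. -/
def PseudoLocallyLipschitz {α β : Type*} [PseudoMetricSpace α] [PseudoMetricSpace β]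
    (F : α → β) : Prop :=
  ∀ a, ∃ O : Set α, ∃ V : Set β, IsOpen O ∧ a ∈ O ∧ IsOpen V ∧ F a ∈ V ∧
    ∃ C : NNReal, LipschitzOnWith C F (O ∩ F ⁻¹' V)

namespace MetricModel

variable {Var Pred : Type u} {ar : Pred → ℕ}

/-- The joint variable `𝐗(s) = (𝐱(s))_{x ∈ X}`. The product over the finite set `X` carries
Mathlib's product metric, which is the Chebyshev distance (`0` for `X = ∅`), and the product
topology. -/
def joint (M : MetricModel Var ar) (X : Finset Var) (s : M.State) : ∀ x : X, M.Rng x :=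
  fun x => M.val x s

/-- The `𝐗`-topology on the states: preimages under `𝐗` of the open sets. -/
@[reducible]
def stateTopology (M : MetricModel Var ar) (X : Finset Var) : TopologicalSpace M.State :=
  TopologicalSpace.induced (M.joint X) inferInstance

/-- The pseudo-metric `d_X^S(s,t) = sup {d_x(𝐱(s),𝐱(t)) : x ∈ X}` on the states. -/
noncomputable def stateDist (M : MetricModel Var ar) (X : Finset Var) (s t : M.State) : ℝ :=
  dist (M.joint X s) (M.joint X t)

/-- The satisfaction relation `s ⊨ φ`. In the clause for `K_X Y` the function `F` is only relevant
on `𝐗(O)`. -/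
def Sat (M : MetricModel Var ar) : Formula Var ar → M.State → Prop
  | .pred P xs, s =>
      (fun i => ⟨M.val (xs i) s, Set.mem_iUnion.2 ⟨xs i, (M.val (xs i) s).2⟩⟩) ∈ M.interp P
  | .neg φ, s => ¬ M.Sat φ s
  | .and φ ψ, s => M.Sat φ s ∧ M.Sat ψ s
  | .D X φ, s => ∀ w, M.joint X s = M.joint X w → M.Sat φ w
  | .Dep X Y, s => ∀ w, M.joint X s = M.joint X w → M.joint Y s = M.joint Y w
  | .K X φ, s => s ∈ @interior M.State (M.stateTopology X) {w | M.Sat φ w}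
  | .KDep X Y, s => ∃ O : Set M.State, @IsOpen M.State (M.stateTopology X) O ∧ s ∈ O ∧
      ∃ F : (∀ x : X, M.Rng x) → (∀ y : Y, M.Rng y),
        ContinuousOn F (M.joint X '' O) ∧ ∀ w ∈ O, F (M.joint X w) = M.joint Y w
  | .UDep X Y, _ => ∀ ε > 0, ∃ δ > 0, ∀ s t : M.State,
      M.stateDist X s t < δ → M.stateDist Y s t < ε

/-- Truth at all states. -/
def Valid (M : MetricModel Var ar) (φ : Formula Var ar) : Prop := ∀ s, M.Sat φ s

/-- A basic variable is constant if it takes at most one value. -/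
def IsConstant (M : MetricModel Var ar) (x : Var) : Prop := ∀ s t, M.val x s = M.val x t

/-- Pseudo-locally Lipschitz models: every basic variable `y` is pseudo-locally Lipschitz with
respect to every non-constant basic variable `x`, i.e. as a map from the states, with the
pseudo-metric `d_x^S(s,t) = d_x(𝐱(s),𝐱(t))`, to the range of `y`. For a constant `x` this
pseudo-metric is identically zero, as it is for the empty set of variables. -/
def IsPseudoLocallyLipschitz (M : MetricModel Var ar) : Prop :=
  ∀ x y : Var, ¬ M.IsConstant x →
    @PseudoLocallyLipschitz M.State (M.Rng y)
      (PseudoMetricSpace.induced (M.val x) inferInstance) inferInstance (M.val y)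

end MetricModel

/-! ### Validity on the classes of models -/

section Validity

variable {Var Pred : Type u} {ar : Pred → ℕ}

/-- Validity on all metric dependence models. -/
def MetricValid (φ : Formula Var ar) : Prop := ∀ M : MetricModel Var ar, M.Valid φ

/-- Validity on all concrete metric models. -/
def ConcreteValid (φ : Formula Var ar) : Prop :=
  ∀ M : ConcreteMetricModel Var ar, M.toMetricModel.Valid φ

/-- Validity on all pseudo-locally Lipschitz models. -/
def LipschitzValid (φ : Formula Var ar) : Prop :=
  ∀ M : MetricModel Var ar, M.IsPseudoLocallyLipschitz → M.Valid φ

end Validity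

/-! ### Gödel numbers of formulas -/

namespace Formula

variable {Var Pred : Type u} [Encodable Var] [Encodable Pred] {ar : Pred → ℕ}

/-- The code of a finite set of variables: the number whose binary digits form the indicator
sequence of the set of their numbers. -/
def codeSet (X : Finset Var) : ℕ := ∑ x ∈ X, 2 ^ Encodable.encode x

/-- The Gödel number of a formula, relative to a numbering of the variables and predicates. -/
def code : Formula Var ar → ℕ
  | pred P xs => Nat.pair 0 (Nat.pair (Encodable.encode P)
      (Encodable.encode (List.ofFn fun i => Encodable.encode (xs i))))
  | neg φ => Nat.pair 1 φ.code
  | and φ ψ => Nat.pair 2 (Nat.pair φ.code ψ.code)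
  | D X φ => Nat.pair 3 (Nat.pair (codeSet X) φ.code)
  | Dep X Y => Nat.pair 4 (Nat.pair (codeSet X) (codeSet Y))
  | K X φ => Nat.pair 5 (Nat.pair (codeSet X) φ.code)
  | KDep X Y => Nat.pair 6 (Nat.pair (codeSet X) (codeSet Y))
  | UDep X Y => Nat.pair 7 (Nat.pair (codeSet X) (codeSet Y))

theorem codeSet_injective : Function.Injective (codeSet : Finset Var → ℕ) := by
  intro X Y h
  have key : ∀ Z : Finset Var,
      codeSet Z = ∑ n ∈ Z.map ⟨Encodable.encode, Encodable.encode_injective⟩, 2 ^ n := by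
    intro Z; simp [codeSet]
  rw [key, key] at h
  exact Finset.map_injective _ (Finset.geomSum_injective le_rfl h)

theorem code_injective : Function.Injective (code : Formula Var ar → ℕ) := by
  intro φ
  induction φ with
  | pred P xs =>
    intro ψ h
    cases ψ <;> simp only [code, Nat.pair_eq_pair] at h <;> try omega
    obtain ⟨-, hP, hx⟩ := h
    obtain rfl := Encodable.encode_injective hP
    have := List.ofFn_injective (Encodable.encode_injective hx)
    congr
    funext i
    exact Encodable.encode_injective (congrFun this i)
  | neg φ ih =>
    intro ψ h
    cases ψ <;> simp only [code, Nat.pair_eq_pair] at h <;> try omega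
    rw [ih h.2]
  | and φ χ ih₁ ih₂ =>
    intro ψ h
    cases ψ <;> simp only [code, Nat.pair_eq_pair] at h <;> try omega
    rw [ih₁ h.2.1, ih₂ h.2.2]
  | D X φ ih =>
    intro ψ h
    cases ψ <;> simp only [code, Nat.pair_eq_pair] at h <;> try omega
    rw [ih h.2.2, codeSet_injective h.2.1]
  | K X φ ih =>
    intro ψ h
    cases ψ <;> simp only [code, Nat.pair_eq_pair] at h <;> try omega
    rw [ih h.2.2, codeSet_injective h.2.1]
  | Dep X Y =>
    intro ψ h
    cases ψ <;> simp only [code, Nat.pair_eq_pair] at h <;> try omega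
    rw [codeSet_injective h.2.1, codeSet_injective h.2.2]
  | KDep X Y =>
    intro ψ h
    cases ψ <;> simp only [code, Nat.pair_eq_pair] at h <;> try omega
    rw [codeSet_injective h.2.1, codeSet_injective h.2.2]
  | UDep X Y =>
    intro ψ h
    cases ψ <;> simp only [code, Nat.pair_eq_pair] at h <;> try omega
    rw [codeSet_injective h.2.1, codeSet_injective h.2.2]

end Formula

/-- A set of formulas is decidable if a total recursive function decides membership from the
Gödel number of a formula. -/
def DecidableFormulas {Var Pred : Type u} [Encodable Var] [Encodable Pred] {ar : Pred → ℕ}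
    (T : Formula Var ar → Prop) : Prop :=
  ∃ f : ℕ → Bool, Computable f ∧ ∀ φ : Formula Var ar, f φ.code = true ↔ T φ

end LUD

namespace LUD

/-! ### Metric descriptions of the semantic clauses -/

namespace MetricModel

variable {Var Pred : Type u} {ar : Pred → ℕ} (M : MetricModel Var ar)

/-! Soundness becomes an ε–δ check once the topological clauses are made metric: `K_X φ` says that
`φ` holds on a `d_X`-ball (`sat_K_iff`), and `K_X Y` says that `Y` depends continuously on `X` at
every state of a `d_X`-ball (`sat_KDep_iff`). Truth depends on a state only through the values of
the variables, so every model can be made concrete (`sat_toAssignment`).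

For completeness, an unprovable formula is first refuted in a quasi-model: the maximal theories that
share the necessary truths of one theory refuting the formula (`exists_quasiModel`). A quasi-model
has no metric yet. It is unravelled into a tree whose nodes are types paired with a natural number,
the modulus, and whose finite paths are the states. Each edge carries, for each variable, a weight,
the amount by which the variable changes; the distance of two paths for `x` is the largest weight of
`x` on the way between them in the tree, which is an ultrametric up to identification
(`treeDist_ultra`).

The weights encode the three strengths of dependence. An edge of kind `det X` fixes what `X`
determines and moves every other non-constant variable by 1. An edge of kind `know X n` moves what
depends uniformly on `X` by 1/(n+1), what depends only knowably on `X` by up to (N+1)/(n+1), where N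
is the modulus of the node, and all else by 1. An edge that changes the modulus moves every
non-constant variable by 1. Hence on scales below 1 uniform dependence does not increase distances
(`height_le_of_udep`), while knowable dependence is Lipschitz with a constant N+1 that is locally
fixed (`height_le_mul_of_kdep`) but globally unbounded, which is what refutes `U(X;Y)` when `K_X Y`
is merely true everywhere. The same estimates give the truth lemma `QuasiModel.sat_iff` and the
pseudo-local Lipschitz property.

For decidability, only the subformulas of the given formula and the dependence atoms over its
variables matter in a quasi-model. Truncating types to Gödel numbers below a computable bound leaves
a number that codes a quasi-model, and searching for it is a primitive recursive test
(`Coded.primrecPred_refutable`, `refutable_iff`). -/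

theorem stateDist_lt_iff {X : Finset Var} {s t : M.State} {ε : ℝ} (hε : 0 < ε) :
    M.stateDist X s t < ε ↔ ∀ x ∈ X, dist (M.val x s) (M.val x t) < ε := by
  simp [stateDist, dist_pi_lt_iff hε, joint]

theorem stateDist_le_iff {X : Finset Var} {s t : M.State} {ε : ℝ} (hε : 0 ≤ ε) :
    M.stateDist X s t ≤ ε ↔ ∀ x ∈ X, dist (M.val x s) (M.val x t) ≤ ε := by
  simp [stateDist, dist_pi_le_iff hε, joint]

theorem joint_eq_iff {X : Finset Var} {s t : M.State} :
    M.joint X s = M.joint X t ↔ ∀ x ∈ X, M.val x s = M.val x t := by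
  simp [joint, funext_iff]

theorem stateDist_eq_zero {X : Finset Var} {s t : M.State} :
    M.stateDist X s t = 0 ↔ M.joint X s = M.joint X t := dist_eq_zero

theorem stateDist_mono {X Y : Finset Var} (h : Y ⊆ X) (s t : M.State) :
    M.stateDist Y s t ≤ M.stateDist X s t :=
  (M.stateDist_le_iff dist_nonneg).2 fun x hx =>
    (M.stateDist_le_iff (X := X) dist_nonneg).1 le_rfl x (h hx)

theorem stateDist_triangle (X : Finset Var) (s t r : M.State) :
    M.stateDist X s r ≤ M.stateDist X s t + M.stateDist X t r := dist_triangle _ _ _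

theorem stateDist_self (X : Finset Var) (s : M.State) : M.stateDist X s s = 0 := dist_self _

theorem isOpen_ball (X : Finset Var) (s : M.State) (ρ : ℝ) :
    @IsOpen M.State (M.stateTopology X) {w | M.stateDist X s w < ρ} := by
  let _ := PseudoMetricSpace.induced (M.joint X) inferInstance
  have h : {w | M.stateDist X s w < ρ} = Metric.ball s ρ := by
    ext w
    rw [Metric.mem_ball, dist_comm]
    rfl
  rw [h]
  exact Metric.isOpen_ball

theorem exists_ball_subset {X : Finset Var} {O : Set M.State}
    (hO : @IsOpen M.State (M.stateTopology X) O) {s : M.State} (hs : s ∈ O) :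
    ∃ ε > 0, ∀ w, M.stateDist X s w < ε → w ∈ O := by
  let _ := PseudoMetricSpace.induced (M.joint X) inferInstance
  obtain ⟨ε, hε, h⟩ := Metric.isOpen_iff.1 hO s hs
  refine ⟨ε, hε, fun w hw => h ?_⟩
  rw [Metric.mem_ball, dist_comm]
  exact hw

theorem sat_K_iff {X : Finset Var} {φ : Formula Var ar} {s : M.State} :
    M.Sat (.K X φ) s ↔ ∃ ε > 0, ∀ w, M.stateDist X s w < ε → M.Sat φ w := by
  constructor
  · intro h
    obtain ⟨O, hO, hO', hs⟩ := (@mem_interior M.State (M.stateTopology X) _ _).1 h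
    obtain ⟨ε, hε, h⟩ := M.exists_ball_subset hO' hs
    exact ⟨ε, hε, fun w hw => hO (h w hw)⟩
  · rintro ⟨ε, hε, h⟩
    refine (@mem_interior M.State (M.stateTopology X) _ _).2
      ⟨{w | M.stateDist X s w < ε}, fun w hw => h w hw, M.isOpen_ball X s ε, ?_⟩
    simpa [stateDist_self] using hε

/-- Continuous dependence of `Y` on `X` at the state `w`. -/
def ContDep (X Y : Finset Var) (w : M.State) : Prop :=
  ∀ ε > 0, ∃ δ > 0, ∀ w', M.stateDist X w w' < δ → M.stateDist Y w w' < ε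

theorem ContDep.joint_eq {M : MetricModel Var ar} {X Y : Finset Var} {w w' : M.State}
    (h : M.ContDep X Y w) (hw : M.joint X w = M.joint X w') : M.joint Y w = M.joint Y w' := by
  rw [← stateDist_eq_zero] at hw ⊢
  refine le_antisymm (le_of_forall_pos_lt_add fun ε hε => ?_) dist_nonneg
  obtain ⟨δ, hδ, h⟩ := h ε hε
  simpa using h w' (by rwa [hw])

/-- Continuity at a state already forces equal `X`-values to give equal `Y`-values, so on the image
of a ball the function `F` can be read off from arbitrarily chosen preimages. -/
theorem sat_KDep_iff {X Y : Finset Var} {s : M.State} :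
    M.Sat (.KDep X Y) s ↔ ∃ ρ > 0, ∀ w, M.stateDist X s w < ρ → M.ContDep X Y w := by
  constructor
  · rintro ⟨O, hO, hs, F, hF, hFO⟩
    obtain ⟨ρ, hρ, hρO⟩ := M.exists_ball_subset hO hs
    refine ⟨ρ, hρ, fun w hw ε hε => ?_⟩
    have hwO := hρO w hw
    obtain ⟨δ₁, hδ₁, h₁⟩ := M.exists_ball_subset hO hwO
    obtain ⟨δ₂, hδ₂, h₂⟩ := Metric.continuousOn_iff.1 hF _ ⟨w, hwO, rfl⟩ ε hε
    refine ⟨min δ₁ δ₂, lt_min hδ₁ hδ₂, fun w' hw' => ?_⟩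
    have hw'O := h₁ w' (hw'.trans_le (min_le_left _ _))
    have := h₂ _ ⟨w', hw'O, rfl⟩ (by
      rw [dist_comm]; exact hw'.trans_le (min_le_right _ _))
    rw [hFO w hwO, hFO w' hw'O, dist_comm] at this
    exact this
  · rintro ⟨ρ, hρ, h⟩
    classical
    -- Off the image of the ball the value is a dummy and is never used.
    let F : (∀ x : X, M.Rng x) → (∀ y : Y, M.Rng y) := fun a =>
      if ha : ∃ w, M.stateDist X s w < ρ ∧ M.joint X w = a then M.joint Y ha.choose
      else M.joint Y s
    have hF : ∀ w, M.stateDist X s w < ρ → F (M.joint X w) = M.joint Y w := by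
      intro w hw
      have ha : ∃ w', M.stateDist X s w' < ρ ∧ M.joint X w' = M.joint X w := ⟨w, hw, rfl⟩
      have : F (M.joint X w) = M.joint Y ha.choose := dif_pos ha
      rw [this]
      exact (h _ ha.choose_spec.1).joint_eq ha.choose_spec.2
    refine ⟨_, M.isOpen_ball X s ρ, by simpa [stateDist_self] using hρ, F, ?_, hF⟩
    rw [Metric.continuousOn_iff]
    rintro _ ⟨w, hw, rfl⟩ ε hε
    obtain ⟨δ, hδ, hδ'⟩ := h w hw ε hε
    refine ⟨δ, hδ, ?_⟩
    rintro _ ⟨w', hw', rfl⟩ hd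
    rw [hF w hw, hF w' hw', dist_comm]
    exact hδ' w' (by rw [stateDist, dist_comm]; exact hd)

/-! ### Concretization -/

/-- The concrete model on the image of the states among the assignments. -/
def toConcrete : ConcreteMetricModel Var ar where
  toTypedMetricModel := M.toTypedMetricModel
  States := Set.range fun s x => M.val x s
  range_eq x := by
    ext a
    obtain ⟨s, rfl⟩ := M.surj x a
    simp

/-- The assignment defined by a state. -/
def toAssignment (s : M.State) : M.toConcrete.toMetricModel.State :=
  ⟨fun x => M.val x s, s, rfl⟩

theorem toAssignment_surjective : Function.Surjective M.toAssignment := by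
  rintro ⟨_, s, rfl⟩
  exact ⟨s, rfl⟩

/-- Every clause sees a state only through the values of its variables. The clauses for `K` are
compared in ε–δ form, since the two topologies live on different sets of states. -/
theorem sat_toAssignment (φ : Formula Var ar) (s : M.State) :
    M.toConcrete.toMetricModel.Sat φ (M.toAssignment s) ↔ M.Sat φ s := by
  induction φ generalizing s with
  | pred P xs => rfl
  | neg φ ih => exact not_congr (ih s)
  | and φ ψ ih₁ ih₂ => exact and_congr (ih₁ s) (ih₂ s)
  | D X φ ih =>
    exact M.toAssignment_surjective.forall.trans (forall_congr' fun w => imp_congr Iff.rfl (ih w))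
  | Dep X Y => exact M.toAssignment_surjective.forall.trans (forall_congr' fun w => Iff.rfl)
  | K X φ ih =>
    rw [sat_K_iff, sat_K_iff]
    exact exists_congr fun ε => and_congr Iff.rfl (M.toAssignment_surjective.forall.trans
      (forall_congr' fun w => imp_congr Iff.rfl (ih w)))
  | KDep X Y =>
    rw [sat_KDep_iff, sat_KDep_iff]
    refine exists_congr fun ρ => and_congr Iff.rfl (M.toAssignment_surjective.forall.trans
      (forall_congr' fun w => imp_congr Iff.rfl ?_))
    exact forall_congr' fun ε => imp_congr Iff.rfl (exists_congr fun δ => and_congr Iff.rfl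
      (M.toAssignment_surjective.forall.trans (forall_congr' fun w => Iff.rfl)))
  | UDep X Y =>
    exact forall_congr' fun ε => imp_congr Iff.rfl (exists_congr fun δ => and_congr Iff.rfl
      (M.toAssignment_surjective.forall.trans (forall_congr' fun w =>
        M.toAssignment_surjective.forall.trans (forall_congr' fun w => Iff.rfl))))

/-! ### Soundness -/

theorem sat_imp {φ ψ : Formula Var ar} {s : M.State} :
    M.Sat (φ.imp ψ) s ↔ (M.Sat φ s → M.Sat ψ s) := by
  simp [Formula.imp, Sat]

variable {M} in
theorem stateDist_union_lt [DecidableEq Var] {Y Z : Finset Var} {s t : M.State} {ε : ℝ}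
    (hε : 0 < ε) (hY : M.stateDist Y s t < ε) (hZ : M.stateDist Z s t < ε) :
    M.stateDist (Y ∪ Z) s t < ε := by
  rw [stateDist_lt_iff _ hε] at hY hZ ⊢
  intro x hx
  exact (Finset.mem_union.1 hx).elim (hY x) (hZ x)

theorem stateDist_empty (s t : M.State) : M.stateDist ∅ s t = 0 :=
  (M.stateDist_eq_zero).2 (Subsingleton.elim _ _)

variable {M} in
theorem ContDep.trans {X Y Z : Finset Var} {s : M.State} (h : M.ContDep X Y s)
    (h' : M.ContDep Y Z s) : M.ContDep X Z s := by
  intro ε hε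
  obtain ⟨δ, hδ, h₁⟩ := h' ε hε
  obtain ⟨η, hη, h₂⟩ := h δ hδ
  exact ⟨η, hη, fun w hw => h₁ w (h₂ w hw)⟩

theorem sat_of_provable [DecidableEq Var] {φ : Formula Var ar} (h : Provable φ) :
    ∀ s, M.Sat φ s := by
  induction h with
  | taut φ h => exact fun s => h (fun ψ => M.Sat ψ s) (fun _ => Iff.rfl) (fun _ _ => Iff.rfl)
  | modusPonens φ ψ _ _ ih₁ ih₂ => exact fun s => M.sat_imp.1 (ih₁ s) (ih₂ s)
  | dNec X φ _ ih => exact fun s w _ => ih w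
  | dDist X φ ψ =>
    intro s
    simp only [sat_imp, Sat]
    exact fun h₁ h₂ w hw => h₁ w hw (h₂ w hw)
  | dFactivity X φ =>
    intro s
    simp only [sat_imp, Sat]
    exact fun h => h s rfl
  | dFour X φ =>
    intro s
    simp only [sat_imp, Sat]
    exact fun h w hw w' hw' => h w' (hw.trans hw')
  | dFive X φ =>
    intro s
    simp only [sat_imp, Sat]
    exact fun h w hw h' => h fun w' hw' => h' w' (hw.symm.trans hw')
  | inclusion X Y hYX =>
    intro s w hw
    rw [joint_eq_iff] at hw ⊢
    exact fun x hx => hw x (hYX hx)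
  | additivity X Y Z =>
    intro s
    simp only [sat_imp, Sat]
    rintro ⟨h₁, h₂⟩ w hw
    have h₁ := h₁ w hw
    have h₂ := h₂ w hw
    rw [joint_eq_iff] at h₁ h₂ ⊢
    exact fun x hx => (Finset.mem_union.1 hx).elim (h₁ x) (h₂ x)
  | transitivity X Y Z =>
    intro s
    simp only [sat_imp, Sat]
    exact fun h w hw => h.2 w (h.1 w hw)
  | determinedDep X Y =>
    intro s
    simp only [sat_imp, Sat]
    exact fun h w hw w' hw' => (h w hw).symm.trans (h w' (hw.trans hw'))
  | transfer X Y φ =>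
    intro s
    simp only [sat_imp, Sat]
    exact fun h h' w hw => h' w (h w hw)
  | determinedAtoms P xs =>
    intro s
    simp only [sat_imp, Sat]
    intro h w hw
    rw [joint_eq_iff] at hw
    have : ∀ i, M.val (xs i) s = M.val (xs i) w := fun i => hw _ (by simp)
    simpa only [this] using h
  | kNec X φ _ ih =>
    intro s
    rw [sat_K_iff]
    exact ⟨1, one_pos, fun w _ => ih w⟩
  | kDist X φ ψ =>
    intro s
    simp only [sat_imp, sat_K_iff]
    rintro ⟨ε, hε, h⟩ ⟨δ, hδ, h'⟩
    exact ⟨min ε δ, lt_min hε hδ, fun w hw => h w (hw.trans_le (min_le_left _ _))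
      (h' w (hw.trans_le (min_le_right _ _)))⟩
  | veracity X φ =>
    intro s
    simp only [sat_imp, sat_K_iff]
    rintro ⟨ε, hε, h⟩
    exact h s (by rwa [stateDist_self])
  | posIntrospection X φ =>
    intro s
    simp only [sat_imp, sat_K_iff]
    rintro ⟨ε, hε, h⟩
    refine ⟨ε, hε, fun w hw => ⟨ε - M.stateDist X s w, sub_pos.2 hw, fun w' hw' => h w' ?_⟩⟩
    linarith [M.stateDist_triangle X s w w']
  | kInclusion X Y hYX =>
    intro s
    rw [sat_KDep_iff]
    exact ⟨1, one_pos, fun w _ ε hε => ⟨ε, hε, fun w' hw' =>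
      (M.stateDist_mono hYX _ _).trans_lt hw'⟩⟩
  | kAdditivity X Y Z =>
    intro s
    -- `Sat.eq_3` is the clause for conjunction alone; unfolding all of `Sat` would also open the
    -- clauses for `K_X Y`.
    simp only [sat_imp, sat_KDep_iff, Sat.eq_3]
    rintro ⟨⟨ρ₁, hρ₁, h₁⟩, ρ₂, hρ₂, h₂⟩
    refine ⟨min ρ₁ ρ₂, lt_min hρ₁ hρ₂, fun w hw ε hε => ?_⟩
    obtain ⟨δ₁, hδ₁, h₁⟩ := h₁ w (hw.trans_le (min_le_left _ _)) ε hε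
    obtain ⟨δ₂, hδ₂, h₂⟩ := h₂ w (hw.trans_le (min_le_right _ _)) ε hε
    exact ⟨min δ₁ δ₂, lt_min hδ₁ hδ₂, fun w' hw' => stateDist_union_lt hε
      (h₁ w' (hw'.trans_le (min_le_left _ _))) (h₂ w' (hw'.trans_le (min_le_right _ _)))⟩
  | kTransitivity X Y Z =>
    intro s
    simp only [sat_imp, sat_KDep_iff, Sat.eq_3]
    rintro ⟨⟨ρ₁, hρ₁, h₁⟩, ρ₂, hρ₂, h₂⟩
    -- Continuity at `s` pulls the `Y`-ball on which `Z` depends continuously on `Y` back to an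
    -- `X`-ball.
    obtain ⟨δ, hδ, h⟩ := h₁ s (by rwa [stateDist_self]) ρ₂ hρ₂
    exact ⟨min ρ₁ δ, lt_min hρ₁ hδ, fun w hw => (h₁ w (hw.trans_le (min_le_left _ _))).trans
      (h₂ w (h w (hw.trans_le (min_le_right _ _))))⟩
  | knowabilityOfDep X Y =>
    intro s
    simp only [sat_imp, sat_KDep_iff, sat_K_iff]
    rintro ⟨ρ, hρ, h⟩
    refine ⟨ρ, hρ, fun w hw => ⟨ρ - M.stateDist X s w, sub_pos.2 hw, fun w' hw' => h w' ?_⟩⟩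
    linarith [M.stateDist_triangle X s w w']
  | kTransfer X Y φ =>
    intro s
    simp only [sat_imp, sat_KDep_iff, sat_K_iff]
    rintro ⟨ρ, hρ, h⟩ ⟨ε, hε, h'⟩
    obtain ⟨δ, hδ, h⟩ := h s (by rwa [stateDist_self]) ε hε
    exact ⟨δ, hδ, fun w hw => h' w (h w hw)⟩
  | knowableDetermination X φ =>
    intro s
    simp only [sat_imp, sat_K_iff]
    rintro ⟨ε, hε, h⟩ w hw
    exact h w (by rwa [(M.stateDist_eq_zero).2 hw])
  | knowableDependence X Y =>
    intro s
    simp only [sat_imp, sat_KDep_iff]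
    rintro ⟨ρ, hρ, h⟩ w hw
    exact (h s (by rwa [stateDist_self])).joint_eq hw
  | knowledgeOfNecessity φ =>
    intro s
    simp only [sat_imp, Formula.known, Formula.all, sat_K_iff]
    exact fun h => ⟨1, one_pos, fun w _ => h w (Subsingleton.elim _ _)⟩
  | knowledgeOfConstants Y =>
    intro s
    simp only [sat_imp, Formula.knownVal, Formula.const, sat_KDep_iff]
    refine fun h => ⟨1, one_pos, fun w _ ε hε => ⟨1, one_pos, fun w' _ => ?_⟩⟩
    rwa [(M.stateDist_eq_zero).2 ((h w (Subsingleton.elim _ _)).symm.trans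
      (h w' (Subsingleton.elim _ _)))]
  | uInclusion X Y hYX =>
    exact fun s ε hε => ⟨ε, hε, fun w w' hw' => (M.stateDist_mono hYX _ _).trans_lt hw'⟩
  | uAdditivity X Y Z =>
    intro s
    simp only [sat_imp, Sat]
    rintro ⟨h₁, h₂⟩ ε hε
    obtain ⟨δ₁, hδ₁, h₁⟩ := h₁ ε hε
    obtain ⟨δ₂, hδ₂, h₂⟩ := h₂ ε hε
    exact ⟨min δ₁ δ₂, lt_min hδ₁ hδ₂, fun w w' hw' => stateDist_union_lt hε
      (h₁ w w' (hw'.trans_le (min_le_left _ _))) (h₂ w w' (hw'.trans_le (min_le_right _ _)))⟩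
  | uTransitivity X Y Z =>
    intro s
    simp only [sat_imp, Sat]
    rintro ⟨h₁, h₂⟩ ε hε
    obtain ⟨δ, hδ, h₂⟩ := h₂ ε hε
    obtain ⟨η, hη, h₁⟩ := h₁ δ hδ
    exact ⟨η, hη, fun w w' hw => h₂ w w' (h₁ w w' hw)⟩
  | uKnown X Y =>
    intro s
    simp only [sat_imp, Formula.known, sat_K_iff]
    exact fun h => ⟨1, one_pos, fun w _ => h⟩
  | uContinuity X Y =>
    intro s
    simp only [sat_imp, Formula.knownDep, Formula.known, sat_K_iff, sat_KDep_iff]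
    refine fun h => ⟨1, one_pos, fun w _ => ⟨1, one_pos, fun w' _ ε hε => ?_⟩⟩
    obtain ⟨δ, hδ, h⟩ := h ε hε
    exact ⟨δ, hδ, h w'⟩
  | uKnowledge X Y =>
    intro s
    simp only [sat_imp, Formula.knownVal, sat_KDep_iff]
    rintro ⟨ρ, hρ, h⟩ ε hε
    -- Since `d_∅` vanishes, every state lies in the ball, and continuity with respect to `∅` makes
    -- `Y` constant.
    refine ⟨1, one_pos, fun w w' _ => ?_⟩
    rwa [(M.stateDist_eq_zero).2 ((h w (by rwa [stateDist_empty])).joint_eq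
      (Subsingleton.elim _ _))]

end MetricModel

end LUD

namespace LUD

open Formula

variable {Var Pred : Type u} {ar : Pred → ℕ}

/-! ### Quasi-models -/

/-- The types `s` and `t` agree on the formulas whose truth value is determined by `Z`. -/
structure Agree (V : Finset Var) (Φ : Set (Formula Var ar)) (Z : Finset Var)
    (s t : Set (Formula Var ar)) : Prop where
  dep : ∀ Y ⊆ V, Dep Z Y ∈ s ↔ Dep Z Y ∈ t
  kdep : ∀ Y ⊆ V, KDep Z Y ∈ s ↔ KDep Z Y ∈ t
  d : ∀ ψ, D Z ψ ∈ Φ → (D Z ψ ∈ s ↔ D Z ψ ∈ t)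
  k : ∀ ψ, K Z ψ ∈ Φ → (K Z ψ ∈ s ↔ K Z ψ ∈ t)
  pred : ∀ P xs, pred P xs ∈ Φ → (∀ i, xs i ∈ Z) → (pred P xs ∈ s ↔ pred P xs ∈ t)

/-- The type `t` inherits from `s` the formulas that are stable under small changes of `Z`. -/
structure Inherit (V : Finset Var) (Φ : Set (Formula Var ar)) (Z : Finset Var)
    (s t : Set (Formula Var ar)) : Prop where
  kdep : ∀ Y ⊆ V, KDep Z Y ∈ s → KDep Z Y ∈ t
  k : ∀ ψ, K Z ψ ∈ Φ → K Z ψ ∈ s → K Z ψ ∈ t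

/-- The accessibility relation for `D_X`. -/
def DRel (V : Finset Var) (Φ : Set (Formula Var ar)) (X : Finset Var)
    (s t : Set (Formula Var ar)) : Prop :=
  ∀ Z ⊆ V, Dep X Z ∈ s → Agree V Φ Z s t

/-- The accessibility relation for `K_X`. -/
def KRel (V : Finset Var) (Φ : Set (Formula Var ar)) (X : Finset Var)
    (s t : Set (Formula Var ar)) : Prop :=
  ∀ Z ⊆ V, KDep X Z ∈ s → Inherit V Φ Z s t

/-- A relation of dependence between sets of variables: it is determined by a closure operator. -/
structure DepLike (V : Finset Var) (R : Finset Var → Finset Var → Prop) : Prop where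
  iff_forall : ∀ X ⊆ V, ∀ Y ⊆ V, R X Y ↔ ∀ y ∈ Y, R X {y}
  refl : ∀ X ⊆ V, ∀ x ∈ X, R X {x}
  trans : ∀ X ⊆ V, ∀ Y ⊆ V, ∀ Z ⊆ V, R X Y → R Y Z → R X Z

/-- A set `Φ` of formulas over the variables `V` that is closed under subformulas. -/
structure SubClosed (V : Finset Var) (Φ : Set (Formula Var ar)) : Prop where
  pred : ∀ P xs, pred P xs ∈ Φ → ∀ i, xs i ∈ V
  neg : ∀ ψ, neg ψ ∈ Φ → ψ ∈ Φ
  and : ∀ ψ χ, Formula.and ψ χ ∈ Φ → ψ ∈ Φ ∧ χ ∈ Φ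
  d : ∀ X ψ, D X ψ ∈ Φ → X ⊆ V ∧ ψ ∈ Φ
  dep : ∀ X Y, Dep X Y ∈ Φ → X ⊆ V ∧ Y ⊆ V
  k : ∀ X ψ, K X ψ ∈ Φ → X ⊆ V ∧ ψ ∈ Φ
  kdep : ∀ X Y, KDep X Y ∈ Φ → X ⊆ V ∧ Y ⊆ V
  udep : ∀ X Y, UDep X Y ∈ Φ → X ⊆ V ∧ Y ⊆ V

/-- A set `s` of formulas that respects the local axioms on `Φ` and on the dependence atoms
over `V`. -/
structure IsType (V : Finset Var) (Φ : Set (Formula Var ar)) (s : Set (Formula Var ar)) :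
    Prop where
  neg : ∀ ψ, neg ψ ∈ Φ → (neg ψ ∈ s ↔ ψ ∉ s)
  and : ∀ ψ χ, Formula.and ψ χ ∈ Φ → (Formula.and ψ χ ∈ s ↔ ψ ∈ s ∧ χ ∈ s)
  d : ∀ X ψ, D X ψ ∈ Φ → D X ψ ∈ s → ψ ∈ s
  k : ∀ X ψ, K X ψ ∈ Φ → K X ψ ∈ s → ψ ∈ s
  depLike : DepLike V fun X Y => Dep X Y ∈ s
  kdepLike : DepLike V fun X Y => KDep X Y ∈ s
  udepLike : DepLike V fun X Y => UDep X Y ∈ s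
  dep_of_kdep : ∀ X ⊆ V, ∀ Y ⊆ V, KDep X Y ∈ s → Dep X Y ∈ s
  kdep_of_udep : ∀ X ⊆ V, ∀ Y ⊆ V, UDep X Y ∈ s → KDep X Y ∈ s
  udep_of_const : ∀ X ⊆ V, ∀ Y ⊆ V, Dep ∅ Y ∈ s → UDep X Y ∈ s

/-- A set of types in which every failure of `D_X ψ` or `K_X ψ` is witnessed, and which is
connected by the relation for `D_∅`. -/
structure QuasiModel (V : Finset Var) (Φ : Set (Formula Var ar))
    (W : Set (Set (Formula Var ar))) : Prop where
  subClosed : SubClosed V Φ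
  isType : ∀ s ∈ W, IsType V Φ s
  d : ∀ s ∈ W, ∀ X ψ, D X ψ ∈ Φ → D X ψ ∉ s → ∃ t ∈ W, DRel V Φ X s t ∧ ψ ∉ t
  k : ∀ s ∈ W, ∀ X ψ, K X ψ ∈ Φ → K X ψ ∉ s → ∃ t ∈ W, KRel V Φ X s t ∧ ψ ∉ t
  all : ∀ s ∈ W, ∀ t ∈ W, DRel V Φ ∅ s t
  udep : ∀ s ∈ W, ∀ t ∈ W, ∀ X ⊆ V, ∀ Y ⊆ V, UDep X Y ∈ s → UDep X Y ∈ t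

/-! ### Subformulas -/

namespace Formula

/-- The variables of a formula. -/
def vars [DecidableEq Var] : Formula Var ar → Finset Var
  | pred _ xs => Finset.univ.image xs
  | neg φ => φ.vars
  | and φ ψ => φ.vars ∪ ψ.vars
  | D X φ => X ∪ φ.vars
  | Dep X Y => X ∪ Y
  | K X φ => X ∪ φ.vars
  | KDep X Y => X ∪ Y
  | UDep X Y => X ∪ Y

/-- The set of subformulas of a formula. -/
def subformulas : Formula Var ar → Set (Formula Var ar)
  | pred P xs => {pred P xs}
  | neg φ => insert (neg φ) φ.subformulas
  | and φ ψ => insert (and φ ψ) (φ.subformulas ∪ ψ.subformulas)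
  | D X φ => insert (D X φ) φ.subformulas
  | Dep X Y => {Dep X Y}
  | K X φ => insert (K X φ) φ.subformulas
  | KDep X Y => {KDep X Y}
  | UDep X Y => {UDep X Y}

theorem self_mem_subformulas (φ : Formula Var ar) : φ ∈ φ.subformulas := by
  cases φ <;> simp [subformulas]

theorem subClosed_subformulas [DecidableEq Var] (φ : Formula Var ar) {V : Finset Var}
    (hV : φ.vars ⊆ V) : SubClosed V φ.subformulas := by
  induction φ with
  | pred P xs =>
    constructor <;> simp only [subformulas, Set.mem_singleton_iff, reduceCtorEq] <;> try simp
    rintro Q ys rfl h i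
    cases h
    exact hV (by simp [vars])
  | neg φ ih =>
    have h := ih hV
    constructor <;> simp only [subformulas, Set.mem_insert_iff, reduceCtorEq, false_or]
    · exact h.pred
    · rintro ψ (h' | h')
      · cases h'; exact Or.inr (self_mem_subformulas _)
      · exact Or.inr (h.neg _ h')
    · exact fun ψ χ h' => ⟨Or.inr (h.and _ _ h').1, Or.inr (h.and _ _ h').2⟩
    · exact fun X ψ h' => ⟨(h.d _ _ h').1, Or.inr (h.d _ _ h').2⟩
    · exact h.dep
    · exact fun X ψ h' => ⟨(h.k _ _ h').1, Or.inr (h.k _ _ h').2⟩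
    · exact h.kdep
    · exact h.udep
  | and φ χ ih₁ ih₂ =>
    have h₁ := ih₁ (Finset.union_subset_left hV)
    have h₂ := ih₂ (Finset.union_subset_right hV)
    constructor <;>
      simp only [subformulas, Set.mem_insert_iff, Set.mem_union, reduceCtorEq, false_or]
    · exact fun P xs h => h.elim (h₁.pred P xs) (h₂.pred P xs)
    · exact fun ψ h => Or.inr (h.imp (h₁.neg ψ) (h₂.neg ψ))
    · rintro ψ ξ (h | h | h)
      · cases h
        exact ⟨Or.inr (Or.inl (self_mem_subformulas _)), Or.inr (Or.inr (self_mem_subformulas _))⟩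
      · exact ⟨Or.inr (Or.inl (h₁.and _ _ h).1), Or.inr (Or.inl (h₁.and _ _ h).2)⟩
      · exact ⟨Or.inr (Or.inr (h₂.and _ _ h).1), Or.inr (Or.inr (h₂.and _ _ h).2)⟩
    · rintro X ψ (h | h)
      · exact ⟨(h₁.d _ _ h).1, Or.inr (Or.inl (h₁.d _ _ h).2)⟩
      · exact ⟨(h₂.d _ _ h).1, Or.inr (Or.inr (h₂.d _ _ h).2)⟩
    · exact fun X Y h => h.elim (h₁.dep X Y) (h₂.dep X Y)
    · rintro X ψ (h | h)
      · exact ⟨(h₁.k _ _ h).1, Or.inr (Or.inl (h₁.k _ _ h).2)⟩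
      · exact ⟨(h₂.k _ _ h).1, Or.inr (Or.inr (h₂.k _ _ h).2)⟩
    · exact fun X Y h => h.elim (h₁.kdep X Y) (h₂.kdep X Y)
    · exact fun X Y h => h.elim (h₁.udep X Y) (h₂.udep X Y)
  | D Z φ ih =>
    have h := ih (Finset.union_subset_right hV)
    constructor <;> simp only [subformulas, Set.mem_insert_iff, reduceCtorEq, false_or]
    · exact h.pred
    · exact fun ψ h' => Or.inr (h.neg _ h')
    · exact fun ψ χ h' => ⟨Or.inr (h.and _ _ h').1, Or.inr (h.and _ _ h').2⟩
    · rintro X ψ (h' | h')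
      · cases h'
        exact ⟨Finset.union_subset_left hV, Or.inr (self_mem_subformulas _)⟩
      · exact ⟨(h.d _ _ h').1, Or.inr (h.d _ _ h').2⟩
    · exact h.dep
    · exact fun X ψ h' => ⟨(h.k _ _ h').1, Or.inr (h.k _ _ h').2⟩
    · exact h.kdep
    · exact h.udep
  | K Z φ ih =>
    have h := ih (Finset.union_subset_right hV)
    constructor <;> simp only [subformulas, Set.mem_insert_iff, reduceCtorEq, false_or]
    · exact h.pred
    · exact fun ψ h' => Or.inr (h.neg _ h')
    · exact fun ψ χ h' => ⟨Or.inr (h.and _ _ h').1, Or.inr (h.and _ _ h').2⟩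
    · exact fun X ψ h' => ⟨(h.d _ _ h').1, Or.inr (h.d _ _ h').2⟩
    · exact h.dep
    · rintro X ψ (h' | h')
      · cases h'
        exact ⟨Finset.union_subset_left hV, Or.inr (self_mem_subformulas _)⟩
      · exact ⟨(h.k _ _ h').1, Or.inr (h.k _ _ h').2⟩
    · exact h.kdep
    · exact h.udep
  | Dep X Y =>
    constructor <;> simp only [subformulas, Set.mem_singleton_iff, reduceCtorEq] <;> try simp
    exact ⟨Finset.union_subset_left hV, Finset.union_subset_right hV⟩
  | KDep X Y =>
    constructor <;> simp only [subformulas, Set.mem_singleton_iff, reduceCtorEq] <;> try simp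
    exact ⟨Finset.union_subset_left hV, Finset.union_subset_right hV⟩
  | UDep X Y =>
    constructor <;> simp only [subformulas, Set.mem_singleton_iff, reduceCtorEq] <;> try simp
    exact ⟨Finset.union_subset_left hV, Finset.union_subset_right hV⟩

end Formula

/-! ### Maximal theories -/

variable [DecidableEq Var]

/-- A set of formulas that contains the theorems of **LUD** and is closed under modus ponens. -/
structure IsTheory (T : Set (Formula Var ar)) : Prop where
  provable : ∀ φ, Provable φ → φ ∈ T
  mp : ∀ φ ψ, imp φ ψ ∈ T → φ ∈ T → ψ ∈ T

/-- A maximal consistent theory. -/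
structure IsMaximal (T : Set (Formula Var ar)) : Prop extends IsTheory T where
  neg_mem_iff : ∀ φ, neg φ ∈ T ↔ φ ∉ T

theorem taut_imp {φ ψ : Formula Var ar}
    (h : ∀ v : Formula Var ar → Prop, (∀ ψ, v (neg ψ) ↔ ¬ v ψ) →
      (∀ ψ χ, v (and ψ χ) ↔ v ψ ∧ v χ) → v φ → v ψ) : Provable (imp φ ψ) := by
  refine .taut _ fun v hn ha => ?_
  have := h v hn ha
  simp only [imp, hn, ha]
  tauto

namespace IsTheory

variable {T : Set (Formula Var ar)} (hT : IsTheory T)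
include hT

theorem mp_provable {φ ψ : Formula Var ar} (h : Provable (imp φ ψ)) (hφ : φ ∈ T) : ψ ∈ T :=
  hT.mp _ _ (hT.provable _ h) hφ

theorem and_mem_iff {φ ψ : Formula Var ar} : and φ ψ ∈ T ↔ φ ∈ T ∧ ψ ∈ T := by
  refine ⟨fun h => ⟨hT.mp_provable (taut_imp ?_) h, hT.mp_provable (taut_imp ?_) h⟩,
    fun h => hT.mp _ _ (hT.mp_provable (taut_imp ?_) h.1) h.2⟩
  all_goals
    intro v hn ha
    simp only [imp, hn, ha]
    tauto

/-- By the deduction theorem this is the theory generated by `T` and `φ`. -/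
theorem add (φ : Formula Var ar) : IsTheory {ψ | imp φ ψ ∈ T} where
  provable ψ h := by
    refine hT.mp_provable (taut_imp ?_) (hT.provable _ h)
    intro v hn ha
    simp only [imp, hn, ha]
    tauto
  mp ψ χ h₁ h₂ := by
    refine hT.mp _ _ (hT.mp_provable (taut_imp ?_) h₁) h₂
    intro v hn ha
    simp only [imp, hn, ha]
    tauto

/-- Lindenbaum's lemma. A theory maximal among those omitting `φ` is complete: if it omits `ψ`,
adjoining `ψ` must yield `φ`, so omitting both `ψ` and `¬ψ` would put `φ` itself in the theory. -/
theorem exists_maximal {φ : Formula Var ar} (hφ : φ ∉ T) :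
    ∃ T' ⊇ T, IsMaximal T' ∧ φ ∉ T' := by
  obtain ⟨T', hTT', hmax⟩ := zorn_subset_nonempty {S | IsTheory S ∧ φ ∉ S}
    (by
      intro c hc hchain hne
      refine ⟨⋃₀ c, ⟨⟨?_, ?_⟩, ?_⟩, fun s hs => Set.subset_sUnion_of_mem hs⟩
      · obtain ⟨S, hS⟩ := hne
        exact fun ψ hψ => ⟨S, hS, (hc hS).1.provable ψ hψ⟩
      · rintro ψ χ ⟨S, hS, h₁⟩ ⟨S', hS', h₂⟩
        rcases hchain.total hS hS' with h | h
        · exact ⟨S', hS', (hc hS').1.mp _ _ (h h₁) h₂⟩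
        · exact ⟨S, hS, (hc hS).1.mp _ _ h₁ (h h₂)⟩
      · rintro ⟨S, hS, h⟩
        exact (hc hS).2 h) T ⟨hT, hφ⟩
  obtain ⟨hT', hφ'⟩ := hmax.prop
  have key : ∀ ψ, ψ ∉ T' → imp ψ φ ∈ T' := by
    intro ψ hψ
    by_contra hc
    refine hψ (hmax.le_of_ge (y := {χ | imp ψ χ ∈ T'}) ⟨hT'.add ψ, hc⟩ ?_ ?_)
    · intro χ hχ
      refine hT'.mp_provable (taut_imp ?_) hχ
      intro v hn ha
      simp only [imp, hn, ha]
      tauto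
    · refine hT'.provable _ (taut_imp ?_)
      exact fun v hn ha h => h
  refine ⟨T', hTT', ⟨hT', fun ψ => ⟨fun h h' => hφ' ?_, fun h => ?_⟩⟩, hφ'⟩
  · refine hT'.mp _ _ (hT'.mp_provable (taut_imp ?_) h) h'
    intro v hn ha
    simp only [imp, hn, ha]
    tauto
  · by_contra h'
    refine hφ' (hT'.mp _ _ (hT'.mp_provable (taut_imp ?_) (key _ h)) (key _ h'))
    intro v hn ha
    simp only [imp, hn, ha]
    tauto

/-- A maximal extension of this theory that omits `ψ` is the witness for a failing `D_X ψ`. -/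
theorem unboxD (X : Finset Var) : IsTheory {ψ | D X ψ ∈ T} where
  provable ψ h := hT.provable _ (.dNec X ψ h)
  mp ψ χ h₁ h₂ := hT.mp _ _ (hT.mp_provable (.dDist X ψ χ) h₁) h₂

theorem unboxK (X : Finset Var) : IsTheory {ψ | K X ψ ∈ T} where
  provable ψ h := hT.provable _ (.kNec X ψ h)
  mp ψ χ h₁ h₂ := hT.mp _ _ (hT.mp_provable (.kDist X ψ χ) h₁) h₂

/-- Shared by the three kinds of dependence atoms: inclusion, additivity and transitivity make each
a closure operator, determined by its singletons because `Y` is finite. -/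
theorem depLike (V : Finset Var) (R : Finset Var → Finset Var → Formula Var ar)
    (h₁ : ∀ X Y, Y ⊆ X → Provable (R X Y))
    (h₂ : ∀ X Y Z, Provable (imp (and (R X Y) (R X Z)) (R X (Y ∪ Z))))
    (h₃ : ∀ X Y Z, Provable (imp (and (R X Y) (R Y Z)) (R X Z))) :
    DepLike V fun X Y => R X Y ∈ T where
  iff_forall X _ Y _ := by
    constructor
    · intro h y hy
      exact hT.mp_provable (h₃ X Y {y}) (hT.and_mem_iff.2 ⟨h, hT.provable _ (h₁ _ _ (by simpa))⟩)
    · induction Y using Finset.induction_on with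
      | empty => exact fun _ => hT.provable _ (h₁ _ _ (by simp))
      | insert y Y _ ih =>
        intro h
        rw [Finset.insert_eq]
        refine hT.mp_provable (h₂ X {y} Y) (hT.and_mem_iff.2 ⟨h y (by simp), ih ?_ ?_⟩)
        · exact (Finset.subset_insert _ _).trans ‹_›
        · exact fun z hz => h z (by simp [hz])
  refl X _ x hx := hT.provable _ (h₁ _ _ (by simpa))
  trans X _ Y _ Z _ h h' := hT.mp_provable (h₃ X Y Z) (hT.and_mem_iff.2 ⟨h, h'⟩)

end IsTheory

/-- A formula is `Z`-determined if its truth provably implies that it is determined by `Z`. -/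
def Determined (Z : Finset Var) (φ : Formula Var ar) : Prop := Provable (imp φ (D Z φ))

/-- A formula is `Z`-stable if its truth provably implies that it is knowable given `Z`. -/
def Stable (Z : Finset Var) (φ : Formula Var ar) : Prop := Provable (imp φ (K Z φ))

theorem provable_imp_trans {φ ψ χ : Formula Var ar} (h₁ : Provable (imp φ ψ))
    (h₂ : Provable (imp ψ χ)) : Provable (imp φ χ) := by
  refine .modusPonens _ _ (.modusPonens _ _ (taut_imp (φ := imp φ ψ) ?_) h₁) h₂
  intro v hn ha
  simp only [imp, hn, ha]
  tauto

theorem Stable.determined {Z : Finset Var} {φ : Formula Var ar} (h : Stable Z φ) :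
    Determined Z φ := provable_imp_trans h (.knowableDetermination Z φ)

theorem stable_udep (X Y : Finset Var) : Stable ∅ (UDep X Y : Formula Var ar) := .uKnown X Y

theorem Determined.stable_empty {φ : Formula Var ar} (h : Determined ∅ φ) : Stable ∅ φ :=
  provable_imp_trans h (.knowledgeOfNecessity φ)

namespace IsMaximal

variable {S T : Set (Formula Var ar)}

theorem mem_of_determined (hS : IsMaximal S) {X Z : Finset Var} (h : {χ | D X χ ∈ S} ⊆ T)
    (hXZ : Dep X Z ∈ S) {φ : Formula Var ar} (hφ : Determined Z φ) (hφS : φ ∈ S) : φ ∈ T :=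
  h (hS.mp _ _ (hS.mp_provable (.transfer X Z φ) hXZ) (hS.mp_provable hφ hφS))

/-- The converse direction comes from negative introspection: if `φ` fails in `S`, then so does `D_Z
φ`, and `¬D_Z φ` is itself `Z`-determined. -/
theorem mem_iff_of_determined (hS : IsMaximal S) (hT : IsMaximal T) {X Z : Finset Var}
    (h : {χ | D X χ ∈ S} ⊆ T) (hXZ : Dep X Z ∈ S) {φ : Formula Var ar} (hφ : Determined Z φ) :
    φ ∈ S ↔ φ ∈ T := by
  refine ⟨hS.mem_of_determined h hXZ hφ, fun hφT => ?_⟩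
  by_contra hφS
  have h₁ : neg (D Z φ) ∈ S :=
    (hS.neg_mem_iff _).2 fun h' => hφS (hS.mp_provable (.dFactivity Z φ) h')
  have h₂ := hS.mem_of_determined h hXZ (.dFive Z φ) h₁
  exact (hT.neg_mem_iff _).1 h₂ (hT.mp_provable hφ hφT)

/-- Knowability has no negative introspection, so truth passes in one direction only; hence `KRel`
asks for `Inherit` where `DRel` asks for `Agree`. -/
theorem mem_of_stable (hS : IsMaximal S) {X Z : Finset Var} (h : {χ | K X χ ∈ S} ⊆ T)
    (hXZ : KDep X Z ∈ S) {φ : Formula Var ar} (hφ : Stable Z φ) (hφS : φ ∈ S) : φ ∈ T :=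
  h (hS.mp _ _ (hS.mp_provable (.kTransfer X Z φ) hXZ) (hS.mp_provable hφ hφS))

/-- All five kinds of formulas are `Z`-determined; those about knowability are so because `K_Z φ`
implies `D_Z φ`. -/
theorem dRel (hS : IsMaximal S) (hT : IsMaximal T) (V : Finset Var) (Φ : Set (Formula Var ar))
    {X : Finset Var} (h : {χ | D X χ ∈ S} ⊆ T) : DRel V Φ X S T := by
  intro Z _ hXZ
  refine ⟨fun Y _ => ?_, fun Y _ => ?_, fun ψ _ => ?_, fun ψ _ => ?_, fun P xs _ hxs => ?_⟩
  · exact hS.mem_iff_of_determined hT h hXZ (.determinedDep Z Y)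
  · exact hS.mem_iff_of_determined hT h hXZ (Stable.determined (.knowabilityOfDep Z Y))
  · exact hS.mem_iff_of_determined hT h hXZ (.dFour Z ψ)
  · exact hS.mem_iff_of_determined hT h hXZ (Stable.determined (.posIntrospection Z ψ))
  · refine hS.mem_iff_of_determined hT h (Z := Finset.univ.image xs) ?_ (.determinedAtoms P xs)
    refine hS.mp_provable (.transitivity X Z _) (hS.and_mem_iff.2 ⟨hXZ, ?_⟩)
    exact hS.provable _ (.inclusion _ _ (by simpa [Finset.image_subset_iff] using hxs))

theorem kRel (hS : IsMaximal S) (V : Finset Var) (Φ : Set (Formula Var ar))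
    {X : Finset Var} (h : {χ | K X χ ∈ S} ⊆ T) : KRel V Φ X S T := fun Z _ hXZ =>
  ⟨fun Y _ => hS.mem_of_stable h hXZ (.knowabilityOfDep Z Y),
    fun ψ _ => hS.mem_of_stable h hXZ (.posIntrospection Z ψ)⟩

theorem isType (hS : IsMaximal S) (V : Finset Var) (Φ : Set (Formula Var ar)) :
    IsType V Φ S where
  neg ψ _ := hS.neg_mem_iff ψ
  and _ _ _ := hS.and_mem_iff
  d X ψ _ := hS.mp_provable (.dFactivity X ψ)
  k X ψ _ := hS.mp_provable (.veracity X ψ)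
  depLike := hS.depLike V Dep .inclusion .additivity .transitivity
  kdepLike := hS.depLike V KDep .kInclusion .kAdditivity .kTransitivity
  udepLike := hS.depLike V UDep .uInclusion .uAdditivity .uTransitivity
  dep_of_kdep X _ Y _ := hS.mp_provable (.knowableDependence X Y)
  kdep_of_udep X _ Y _ h :=
    hS.mp_provable (.veracity ∅ _) (hS.mp_provable (.uContinuity X Y) h)
  udep_of_const X _ Y _ h :=
    hS.mp_provable (.uKnowledge X Y) (hS.mp_provable (.knowledgeOfConstants Y) h)

end IsMaximal

/-- Every unprovable formula is refuted in a quasi-model. -/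
theorem exists_quasiModel {φ : Formula Var ar} (hφ : ¬ Provable φ) :
    ∃ W, QuasiModel φ.vars φ.subformulas W ∧ ∃ s ∈ W, φ ∉ s := by
  obtain ⟨S₀, -, hS₀, hφS₀⟩ := IsTheory.exists_maximal (T := {φ : Formula Var ar | Provable φ})
    ⟨fun _ h => h, .modusPonens⟩ hφ
  have hS₀D : {χ | D ∅ χ ∈ S₀} ⊆ S₀ := fun χ h => hS₀.mp_provable (.dFactivity ∅ χ) h
  have empty {S : Set (Formula Var ar)} (hS : IsMaximal S) (X : Finset Var) : Dep X ∅ ∈ S :=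
    hS.provable _ (.inclusion _ _ (by simp))
  have kempty {S : Set (Formula Var ar)} (hS : IsMaximal S) (X : Finset Var) : KDep X ∅ ∈ S :=
    hS.provable _ (.kInclusion _ _ (by simp))
  -- The equivalence class of `S₀` under the universal modality, so that any two types are related
  -- by `DRel` for `∅`.
  refine ⟨{S | IsMaximal S ∧ {χ | D ∅ χ ∈ S₀} ⊆ S},
    ⟨subClosed_subformulas φ subset_rfl, fun S hS => hS.1.isType _ _, ?_, ?_, ?_, ?_⟩,
    S₀, ⟨hS₀, hS₀D⟩, hφS₀⟩
  · rintro S ⟨hS, hS₀S⟩ X ψ - hψ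
    obtain ⟨T, hST, hT, hψT⟩ := (hS.unboxD X).exists_maximal hψ
    refine ⟨T, ⟨hT, fun χ hχ => ?_⟩, hS.dRel hT _ _ hST, hψT⟩
    have h₁ : D ∅ χ ∈ S := hS₀S (hS₀.mp_provable (.dFour ∅ χ) hχ)
    exact hT.mp_provable (.dFactivity ∅ χ)
      (hS.mem_of_determined hST (empty hS X) (.dFour ∅ χ) h₁)
  · rintro S ⟨hS, hS₀S⟩ X ψ - hψ
    obtain ⟨T, hST, hT, hψT⟩ := (hS.unboxK X).exists_maximal hψ
    refine ⟨T, ⟨hT, fun χ hχ => ?_⟩, hS.kRel _ _ hST, hψT⟩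
    have h₁ : D ∅ χ ∈ S := hS₀S (hS₀.mp_provable (.dFour ∅ χ) hχ)
    -- The witness stays in the class because necessary truths are known: `D_∅ χ` is `∅`-stable.
    exact hT.mp_provable (.dFactivity ∅ χ)
      (hS.mem_of_stable hST (kempty hS X) (Determined.stable_empty (.dFour ∅ χ)) h₁)
  all_goals
    rintro S ⟨hS, hS₀S⟩ T ⟨hT, hS₀T⟩
    have h : {χ | D ∅ χ ∈ S} ⊆ T := fun χ hχ => by
      refine hT.mp_provable (.dFactivity ∅ χ) ?_
      refine (hS₀.mem_iff_of_determined hT hS₀T (empty hS₀ ∅) (.dFour ∅ χ)).1 ?_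
      exact (hS₀.mem_iff_of_determined hS hS₀S (empty hS₀ ∅) (.dFour ∅ χ)).2 hχ
  · exact hS.dRel hT _ _ h
  · exact fun X _ Y _ => hS.mem_of_determined h (empty hS ∅) (stable_udep X Y).determined

end LUD

namespace LUD

open Formula

/-! ### The ultrametric on the branches of a labelled tree -/

section TreeDist

variable {P L : Type u} (w : P → L × P → ℝ)

/-- The largest weight of an edge of a path that starts at `p`. -/
def height : P → List (L × P) → ℝ
  | _, [] => 0
  | p, e :: l => max (w p e) (height e.2 l)

/-- The endpoint of a path that starts at `p`. -/
def endpt : P → List (L × P) → P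
  | p, [] => p
  | _, e :: l => endpt e.2 l

open Classical in
/-- The largest weight of an edge on the way from one path to another. -/
noncomputable def treeDist : P → List (L × P) → List (L × P) → ℝ
  | p, [], l => height w p l
  | p, e :: l, [] => height w p (e :: l)
  | p, e :: l, e' :: l' =>
    if e = e' then treeDist e.2 l l' else max (height w p (e :: l)) (height w p (e' :: l'))

@[simp] theorem endpt_nil (p : P) : endpt p ([] : List (L × P)) = p := rfl

@[simp] theorem endpt_cons (p : P) (e : L × P) (l : List (L × P)) :
    endpt p (e :: l) = endpt e.2 l := rfl

@[simp] theorem endpt_append (p : P) (l l' : List (L × P)) :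
    endpt p (l ++ l') = endpt (endpt p l) l' := by
  induction l generalizing p with
  | nil => rfl
  | cons e l ih => exact ih _

@[simp] theorem height_nil (p : P) : height w p [] = 0 := rfl

theorem height_cons (p : P) (e : L × P) (l : List (L × P)) :
    height w p (e :: l) = max (w p e) (height w e.2 l) := rfl

@[simp] theorem treeDist_nil_left (p : P) (l : List (L × P)) :
    treeDist w p [] l = height w p l := by
  rw [treeDist]

@[simp] theorem treeDist_nil_right (p : P) (l : List (L × P)) :
    treeDist w p l [] = height w p l := by
  cases l <;> rw [treeDist]

@[simp] theorem treeDist_cons_self (p : P) (e : L × P) (l l' : List (L × P)) :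
    treeDist w p (e :: l) (e :: l') = treeDist w e.2 l l' := by
  rw [treeDist, if_pos rfl]

theorem treeDist_cons_ne (p : P) {e e' : L × P} (h : e ≠ e') (l l' : List (L × P)) :
    treeDist w p (e :: l) (e' :: l') = max (height w p (e :: l)) (height w p (e' :: l')) := by
  rw [treeDist, if_neg h]

variable {w} in
theorem height_nonneg (hw : ∀ p e, 0 ≤ w p e) (p : P) (l : List (L × P)) : 0 ≤ height w p l := by
  cases l with
  | nil => exact le_rfl
  | cons e l => exact (hw p e).trans (le_max_left _ _)

/-- The point where the two paths part is chosen before the weight, hence is the same for all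
variables. -/
theorem exists_common_prefix (p : P) (l l' : List (L × P)) :
    ∃ c a b, l = c ++ a ∧ l' = c ++ b ∧ ∀ w : P → L × P → ℝ, (∀ p e, 0 ≤ w p e) →
      treeDist w p l l' = max (height w (endpt p c) a) (height w (endpt p c) b) := by
  induction l generalizing p l' with
  | nil => exact ⟨[], [], l', rfl, rfl, fun w hw => by simp [height_nonneg hw]⟩
  | cons e l ih =>
    cases l' with
    | nil => exact ⟨[], e :: l, [], rfl, rfl, fun w hw => by simp [height_nonneg hw]⟩
    | cons e' l' =>
      by_cases h : e = e'
      · subst h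
        obtain ⟨c, a, b, rfl, rfl, h⟩ := ih e.2 l'
        exact ⟨e :: c, a, b, rfl, rfl, fun w hw => by simp [h w hw]⟩
      · exact ⟨[], e :: l, e' :: l', rfl, rfl, fun w _ => treeDist_cons_ne w p h l l'⟩

theorem treeDist_comm (p : P) (l l' : List (L × P)) :
    treeDist w p l l' = treeDist w p l' l := by
  induction l generalizing p l' with
  | nil => simp
  | cons e l ih =>
    cases l' with
    | nil => simp
    | cons e' l' =>
      by_cases h : e = e'
      · subst h
        simpa using ih _ _
      · rw [treeDist_cons_ne w p h, treeDist_cons_ne w p (Ne.symm h), max_comm]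

@[simp] theorem treeDist_self (p : P) (l : List (L × P)) : treeDist w p l l = 0 := by
  induction l generalizing p with
  | nil => simp
  | cons e l ih => simpa using ih _

theorem treeDist_le_max_height (p : P) (l l' : List (L × P)) :
    treeDist w p l l' ≤ max (height w p l) (height w p l') := by
  induction l generalizing p l' with
  | nil => simp
  | cons e l ih =>
    cases l' with
    | nil => simp
    | cons e' l' =>
      by_cases h : e = e'
      · subst h
        rw [treeDist_cons_self]
        exact (ih _ _).trans (max_le_max (le_max_right _ _) (le_max_right _ _))
      · rw [treeDist_cons_ne w p h]

variable {w} (hw : ∀ p e, 0 ≤ w p e)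
include hw

theorem treeDist_nonneg (p : P) (l l' : List (L × P)) : 0 ≤ treeDist w p l l' := by
  obtain ⟨c, a, b, -, -, h⟩ := exists_common_prefix p l l'
  rw [h w hw]
  exact (height_nonneg hw _ _).trans (le_max_left _ _)

theorem treeDist_append_singleton (p : P) (l : List (L × P)) (e : L × P) :
    treeDist w p l (l ++ [e]) = w (endpt p l) e := by
  induction l generalizing p with
  | nil => simp [height_cons, hw]
  | cons e' l ih => simpa using ih _

theorem height_le_max_treeDist (p : P) (l l' : List (L × P)) :
    height w p l ≤ max (height w p l') (treeDist w p l l') := by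
  induction l generalizing p l' with
  | nil => simp [height_nonneg hw]
  | cons e l ih =>
    cases l' with
    | nil => simp
    | cons e' l' =>
      by_cases h : e = e'
      · subst h
        rw [treeDist_cons_self, height_cons, height_cons]
        refine max_le ((le_max_left _ _).trans (le_max_left _ _)) ((ih _ l').trans ?_)
        exact max_le_max (le_max_right _ _) le_rfl
      · rw [treeDist_cons_ne w p h]
        exact (le_max_left _ _).trans (le_max_right _ _)

/-- If `a`, `b` or `b`, `c` part at the root, their distance is the maximum of their heights and
dominates; otherwise all three share the first edge, which can be removed. -/
theorem treeDist_ultra (p : P) (a b c : List (L × P)) :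
    treeDist w p a c ≤ max (treeDist w p a b) (treeDist w p b c) := by
  have key (p : P) (a b c : List (L × P))
      (h : treeDist w p b c = max (height w p b) (height w p c)) :
      treeDist w p a c ≤ max (treeDist w p a b) (treeDist w p b c) := by
    refine (treeDist_le_max_height w p a c).trans (max_le ?_ ?_)
    · refine (height_le_max_treeDist hw p a b).trans (max_le ?_ (le_max_left _ _))
      rw [h]
      exact (le_max_left _ _).trans (le_max_right _ _)
    · rw [h]
      exact (le_max_right _ _).trans (le_max_right _ _)
  have key' (p : P) (a b c : List (L × P))
      (h : treeDist w p a b = max (height w p a) (height w p b)) :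
      treeDist w p a c ≤ max (treeDist w p a b) (treeDist w p b c) := by
    rw [treeDist_comm w p a c, treeDist_comm w p a b, treeDist_comm w p b c, max_comm]
    refine key p c b a ?_
    rw [treeDist_comm, h, max_comm]
  induction b generalizing p a c with
  | nil => exact key p a [] c (by simp [height_nonneg hw])
  | cons f b ih =>
    cases a with
    | nil => exact key' p [] (f :: b) c (by simp [height_nonneg hw])
    | cons e a =>
      cases c with
      | nil => exact key p (e :: a) (f :: b) [] (by simp [height_nonneg hw])
      | cons g c =>
        by_cases h₁ : e = f
        · by_cases h₂ : f = g
          · subst h₁ h₂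
            simpa using ih _ _ _
          · exact key _ _ _ _ (treeDist_cons_ne w p h₂ _ _)
        · exact key' _ _ _ _ (treeDist_cons_ne w p h₁ _ _)

/-- The positive heights of the final segments of a path are bounded away from zero. -/
theorem exists_pos_le_height (p : P) (l : List (L × P)) :
    ∃ δ > 0, ∀ c a, l = c ++ a → height w (endpt p c) a < δ → height w (endpt p c) a = 0 := by
  induction l generalizing p with
  | nil =>
    refine ⟨1, one_pos, fun c a h _ => ?_⟩
    obtain ⟨rfl, rfl⟩ := List.append_eq_nil_iff.1 h.symm
    rfl
  | cons e l ih =>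
    obtain ⟨δ, hδ, h⟩ := ih e.2
    have main (η : ℝ) (hη : η ≤ δ)
        (hη' : height w p (e :: l) < η → height w p (e :: l) = 0) (c a : List (L × P))
        (hca : e :: l = c ++ a) (hlt : height w (endpt p c) a < η) :
        height w (endpt p c) a = 0 := by
      cases c with
      | nil =>
        obtain rfl : e :: l = a := hca
        exact hη' hlt
      | cons f c =>
        obtain ⟨rfl, rfl⟩ := List.cons_eq_cons.1 hca
        exact h c a rfl (hlt.trans_le hη)
    -- The whole path is the only final segment not already covered by induction; its height matters
    -- only if it is positive.
    rcases (height_nonneg hw p (e :: l)).eq_or_lt with h₀ | h₀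
    · exact ⟨δ, hδ, main δ le_rfl fun _ => h₀.symm⟩
    · exact ⟨min δ (height w p (e :: l)), lt_min hδ h₀, main _ (min_le_left _ _)
        fun h => absurd (h.trans_le (min_le_right _ _)) (lt_irrefl _)⟩

end TreeDist

theorem exists_pos_forall_le {ι : Type*} (Z : Finset ι) (δ : ι → ℝ) (hδ : ∀ i ∈ Z, 0 < δ i) :
    ∃ η > 0, η ≤ 1 ∧ ∀ i ∈ Z, η ≤ δ i := by
  classical
  induction Z using Finset.induction_on with
  | empty => exact ⟨1, one_pos, le_rfl, by simp⟩
  | insert i Z _ ih =>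
    obtain ⟨η, hη, h₁, h⟩ := ih fun j hj => hδ j (by simp [hj])
    refine ⟨min η (δ i), lt_min hη (hδ i (by simp)), (min_le_left _ _).trans h₁, fun j hj => ?_⟩
    rcases Finset.mem_insert.1 hj with rfl | hj
    · exact min_le_right _ _
    · exact (min_le_left _ _).trans (h j hj)

/-! ### The weights of the edges over a quasi-model -/

/-- Labels of edges: a change that keeps `X` fixed, or the `n`-th small change of `X`. -/
inductive Label (Var : Type u) : Type u
  | det (X : Finset Var) : Label Var
  | know (X : Finset Var) (n : ℕ) : Label Var

variable {Var Pred : Type u} {ar : Pred → ℕ}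

/-- The variables that are constant in the model over a quasi-model. -/
def ConstVar (V : Finset Var) (W : Set (Set (Formula Var ar))) (x : Var) : Prop :=
  x ∉ V ∨ ∀ s ∈ W, Dep ∅ {x} ∈ s

/-- A node of the tree: a type, and a modulus that bounds the local Lipschitz constants. -/
abbrev Node (W : Set (Set (Formula Var ar))) : Type u := W × ℕ

open Classical in
/-- The amount by which the variable `x` changes along an edge. -/
noncomputable def weight (V : Finset Var) (Φ : Set (Formula Var ar))
    (W : Set (Set (Formula Var ar))) (x : Var) (p : Node W) (e : Label Var × Node W) : ℝ :=
  if ConstVar V W x then 0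
  else if e.2.2 ≠ p.2 then 1
  else match e.1 with
    | .det X => if (X ⊆ V ∧ DRel V Φ X p.1 e.2.1) ∧ Dep X {x} ∈ p.1.1 then 0 else 1
    | .know X n =>
      if X ⊆ V ∧ KRel V Φ X p.1 e.2.1 then
        if UDep X {x} ∈ p.1.1 then 1 / (n + 1 : ℝ)
        else if KDep X {x} ∈ p.1.1 then min 1 ((p.2 + 1 : ℝ) / (n + 1)) else 1
      else 1

section Weight

variable {V : Finset Var} {Φ : Set (Formula Var ar)} {W : Set (Set (Formula Var ar))}

theorem weight_of_const {x : Var} (hx : ConstVar V W x) (p : Node W) (e : Label Var × Node W) :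
    weight V Φ W x p e = 0 := if_pos hx

/-- The three kinds of edges: jumps, changes that keep a set of variables fixed, and small
changes. -/
theorem edge_cases (V : Finset Var) (Φ : Set (Formula Var ar)) (p : Node W)
    (e : Label Var × Node W) :
    (∀ x, ¬ ConstVar V W x → weight V Φ W x p e = 1) ∨
    (∃ X ⊆ V, DRel V Φ X p.1 e.2.1 ∧ e.2.2 = p.2 ∧ ∀ x, ¬ ConstVar V W x →
      (Dep X {x} ∈ p.1.1 ∧ weight V Φ W x p e = 0) ∨
      (Dep X {x} ∉ p.1.1 ∧ weight V Φ W x p e = 1)) ∨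
    (∃ X ⊆ V, ∃ n : ℕ, KRel V Φ X p.1 e.2.1 ∧ e.2.2 = p.2 ∧ ∀ x, ¬ ConstVar V W x →
      (UDep X {x} ∈ p.1.1 ∧ weight V Φ W x p e = 1 / (n + 1 : ℝ)) ∨
      (UDep X {x} ∉ p.1.1 ∧ KDep X {x} ∈ p.1.1 ∧
        weight V Φ W x p e = min 1 ((p.2 + 1 : ℝ) / (n + 1))) ∨
      (UDep X {x} ∉ p.1.1 ∧ KDep X {x} ∉ p.1.1 ∧ weight V Φ W x p e = 1)) := by
  obtain ⟨l, t, N⟩ := e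
  by_cases hN : N = p.2
  swap
  · exact Or.inl fun x hx => by simp [weight, hx, hN]
  cases l with
  | det X =>
    by_cases h : X ⊆ V ∧ DRel V Φ X p.1 t
    · refine Or.inr (Or.inl ⟨X, h.1, h.2, hN, fun x hx => ?_⟩)
      by_cases h' : Dep X {x} ∈ p.1.1 <;> simp [weight, hx, hN, h, h']
    · exact Or.inl fun x hx => by simp [weight, hx, hN, h]
  | know X n =>
    by_cases h : X ⊆ V ∧ KRel V Φ X p.1 t
    · refine Or.inr (Or.inr ⟨X, h.1, n, h.2, hN, fun x hx => ?_⟩)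
      by_cases h₁ : UDep X {x} ∈ p.1.1 <;> by_cases h₂ : KDep X {x} ∈ p.1.1 <;>
        simp [weight, hx, hN, h, h₁, h₂]
    · exact Or.inl fun x hx => by simp [weight, hx, hN, h]

theorem weight_nonneg (x : Var) (p : Node W) (e : Label Var × Node W) :
    0 ≤ weight V Φ W x p e := by
  by_cases hx : ConstVar V W x
  · rw [weight_of_const hx]
  · rcases edge_cases V Φ p e with h | ⟨X, -, -, -, h⟩ | ⟨X, -, n, -, -, h⟩
    · rw [h x hx]; exact zero_le_one
    · rcases h x hx with ⟨-, h⟩ | ⟨-, h⟩ <;> simp [h]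
    · rcases h x hx with ⟨-, h⟩ | ⟨-, -, h⟩ | ⟨-, -, h⟩ <;> rw [h] <;> positivity

/-- Every weight possible for a non-constant variable on an `n`-th small change is at least 1/(n+1).
A bound on one such variable therefore bounds 1/(n+1), and with it the changes of the others. -/
theorem small_le_weight {x : Var} {X : Finset Var} {n : ℕ} {p : Node W} {e : Label Var × Node W}
    {r : ℝ} (hr : r < 1) (hxr : weight V Φ W x p e ≤ r)
    (h : (UDep X {x} ∈ p.1.1 ∧ weight V Φ W x p e = 1 / (n + 1 : ℝ)) ∨
      (UDep X {x} ∉ p.1.1 ∧ KDep X {x} ∈ p.1.1 ∧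
        weight V Φ W x p e = min 1 ((p.2 + 1 : ℝ) / (n + 1))) ∨
      (UDep X {x} ∉ p.1.1 ∧ KDep X {x} ∉ p.1.1 ∧ weight V Φ W x p e = 1)) :
    1 / (n + 1 : ℝ) ≤ weight V Φ W x p e := by
  have hn : 1 / (n + 1 : ℝ) ≤ 1 := by
    rw [div_le_one (by positivity)]
    linarith [Nat.cast_nonneg (α := ℝ) n]
  rcases h with h | h | h
  · exact h.2.ge
  · rw [h.2.2]
    refine le_min hn ?_
    gcongr
    linarith [Nat.cast_nonneg (α := ℝ) p.2]
  · linarith [h.2.2]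

/-! ### Agreement, inheritance and dependence along a single edge. -/

theorem Agree.refl {Z : Finset Var} (s : Set (Formula Var ar)) : Agree V Φ Z s s :=
  ⟨fun _ _ => Iff.rfl, fun _ _ => Iff.rfl, fun _ _ => Iff.rfl, fun _ _ => Iff.rfl,
    fun _ _ _ _ => Iff.rfl⟩

theorem Agree.symm {Z : Finset Var} {s t : Set (Formula Var ar)} (h : Agree V Φ Z s t) :
    Agree V Φ Z t s :=
  ⟨fun Y hY => (h.dep Y hY).symm, fun Y hY => (h.kdep Y hY).symm, fun ψ hψ => (h.d ψ hψ).symm,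
    fun ψ hψ => (h.k ψ hψ).symm, fun P xs hP hxs => (h.pred P xs hP hxs).symm⟩

theorem Agree.trans {Z : Finset Var} {s t r : Set (Formula Var ar)} (h : Agree V Φ Z s t)
    (h' : Agree V Φ Z t r) : Agree V Φ Z s r :=
  ⟨fun Y hY => (h.dep Y hY).trans (h'.dep Y hY), fun Y hY => (h.kdep Y hY).trans (h'.kdep Y hY),
    fun ψ hψ => (h.d ψ hψ).trans (h'.d ψ hψ), fun ψ hψ => (h.k ψ hψ).trans (h'.k ψ hψ),
    fun P xs hP hxs => (h.pred P xs hP hxs).trans (h'.pred P xs hP hxs)⟩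

theorem Agree.inherit {Z : Finset Var} {s t : Set (Formula Var ar)}
    (h : Agree V Φ Z s t) : Inherit V Φ Z s t :=
  ⟨fun Y hY => (h.kdep Y hY).1, fun ψ hψ => (h.k ψ hψ).1⟩

theorem Inherit.refl {Z : Finset Var} (s : Set (Formula Var ar)) : Inherit V Φ Z s s :=
  ⟨fun _ _ => id, fun _ _ => id⟩

theorem Inherit.trans {Z : Finset Var} {s t r : Set (Formula Var ar)} (h : Inherit V Φ Z s t)
    (h' : Inherit V Φ Z t r) : Inherit V Φ Z s r :=
  ⟨fun Y hY => h'.kdep Y hY ∘ h.kdep Y hY, fun ψ hψ => h'.k ψ hψ ∘ h.k ψ hψ⟩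

namespace QuasiModel

variable (hQ : QuasiModel V Φ W)
include hQ

/-- The atom `Dep ∅ {x}` is determined by `∅` and all types are connected by `DRel` for `∅`, so a
single type decides constancy. -/
theorem constVar_iff (s : W) {x : Var} (hx : x ∈ V) : ConstVar V W x ↔ Dep ∅ {x} ∈ s.1 := by
  refine ⟨fun h => h.elim (fun h => absurd hx h) fun h => h s s.2, fun h => Or.inr fun t ht => ?_⟩
  have hs := hQ.isType s s.2
  have h₁ : Dep ∅ ∅ ∈ s.1 := (hs.depLike.iff_forall ∅ (by simp) ∅ (by simp)).2 (by simp)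
  exact ((hQ.all s s.2 t ht ∅ (by simp) h₁).dep {x} (by simpa)).1 h

theorem dep_empty_of_const (s : W) {Z : Finset Var} (hZ : Z ⊆ V) (h : ∀ z ∈ Z, ConstVar V W z) :
    Dep ∅ Z ∈ s.1 :=
  ((hQ.isType s s.2).depLike.iff_forall ∅ (by simp) Z hZ).2 fun z hz =>
    (hQ.constVar_iff s (hZ hz)).1 (h z hz)

theorem dep_of_const (s : W) {X : Finset Var} (hX : X ⊆ V) {x : Var} (hxV : x ∈ V)
    (hx : ConstVar V W x) : UDep X {x} ∈ s.1 ∧ KDep X {x} ∈ s.1 ∧ Dep X {x} ∈ s.1 := by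
  have hs := hQ.isType s s.2
  have hx' : {x} ⊆ V := by simpa
  have h₁ := hs.udep_of_const X hX _ hx' ((hQ.constVar_iff s hxV).1 hx)
  have h₂ := hs.kdep_of_udep X hX _ hx' h₁
  exact ⟨h₁, h₂, hs.dep_of_kdep X hX _ hx' h₂⟩

/-- Settles dependence on constants only, where small distances say nothing about the kind of edge.
-/
theorem const_of_kdep (s : W) {Z : Finset Var} (hZ : Z ⊆ V) (h : ∀ z ∈ Z, ConstVar V W z)
    {y : Var} (hy : y ∈ V) (hZy : KDep Z {y} ∈ s.1) : ConstVar V W y := by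
  have hs := hQ.isType s s.2
  have hy' : {y} ⊆ V := by simpa
  exact (hQ.constVar_iff s hy).2 (hs.depLike.trans ∅ (by simp) Z hZ _ hy'
    (hQ.dep_empty_of_const s hZ h) (hs.dep_of_kdep Z hZ _ hy' hZy))

/-- A non-constant variable in `Z` with weight 0 rules out jumps and small changes, so the edge has
kind `det X` with `X` determining `Z`. If all of `Z` is constant, connectedness of the quasi-model
suffices. -/
theorem weight_agree {p : Node W} {e : Label Var × Node W} {Z : Finset Var} (hZ : Z ⊆ V)
    (h : ∀ z ∈ Z, weight V Φ W z p e = 0) : Agree V Φ Z p.1 e.2.1 := by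
  by_cases hc : ∀ z ∈ Z, ConstVar V W z
  · exact hQ.all _ p.1.2 _ e.2.1.2 Z hZ (hQ.dep_empty_of_const p.1 hZ hc)
  push Not at hc
  obtain ⟨z₀, hz₀, hc⟩ := hc
  rcases edge_cases V Φ p e with h' | ⟨X, hX, hR, -, h'⟩ | ⟨X, hX, n, hR, -, h'⟩
  · simpa [h' z₀ hc] using h z₀ hz₀
  · refine hR Z hZ (((hQ.isType _ p.1.2).depLike.iff_forall X hX Z hZ).2 fun z hz => ?_)
    by_cases hzc : ConstVar V W z
    · exact (hQ.dep_of_const p.1 hX (hZ hz) hzc).2.2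
    · rcases h' z hzc with h' | h'
      · exact h'.1
      · simp [h z hz] at h'
  · exfalso
    have h₀ := h z₀ hz₀
    rcases h' z₀ hc with ⟨-, h'⟩ | ⟨-, -, h'⟩ | ⟨-, -, h'⟩ <;> rw [h₀] at h'
    · exact absurd h' (by positivity)
    · exact absurd h' (by positivity)
    · norm_num at h'

/-- With a non-constant variable in `Z`, weights below 1 leave two possibilities: on a `det` edge
they are then 0 and `Z` agrees, and on a `know X n` edge `Z` depends knowably on `X`. -/
theorem weight_inherit {p : Node W} {e : Label Var × Node W} {Z : Finset Var} (hZ : Z ⊆ V)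
    (h : ∀ z ∈ Z, weight V Φ W z p e < 1) : Inherit V Φ Z p.1 e.2.1 := by
  by_cases hc : ∀ z ∈ Z, ConstVar V W z
  · exact (hQ.all _ p.1.2 _ e.2.1.2 Z hZ (hQ.dep_empty_of_const p.1 hZ hc)).inherit
  push Not at hc
  obtain ⟨z₀, hz₀, hc⟩ := hc
  rcases edge_cases V Φ p e with h' | ⟨X, hX, hR, -, h'⟩ | ⟨X, hX, n, hR, -, h'⟩
  · exact absurd (h' z₀ hc) (h z₀ hz₀).ne
  · refine (hQ.weight_agree hZ fun z hz => ?_).inherit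
    by_cases hzc : ConstVar V W z
    · exact weight_of_const hzc _ _
    · rcases h' z hzc with h' | h'
      · exact h'.2
      · exact absurd h'.2 (h z hz).ne
  · have hp := hQ.isType _ p.1.2
    refine hR Z hZ ((hp.kdepLike.iff_forall X hX Z hZ).2 fun z hz => ?_)
    by_cases hzc : ConstVar V W z
    · exact (hQ.dep_of_const p.1 hX (hZ hz) hzc).2.1
    · rcases h' z hzc with h' | h' | h'
      · exact hp.kdep_of_udep X hX _ (by simpa using hZ hz) h'.1
      · exact h'.2.1
      · exact absurd h'.2.2 (h z hz).ne

/-- On a `know X n` edge `X` knowably determines `Z`, hence `y`, so `y` moves by at most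
(N+1)/(n+1), while the non-constant variable of `Z` shows 1/(n+1) ≤ `r`. The second conclusion lets
the constant survive along a path. -/
theorem weight_le_mul_of_kdep {p : Node W} {e : Label Var × Node W} {Z : Finset Var} (hZ : Z ⊆ V)
    (hc : ∃ z ∈ Z, ¬ ConstVar V W z) {r : ℝ} (hr : r < 1)
    (h : ∀ z ∈ Z, weight V Φ W z p e ≤ r) {y : Var} (hy : y ∈ V) (hZy : KDep Z {y} ∈ p.1.1) :
    weight V Φ W y p e ≤ (p.2 + 1) * r ∧ e.2.2 = p.2 := by
  obtain ⟨z₀, hz₀, hc⟩ := hc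
  have hr₀ : 0 ≤ r := (weight_nonneg z₀ p e).trans (h z₀ hz₀)
  have hpos : 0 ≤ (p.2 + 1 : ℝ) * r := by positivity
  have hp := hQ.isType _ p.1.2
  have hy' : {y} ⊆ V := by simpa
  rcases edge_cases V Φ p e with h' | ⟨X, hX, hR, hN, h'⟩ | ⟨X, hX, n, hR, hN, h'⟩
  · have := h z₀ hz₀
    rw [h' z₀ hc] at this
    linarith
  · refine ⟨?_, hN⟩
    by_cases hyc : ConstVar V W y
    · rwa [weight_of_const hyc]
    have hXZ : Dep X Z ∈ p.1.1 := by
      refine (hp.depLike.iff_forall X hX Z hZ).2 fun z hz => ?_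
      by_cases hzc : ConstVar V W z
      · exact (hQ.dep_of_const p.1 hX (hZ hz) hzc).2.2
      · rcases h' z hzc with h' | h'
        · exact h'.1
        · linarith [h z hz]
    have hXy : Dep X {y} ∈ p.1.1 :=
      hp.depLike.trans X hX Z hZ _ hy' hXZ (hp.dep_of_kdep Z hZ _ hy' hZy)
    rcases h' y hyc with h' | h'
    · rwa [h'.2]
    · exact absurd hXy h'.1
  · refine ⟨?_, hN⟩
    by_cases hyc : ConstVar V W y
    · rwa [weight_of_const hyc]
    have hXZ : KDep X Z ∈ p.1.1 := by
      refine (hp.kdepLike.iff_forall X hX Z hZ).2 fun z hz => ?_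
      by_cases hzc : ConstVar V W z
      · exact (hQ.dep_of_const p.1 hX (hZ hz) hzc).2.1
      · rcases h' z hzc with h' | h' | h'
        · exact hp.kdep_of_udep X hX _ (by simpa using hZ hz) h'.1
        · exact h'.2.1
        · linarith [h z hz]
    have hXy : KDep X {y} ∈ p.1.1 := hp.kdepLike.trans X hX Z hZ _ hy' hXZ hZy
    have hn : 1 / (n + 1 : ℝ) ≤ r := (small_le_weight hr (h z₀ hz₀) (h' z₀ hc)).trans (h z₀ hz₀)
    rcases h' y hyc with h' | h' | h'
    · rw [h'.2]
      exact hn.trans (le_mul_of_one_le_left hr₀ (by linarith [Nat.cast_nonneg (α := ℝ) p.2]))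
    · rw [h'.2.2]
      refine (min_le_right _ _).trans ?_
      rw [div_eq_mul_one_div]
      exact mul_le_mul_of_nonneg_left hn (by positivity)
    · exact absurd hXy h'.2.1

theorem weight_le_of_udep {p : Node W} {e : Label Var × Node W} {Z : Finset Var} (hZ : Z ⊆ V)
    {r : ℝ} (hr₀ : 0 ≤ r) (hr : r < 1) (h : ∀ z ∈ Z, weight V Φ W z p e ≤ r) {y : Var}
    (hy : y ∈ V) (hZy : UDep Z {y} ∈ p.1.1) : weight V Φ W y p e ≤ r := by
  have hp := hQ.isType _ p.1.2
  have hy' : {y} ⊆ V := by simpa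
  have hZy' := hp.kdep_of_udep Z hZ _ hy' hZy
  by_cases hyc : ConstVar V W y
  · rwa [weight_of_const hyc]
  have hc : ∃ z ∈ Z, ¬ ConstVar V W z := by
    by_contra! hc
    exact hyc (hQ.const_of_kdep p.1 hZ hc hy hZy')
  obtain ⟨z₀, hz₀, hc⟩ := hc
  rcases edge_cases V Φ p e with h' | ⟨X, hX, hR, hN, h'⟩ | ⟨X, hX, n, hR, hN, h'⟩
  · have := h z₀ hz₀
    rw [h' z₀ hc] at this
    linarith
  -- On a `det` edge the weights are 0 or 1, so the bound `r < 1` improves to 0.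
  · have h₀ : ∀ z ∈ Z, weight V Φ W z p e ≤ 0 := by
      intro z hz
      by_cases hzc : ConstVar V W z
      · rw [weight_of_const hzc]
      · rcases h' z hzc with h' | h'
        · exact h'.2.le
        · linarith [h z hz]
    have := (hQ.weight_le_mul_of_kdep hZ ⟨z₀, hz₀, hc⟩ one_pos h₀ hy hZy').1
    rw [mul_zero] at this
    exact this.trans hr₀
  -- If all of `Z` depends uniformly on `X`, then so does `y`, which moves by 1/(n+1) only.
  -- Otherwise some variable of `Z` moves by the larger amount min(1, (N+1)/(n+1)), which bounds the
  -- change of `y`.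
  · by_cases hU : ∀ z ∈ Z, UDep X {z} ∈ p.1.1
    · have hXy : UDep X {y} ∈ p.1.1 := hp.udepLike.trans X hX Z hZ _ hy'
        ((hp.udepLike.iff_forall X hX Z hZ).2 hU) hZy
      rcases h' y hyc with h'' | h'' | h''
      · rw [h''.2]
        exact (small_le_weight hr (h z₀ hz₀) (h' z₀ hc)).trans (h z₀ hz₀)
      · exact absurd hXy h''.1
      · exact absurd hXy h''.1
    · push Not at hU
      obtain ⟨z₁, hz₁, hU⟩ := hU
      have hc₁ : ¬ ConstVar V W z₁ := fun hc₁ => hU (hQ.dep_of_const p.1 hX (hZ hz₁) hc₁).1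
      have hmin : min 1 ((p.2 + 1 : ℝ) / (n + 1)) ≤ r := by
        rcases h' z₁ hc₁ with h'' | h'' | h''
        · exact absurd h''.1 hU
        · rw [← h''.2.2]; exact h z₁ hz₁
        · linarith [h z₁ hz₁]
      have hXZ : KDep X Z ∈ p.1.1 := by
        refine (hp.kdepLike.iff_forall X hX Z hZ).2 fun z hz => ?_
        by_cases hzc : ConstVar V W z
        · exact (hQ.dep_of_const p.1 hX (hZ hz) hzc).2.1
        · rcases h' z hzc with h' | h' | h'
          · exact hp.kdep_of_udep X hX _ (by simpa using hZ hz) h'.1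
          · exact h'.2.1
          · linarith [h z hz]
      have hXy : KDep X {y} ∈ p.1.1 := hp.kdepLike.trans X hX Z hZ _ hy' hXZ hZy'
      rcases h' y hyc with h'' | h'' | h''
      · rw [h''.2]
        exact (small_le_weight hr (h z₀ hz₀) (h' z₀ hc)).trans (h z₀ hz₀)
      · rwa [h''.2.2]
      · exact absurd hXy h''.2.1

omit hQ in
-- No dependence between `x` and `y` is assumed: asking that `y` too changes by less than 1 replaces
-- it. This is where the second neighbourhood in the definition of pseudo-locally Lipschitz is
-- needed.
theorem weight_le_mul {p : Node W} {e : Label Var × Node W} {x y : Var} (hc : ¬ ConstVar V W x)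
    (hx : weight V Φ W x p e < 1) (hy : weight V Φ W y p e < 1) :
    weight V Φ W y p e ≤ (p.2 + 1) * weight V Φ W x p e ∧ e.2.2 = p.2 := by
  have hpos : 0 ≤ (p.2 + 1 : ℝ) * weight V Φ W x p e := by
    have := weight_nonneg (V := V) (Φ := Φ) x p e
    positivity
  rcases edge_cases V Φ p e with h' | ⟨X, hX, hR, hN, h'⟩ | ⟨X, hX, n, hR, hN, h'⟩
  · exact absurd (h' x hc) hx.ne
  · refine ⟨?_, hN⟩
    by_cases hyc : ConstVar V W y
    · rwa [weight_of_const hyc]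
    rcases h' y hyc with h' | h'
    · rwa [h'.2]
    · exact absurd h'.2 hy.ne
  · refine ⟨?_, hN⟩
    by_cases hyc : ConstVar V W y
    · rwa [weight_of_const hyc]
    have hn : 1 / (n + 1 : ℝ) ≤ weight V Φ W x p e := small_le_weight hx le_rfl (h' x hc)
    rcases h' y hyc with h' | h' | h'
    · rw [h'.2]
      exact hn.trans (le_mul_of_one_le_left (weight_nonneg x p e)
        (by linarith [Nat.cast_nonneg (α := ℝ) p.2]))
    · rw [h'.2.2]
      refine (min_le_right _ _).trans ?_
      rw [div_eq_mul_one_div]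
      exact mul_le_mul_of_nonneg_left hn (by positivity)
    · exact absurd h'.2.2 hy.ne

/-! ### Paths over a quasi-model -/

theorem height_agree {Z : Finset Var} (hZ : Z ⊆ V) (l : List (Label Var × Node W)) (p : Node W)
    (h : ∀ z ∈ Z, height (weight V Φ W z) p l = 0) : Agree V Φ Z p.1 (endpt p l).1 := by
  induction l generalizing p with
  | nil => exact .refl _
  | cons e l ih =>
    have h₁ : ∀ z ∈ Z, weight V Φ W z p e = 0 := fun z hz =>
      le_antisymm ((le_max_left _ _).trans (h z hz).le) (weight_nonneg _ _ _)
    have h₂ : ∀ z ∈ Z, height (weight V Φ W z) e.2 l = 0 := fun z hz =>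
      le_antisymm ((le_max_right _ _).trans (h z hz).le) (height_nonneg (weight_nonneg z) _ _)
    exact (hQ.weight_agree hZ h₁).trans (ih e.2 h₂)

theorem height_inherit {Z : Finset Var} (hZ : Z ⊆ V) (l : List (Label Var × Node W))
    (p : Node W) (h : ∀ z ∈ Z, height (weight V Φ W z) p l < 1) :
    Inherit V Φ Z p.1 (endpt p l).1 := by
  induction l generalizing p with
  | nil => exact .refl _
  | cons e l ih =>
    exact (hQ.weight_inherit hZ fun z hz => (le_max_left _ _).trans_lt (h z hz)).trans
      (ih e.2 fun z hz => (le_max_right _ _).trans_lt (h z hz))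

/-- Neither the atom `KDep Z {y}` nor the modulus is lost along the path, so the one-edge estimate
applies with the same constant throughout. -/
theorem height_le_mul_of_kdep {Z : Finset Var} (hZ : Z ⊆ V) (hc : ∃ z ∈ Z, ¬ ConstVar V W z)
    {r : ℝ} (hr₀ : 0 ≤ r) (hr : r < 1) {y : Var} (hy : y ∈ V)
    (l : List (Label Var × Node W)) (p : Node W)
    (h : ∀ z ∈ Z, height (weight V Φ W z) p l ≤ r) (hZy : KDep Z {y} ∈ p.1.1) :
    height (weight V Φ W y) p l ≤ (p.2 + 1) * r ∧ (endpt p l).2 = p.2 := by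
  induction l generalizing p with
  | nil => exact ⟨by rw [height_nil]; positivity, rfl⟩
  | cons e l ih =>
    have h₁ : ∀ z ∈ Z, weight V Φ W z p e ≤ r := fun z hz => (le_max_left _ _).trans (h z hz)
    obtain ⟨h₂, hN⟩ := hQ.weight_le_mul_of_kdep hZ hc hr h₁ hy hZy
    obtain ⟨h₃, hN'⟩ := ih e.2 (fun z hz => (le_max_right _ _).trans (h z hz))
      ((hQ.weight_inherit hZ fun z hz => (h₁ z hz).trans_lt hr).kdep _ (by simpa) hZy)
    rw [hN] at h₃ hN'
    exact ⟨max_le h₂ h₃, hN'⟩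

theorem height_le_of_udep {Z : Finset Var} (hZ : Z ⊆ V) {r : ℝ} (hr₀ : 0 ≤ r) (hr : r < 1)
    {y : Var} (hy : y ∈ V) (l : List (Label Var × Node W)) (p : Node W)
    (h : ∀ z ∈ Z, height (weight V Φ W z) p l ≤ r) (hZy : UDep Z {y} ∈ p.1.1) :
    height (weight V Φ W y) p l ≤ r := by
  induction l generalizing p with
  | nil => exact hr₀
  | cons e l ih =>
    exact max_le
      (hQ.weight_le_of_udep hZ hr₀ hr (fun z hz => (le_max_left _ _).trans (h z hz)) hy hZy)
      (ih e.2 (fun z hz => (le_max_right _ _).trans (h z hz))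
        (hQ.udep _ p.1.2 _ e.2.1.2 Z hZ _ (by simpa) hZy))

omit hQ in
theorem height_le_mul {x y : Var} (hc : ¬ ConstVar V W x) (l : List (Label Var × Node W))
    (p : Node W) (hx : height (weight V Φ W x) p l < 1) (hy : height (weight V Φ W y) p l < 1) :
    height (weight V Φ W y) p l ≤ (p.2 + 1) * height (weight V Φ W x) p l ∧
      (endpt p l).2 = p.2 := by
  induction l generalizing p with
  | nil => simp
  | cons e l ih =>
    rw [height_cons] at hx hy
    obtain ⟨h₁, hN⟩ := weight_le_mul hc (max_lt_iff.1 hx).1 (max_lt_iff.1 hy).1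
    obtain ⟨h₂, hN'⟩ := ih e.2 (max_lt_iff.1 hx).2 (max_lt_iff.1 hy).2
    rw [hN] at h₂ hN'
    refine ⟨max_le (h₁.trans ?_) (h₂.trans ?_), hN'⟩
    · exact mul_le_mul_of_nonneg_left (le_max_left _ _) (by positivity)
    · exact mul_le_mul_of_nonneg_left (le_max_right _ _) (by positivity)

end QuasiModel
end Weight

end LUD

namespace LUD

open Formula

/-! ### The metric model over a quasi-model -/

/-- The metric on a quotient of a pseudo-metric space. -/
@[reducible]
noncomputable def quotientMetric {S R : Type*} (d : S → S → ℝ) (hself : ∀ s, d s s = 0)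
    (hcomm : ∀ s t, d s t = d t s) (htri : ∀ s t r, d s r ≤ d s t + d t r) (f : S → R)
    (hf : Function.Surjective f) (h : ∀ s t, d s t = 0 → f s = f t) : MetricSpace R where
  dist a b := d (Function.surjInv hf a) (Function.surjInv hf b)
  dist_self a := hself _
  dist_comm a b := hcomm _ _
  dist_triangle a b c := htri _ _ _
  eq_of_dist_eq_zero {a b} hab := by
    simpa only [Function.surjInv_eq] using h _ _ hab

theorem quotientMetric_dist {S R : Type*} (d : S → S → ℝ) (hself : ∀ s, d s s = 0)
    (hcomm : ∀ s t, d s t = d t s) (htri : ∀ s t r, d s r ≤ d s t + d t r) (f : S → R)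
    (hf : Function.Surjective f) (h : ∀ s t, d s t = 0 → f s = f t)
    (h' : ∀ s t, f s = f t → d s t = 0) (s t : S) :
    (quotientMetric d hself hcomm htri f hf h).dist (f s) (f t) = d s t := by
  have key (s : S) : d s (Function.surjInv hf (f s)) = 0 :=
    h' _ _ (Function.surjInv_eq hf (f s)).symm
  change d (Function.surjInv hf (f s)) (Function.surjInv hf (f t)) = d s t
  have hs := key s
  have ht := key t
  set s' := Function.surjInv hf (f s)
  set t' := Function.surjInv hf (f t)
  linarith [htri s' s t', htri s t t', htri s s' t, htri s' t' t, hcomm s' s, hcomm t' t]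

variable {Var Pred : Type u} {ar : Pred → ℕ}

section Model

variable (V : Finset Var) (Φ : Set (Formula Var ar)) (W : Set (Set (Formula Var ar))) (s₀ : W)

/-- The states of the model: the finite paths over a quasi-model. -/
abbrev Path : Type u := List (Label Var × Node W)

/-- The distance between two paths with respect to the variable `x`. -/
noncomputable def pathDist (x : Var) (h h' : Path W) : ℝ :=
  treeDist (weight V Φ W x) (s₀, 0) h h'

/-- The endpoint of a path from the root. -/
def tip (h : Path W) : Node W := endpt (s₀, 0) h

/-- The value of the variable `x` at a path: the class of paths at distance zero. -/
def pathClass (x : Var) (h : Path W) : Var × Set (Path W) :=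
  (x, {h' | pathDist V Φ W s₀ x h h' = 0})

variable {V Φ W s₀}

/-! ### The path distance and the fork of two paths. -/

theorem pathDist_comm (x : Var) (h h' : Path W) :
    pathDist V Φ W s₀ x h h' = pathDist V Φ W s₀ x h' h := treeDist_comm _ _ _ _

theorem pathDist_self (x : Var) (h : Path W) : pathDist V Φ W s₀ x h h = 0 := treeDist_self _ _ _

theorem pathDist_nonneg (x : Var) (h h' : Path W) : 0 ≤ pathDist V Φ W s₀ x h h' :=
  treeDist_nonneg (weight_nonneg x) _ _ _

theorem pathDist_ultra (x : Var) (a b c : Path W) :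
    pathDist V Φ W s₀ x a c ≤ max (pathDist V Φ W s₀ x a b) (pathDist V Φ W s₀ x b c) :=
  treeDist_ultra (weight_nonneg x) _ _ _ _

theorem pathDist_triangle (x : Var) (a b c : Path W) :
    pathDist V Φ W s₀ x a c ≤ pathDist V Φ W s₀ x a b + pathDist V Φ W s₀ x b c :=
  (pathDist_ultra x a b c).trans
    (max_le_add_of_nonneg (pathDist_nonneg x a b) (pathDist_nonneg x b c))

theorem pathDist_append (x : Var) (h : Path W) (e : Label Var × Node W) :
    pathDist V Φ W s₀ x h (h ++ [e]) = weight V Φ W x (tip W s₀ h) e :=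
  treeDist_append_singleton (weight_nonneg x) _ _ _

@[simp] theorem tip_append (h : Path W) (e : Label Var × Node W) :
    tip W s₀ (h ++ [e]) = e.2 := by
  simp [tip]

theorem exists_fork (V : Finset Var) (Φ : Set (Formula Var ar)) (h h' : Path W) :
    ∃ (p : Node W) (a b : Path W), endpt p a = tip W s₀ h ∧ endpt p b = tip W s₀ h' ∧
      ∀ x, pathDist V Φ W s₀ x h h' =
        max (height (weight V Φ W x) p a) (height (weight V Φ W x) p b) := by
  obtain ⟨c, a, b, rfl, rfl, hd⟩ := exists_common_prefix ((s₀, 0) : Node W) h h'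
  exact ⟨endpt (s₀, 0) c, a, b, by simp [tip], by simp [tip],
    fun x => hd _ (weight_nonneg x)⟩

/-- A path close enough to `h` leaves it at a node after which `h` no longer changes `Z`, because
the positive heights of the final segments of `h` are bounded below. Climbing from `h` to the fork
thus preserves everything `Z` determines, and only the descent to `h'` needs a one-way argument. -/
theorem exists_fork_of_lt (V : Finset Var) (Φ : Set (Formula Var ar)) (Z : Finset Var)
    (h : Path W) : ∃ δ > 0, δ ≤ 1 ∧ ∀ h', (∀ z ∈ Z, pathDist V Φ W s₀ z h h' < δ) →
    ∃ (p : Node W) (a b : Path W), endpt p a = tip W s₀ h ∧ endpt p b = tip W s₀ h' ∧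
      (∀ z ∈ Z, height (weight V Φ W z) p a = 0) ∧
      ∀ x, pathDist V Φ W s₀ x h h' =
        max (height (weight V Φ W x) p a) (height (weight V Φ W x) p b) := by
  choose δ hδ hδ' using fun z => exists_pos_le_height (weight_nonneg (V := V) (Φ := Φ) z)
    ((s₀, 0) : Node W) h
  obtain ⟨η, hη, hη₁, hηδ⟩ := exists_pos_forall_le Z δ fun z _ => hδ z
  refine ⟨η, hη, hη₁, fun h' hh' => ?_⟩
  obtain ⟨c, a, b, hc, rfl, hd⟩ := exists_common_prefix ((s₀, 0) : Node W) h h'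
  refine ⟨endpt (s₀, 0) c, a, b, by simp [tip, hc], by simp [tip], fun z hz => ?_,
    fun x => hd _ (weight_nonneg x)⟩
  exact hδ' z c a hc (((le_max_left _ _).trans (hd _ (weight_nonneg z)).ge).trans_lt
    ((hh' z hz).trans_le (hηδ z hz)))

theorem pathClass_eq_iff {x : Var} {h h' : Path W} :
    pathClass V Φ W s₀ x h = pathClass V Φ W s₀ x h' ↔ pathDist V Φ W s₀ x h h' = 0 := by
  constructor
  · intro hc
    have : h' ∈ (pathClass V Φ W s₀ x h').2 := pathDist_self x h'
    rw [← hc] at this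
    exact this
  · intro hd
    refine Prod.ext rfl (Set.ext fun r => ?_)
    have h₁ := pathDist_triangle (V := V) (Φ := Φ) (s₀ := s₀) x h h' r
    have h₂ := pathDist_triangle (V := V) (Φ := Φ) (s₀ := s₀) x h' h r
    rw [pathDist_comm x h' h] at h₂
    have : pathDist V Φ W s₀ x h r = pathDist V Φ W s₀ x h' r := by linarith
    simp [pathClass, this]

variable (V Φ W s₀)

theorem pathClass_surjective (x : Var) : Function.Surjective
    (fun h => ⟨pathClass V Φ W s₀ x h, h, rfl⟩ :
      Path W → Set.range (pathClass V Φ W s₀ x)) := by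
  rintro ⟨_, h, rfl⟩
  exact ⟨h, rfl⟩

/-- The metric model over a quasi-model. -/
noncomputable def pathModel : MetricModel Var ar where
  Val := Var × Set (Path W)
  Rng x := Set.range (pathClass V Φ W s₀ x)
  metric x := quotientMetric (pathDist V Φ W s₀ x) (pathDist_self x) (pathDist_comm x)
    (pathDist_triangle x) _ (pathClass_surjective V Φ W s₀ x)
    fun _ _ h => Subtype.ext (pathClass_eq_iff.2 h)
  -- Values are tagged with their variable, so ranges are disjoint and a tuple of values recovers
  -- the tuple of variables.
  interp P := {a | ∃ xs h, pred P xs ∈ Φ ∧ pred P xs ∈ (tip W s₀ h).1.1 ∧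
    ∀ i, (a i).1 = pathClass V Φ W s₀ (xs i) h}
  State := Path W
  val x h := ⟨pathClass V Φ W s₀ x h, h, rfl⟩
  surj := pathClass_surjective V Φ W s₀

/-- A path as a state of the model. -/
def pathState (h : Path W) : (pathModel V Φ W s₀).State := h

theorem pathState_surjective : Function.Surjective (pathState V Φ W s₀) := fun h => ⟨h, rfl⟩

theorem dist_val (x : Var) (h h' : Path W) :
    dist ((pathModel V Φ W s₀).val x (pathState V Φ W s₀ h))
      ((pathModel V Φ W s₀).val x (pathState V Φ W s₀ h')) =
      pathDist V Φ W s₀ x h h' :=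
  quotientMetric_dist (pathDist V Φ W s₀ x) (pathDist_self x) (pathDist_comm x)
    (pathDist_triangle x) _ (pathClass_surjective V Φ W s₀ x)
    (fun _ _ h => Subtype.ext (pathClass_eq_iff.2 h))
    (fun _ _ h => pathClass_eq_iff.1 (congrArg Subtype.val h)) h h'

theorem pathModel_joint_eq_iff {X : Finset Var} {h h' : Path W} :
    (pathModel V Φ W s₀).joint X (pathState V Φ W s₀ h) =
      (pathModel V Φ W s₀).joint X (pathState V Φ W s₀ h') ↔
      ∀ x ∈ X, pathDist V Φ W s₀ x h h' = 0 := by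
  rw [MetricModel.joint_eq_iff]
  exact forall₂_congr fun x _ => by rw [← dist_val, dist_eq_zero]

theorem pathModel_stateDist_lt_iff {X : Finset Var} {h h' : Path W} {ε : ℝ} (hε : 0 < ε) :
    (pathModel V Φ W s₀).stateDist X (pathState V Φ W s₀ h) (pathState V Φ W s₀ h') < ε ↔
      ∀ x ∈ X, pathDist V Φ W s₀ x h h' < ε := by
  rw [MetricModel.stateDist_lt_iff _ hε]
  exact forall₂_congr fun x _ => by rw [← dist_val]

theorem pathDist_le_stateDist {X : Finset Var} (h h' : Path W) {x : Var} (hx : x ∈ X) :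
    pathDist V Φ W s₀ x h h' ≤
      (pathModel V Φ W s₀).stateDist X (pathState V Φ W s₀ h) (pathState V Φ W s₀ h') := by
  rw [← dist_val]
  exact (MetricModel.stateDist_le_iff _ dist_nonneg).1 le_rfl x hx

variable {V Φ W}

theorem height_of_const {x : Var} (hx : ConstVar V W x) (p : Node W) (l : Path W) :
    height (weight V Φ W x) p l = 0 := by
  induction l generalizing p with
  | nil => rfl
  | cons e l ih => rw [height_cons, ih, weight_of_const hx, max_self]

theorem pathDist_of_const {x : Var} (hx : ConstVar V W x) (h h' : Path W) :
    pathDist V Φ W s₀ x h h' = 0 := by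
  obtain ⟨p, a, b, -, -, hd⟩ := exists_fork (s₀ := s₀) V Φ h h'
  rw [hd, height_of_const hx, height_of_const hx, max_self]

/-- The model over a quasi-model is pseudo-locally Lipschitz. -/
theorem pathModel_isPseudoLocallyLipschitz :
    (pathModel V Φ W s₀).IsPseudoLocallyLipschitz := by
  intro x y hx
  have hc : ¬ ConstVar V W x := fun hc => hx fun h h' => by
    obtain ⟨h, rfl⟩ := pathState_surjective V Φ W s₀ h
    obtain ⟨h', rfl⟩ := pathState_surjective V Φ W s₀ h'
    rw [← dist_eq_zero, dist_val, pathDist_of_const s₀ hc]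
  -- Both branches keep the modulus of the fork, so nearby paths share one modulus and one Lipschitz
  -- constant.
  have modulus {h h' : Path W} (h₁ : pathDist V Φ W s₀ x h h' < 1)
      (h₂ : pathDist V Φ W s₀ y h h' < 1) :
      pathDist V Φ W s₀ y h h' ≤ ((tip W s₀ h).2 + 1) * pathDist V Φ W s₀ x h h' ∧
        (tip W s₀ h').2 = (tip W s₀ h).2 := by
    obtain ⟨p, a, b, ha, hb, hd⟩ := exists_fork (s₀ := s₀) V Φ h h'
    rw [hd] at h₁ h₂ ⊢
    obtain ⟨ha₁, ha₂⟩ := QuasiModel.height_le_mul hc a p (max_lt_iff.1 h₁).1 (max_lt_iff.1 h₂).1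
    obtain ⟨hb₁, hb₂⟩ := QuasiModel.height_le_mul hc b p (max_lt_iff.1 h₁).2 (max_lt_iff.1 h₂).2
    rw [ha] at ha₂
    rw [hb] at hb₂
    rw [hd, ha₂, hb₂]
    refine ⟨max_le (ha₁.trans ?_) (hb₁.trans ?_), rfl⟩
    · exact mul_le_mul_of_nonneg_left (le_max_left _ _) (by positivity)
    · exact mul_le_mul_of_nonneg_left (le_max_right _ _) (by positivity)
  let _ : PseudoMetricSpace (pathModel V Φ W s₀).State :=
    PseudoMetricSpace.induced ((pathModel V Φ W s₀).val x) inferInstance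
  intro w
  obtain ⟨h, rfl⟩ := pathState_surjective V Φ W s₀ w
  -- Unit balls exclude every edge with weight 1 for `x` or `y`; the Lipschitz constant is the
  -- modulus at the tip plus one.
  refine ⟨Metric.ball (pathState V Φ W s₀ h) 1,
    Metric.ball ((pathModel V Φ W s₀).val y (pathState V Φ W s₀ h)) 1, Metric.isOpen_ball,
    Metric.mem_ball_self one_pos, Metric.isOpen_ball, Metric.mem_ball_self one_pos,
    ((tip W s₀ h).2 + 1 : ℕ), LipschitzOnWith.of_dist_le_mul ?_⟩
  have near {r : Path W} (hr : pathState V Φ W s₀ r ∈ Metric.ball (pathState V Φ W s₀ h) 1 ∩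
      (pathModel V Φ W s₀).val y ⁻¹'
        Metric.ball ((pathModel V Φ W s₀).val y (pathState V Φ W s₀ h)) 1) :
      pathDist V Φ W s₀ x h r < 1 ∧ pathDist V Φ W s₀ y h r < 1 := by
    rw [pathDist_comm x, pathDist_comm y, ← dist_val, ← dist_val]
    exact hr
  intro r hr t ht
  obtain ⟨r, rfl⟩ := pathState_surjective V Φ W s₀ r
  obtain ⟨t, rfl⟩ := pathState_surjective V Φ W s₀ t
  have hr' := near hr
  have ht' := near ht
  -- The ultrametric inequality keeps two points of a unit ball at distance below 1.
  have hx₁ : pathDist V Φ W s₀ x r t < 1 := (pathDist_ultra x r h t).trans_lt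
    (max_lt (by rw [pathDist_comm]; exact hr'.1) ht'.1)
  have hy₁ : pathDist V Φ W s₀ y r t < 1 := (pathDist_ultra y r h t).trans_lt
    (max_lt (by rw [pathDist_comm]; exact hr'.2) ht'.2)
  change dist _ _ ≤ _ * dist ((pathModel V Φ W s₀).val x (pathState V Φ W s₀ r))
    ((pathModel V Φ W s₀).val x (pathState V Φ W s₀ t))
  rw [dist_val, dist_val]
  have := (modulus hx₁ hy₁).1
  rw [(modulus hr'.1 hr'.2).2] at this
  simpa using this

/-! ### The truth lemma -/

namespace QuasiModel

variable (hQ : QuasiModel V Φ W)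
include hQ

/-- Only a `det X` edge can leave a non-constant variable fixed, and then `X` determines `Z`, hence
`y`. -/
theorem weight_eq_zero_of_dep {p : Node W} {e : Label Var × Node W} {Z : Finset Var}
    (hZ : Z ⊆ V) (h : ∀ z ∈ Z, weight V Φ W z p e = 0) {y : Var} (hy : y ∈ V)
    (hZy : Dep Z {y} ∈ p.1.1) : weight V Φ W y p e = 0 := by
  have hp := hQ.isType _ p.1.2
  have hy' : {y} ⊆ V := by simpa
  by_cases hyc : ConstVar V W y
  · exact weight_of_const hyc _ _
  have hc : ∃ z ∈ Z, ¬ ConstVar V W z := by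
    by_contra! hc
    exact hyc ((hQ.constVar_iff p.1 hy).2
      (hp.depLike.trans ∅ (by simp) Z hZ _ hy' (hQ.dep_empty_of_const p.1 hZ hc) hZy))
  obtain ⟨z₀, hz₀, hc⟩ := hc
  have h₀ := h z₀ hz₀
  rcases edge_cases V Φ p e with h' | ⟨X, hX, hR, -, h'⟩ | ⟨X, hX, n, hR, -, h'⟩
  · simp [h' z₀ hc] at h₀
  · have hXZ : Dep X Z ∈ p.1.1 := by
      refine (hp.depLike.iff_forall X hX Z hZ).2 fun z hz => ?_
      by_cases hzc : ConstVar V W z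
      · exact (hQ.dep_of_const p.1 hX (hZ hz) hzc).2.2
      · rcases h' z hzc with h' | h'
        · exact h'.1
        · simp [h z hz] at h'
    rcases h' y hyc with h' | h'
    · exact h'.2
    · exact absurd (hp.depLike.trans X hX Z hZ _ hy' hXZ hZy) h'.1
  · have h₁ := small_le_weight zero_lt_one h₀.le (h' z₀ hc)
    rw [h₀] at h₁
    exact absurd h₁ (not_le.2 (by positivity))

theorem height_eq_zero_of_dep {Z : Finset Var} (hZ : Z ⊆ V) {y : Var} (hy : y ∈ V)
    (l : Path W) (p : Node W) (h : ∀ z ∈ Z, height (weight V Φ W z) p l = 0)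
    (hZy : Dep Z {y} ∈ p.1.1) : height (weight V Φ W y) p l = 0 := by
  induction l generalizing p with
  | nil => rfl
  | cons e l ih =>
    have h₁ : ∀ z ∈ Z, weight V Φ W z p e = 0 := fun z hz =>
      le_antisymm ((le_max_left _ _).trans (h z hz).le) (weight_nonneg _ _ _)
    have h₂ : ∀ z ∈ Z, height (weight V Φ W z) e.2 l = 0 := fun z hz =>
      le_antisymm ((le_max_right _ _).trans (h z hz).le) (height_nonneg (weight_nonneg z) _ _)
    rw [height_cons, hQ.weight_eq_zero_of_dep hZ h₁ hy hZy,
      ih e.2 h₂ (((hQ.weight_agree hZ h₁).dep _ (by simpa)).1 hZy), max_self]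

/-! ### The edges that witness failures of modalities and dependence atoms. -/

theorem weight_det {X : Finset Var} (hX : X ⊆ V) {p : Node W} {t : W}
    (hR : DRel V Φ X p.1 t) {x : Var} (hx : x ∈ X) :
    weight V Φ W x p (.det X, t, p.2) = 0 := by
  have := (hQ.isType _ p.1.2).depLike.refl X hX x hx
  simp [weight, hX, hR, this]

theorem weight_know_le {X : Finset Var} (hX : X ⊆ V) {p : Node W} {t : W}
    (hR : KRel V Φ X p.1 t) {x : Var} (hx : x ∈ X) (n : ℕ) :
    weight V Φ W x p (.know X n, t, p.2) ≤ 1 / (n + 1 : ℝ) := by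
  have := (hQ.isType _ p.1.2).udepLike.refl X hX x hx
  by_cases hc : ConstVar V W x
  · rw [weight_of_const hc]
    positivity
  · simp [weight, hc, hX, hR, this]

theorem weight_det_of_not_dep {X : Finset Var} (hX : X ⊆ V) {p : Node W} {q : Node W}
    {y : Var} (hy : y ∈ V) (h : Dep X {y} ∉ p.1.1) :
    weight V Φ W y p (.det X, q) = 1 := by
  have hc : ¬ ConstVar V W y := fun hc => h (hQ.dep_of_const p.1 hX hy hc).2.2
  simp [weight, hc, h]

theorem weight_know_of_not_kdep {X : Finset Var} (hX : X ⊆ V) {p : Node W} {q : Node W}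
    {y : Var} (hy : y ∈ V) (h : KDep X {y} ∉ p.1.1) (n : ℕ) :
    weight V Φ W y p (.know X n, q) = 1 := by
  have hc : ¬ ConstVar V W y := fun hc => h (hQ.dep_of_const p.1 hX hy hc).2.1
  have hU : UDep X {y} ∉ p.1.1 := fun hU =>
    h ((hQ.isType _ p.1.2).kdep_of_udep X hX _ (by simpa) hU)
  simp [weight, hc, h, hU]

/-- When the index of the small change equals the modulus, the factor (N+1)/(n+1) is 1, so even a
variable that depends knowably on `X` makes a full step. -/
theorem weight_know_of_not_udep {X : Finset Var} (hX : X ⊆ V) {p : Node W} {q : Node W}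
    {y : Var} (hy : y ∈ V) (h : UDep X {y} ∉ p.1.1) :
    weight V Φ W y p (.know X p.2, q) = 1 := by
  have hc : ¬ ConstVar V W y := fun hc => h (hQ.dep_of_const p.1 hX hy hc).1
  have : (p.2 + 1 : ℝ) / (p.2 + 1) = 1 := div_self (by positivity)
  simp [weight, hc, h, this]

variable {s₀}

theorem agree_tip {Z : Finset Var} (hZ : Z ⊆ V) {h h' : Path W}
    (hd : ∀ z ∈ Z, pathDist V Φ W s₀ z h h' = 0) :
    Agree V Φ Z (tip W s₀ h).1 (tip W s₀ h').1 := by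
  obtain ⟨p, a, b, ha, hb, hab⟩ := exists_fork (s₀ := s₀) V Φ h h'
  have h₁ := hQ.height_agree hZ a p fun z hz => le_antisymm
    ((le_max_left _ _).trans ((hab z).symm.trans (hd z hz)).le)
    (height_nonneg (weight_nonneg z) _ _)
  have h₂ := hQ.height_agree hZ b p fun z hz => le_antisymm
    ((le_max_right _ _).trans ((hab z).symm.trans (hd z hz)).le)
    (height_nonneg (weight_nonneg z) _ _)
  rw [ha] at h₁
  rw [hb] at h₂
  exact h₁.symm.trans h₂

/-- Agreement up to the fork, inheritance down from it. -/
theorem exists_inherit_tip {Z : Finset Var} (hZ : Z ⊆ V) (h : Path W) :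
    ∃ δ > 0, ∀ h', (∀ z ∈ Z, pathDist V Φ W s₀ z h h' < δ) →
      Inherit V Φ Z (tip W s₀ h).1 (tip W s₀ h').1 := by
  obtain ⟨δ, hδ, hδ₁, H⟩ := exists_fork_of_lt (s₀ := s₀) V Φ Z h
  refine ⟨δ, hδ, fun h' hd => ?_⟩
  obtain ⟨p, a, b, ha, hb, hz, hab⟩ := H h' hd
  have h₁ := hQ.height_agree hZ a p hz
  have h₂ := hQ.height_inherit hZ b p fun z hz =>
    (le_max_right _ _).trans_lt ((hab z).symm.trans_lt ((hd z hz).trans_le hδ₁))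
  rw [ha] at h₁
  rw [hb] at h₂
  exact h₁.symm.inherit.trans h₂

/-- At the tip with modulus N the dependence is Lipschitz with constant N+1, once the other path is
close enough to fork where `h` no longer changes `X`. -/
theorem contDep {X Y : Finset Var} (hX : X ⊆ V) (hY : Y ⊆ V) {h : Path W}
    (hXY : KDep X Y ∈ (tip W s₀ h).1.1) :
    (pathModel V Φ W s₀).ContDep X Y (pathState V Φ W s₀ h) := by
  have hs := hQ.isType _ (tip W s₀ h).1.2
  have hXy := (hs.kdepLike.iff_forall X hX Y hY).1 hXY
  intro ε hε
  by_cases hc : ∀ x ∈ X, ConstVar V W x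
  · refine ⟨1, one_pos, fun h' _ => ?_⟩
    obtain ⟨h', rfl⟩ := pathState_surjective V Φ W s₀ h'
    refine (pathModel_stateDist_lt_iff V Φ W s₀ hε).2 fun y hy => ?_
    rwa [pathDist_of_const s₀ (hQ.const_of_kdep _ hX hc (hY hy) (hXy y hy))]
  push Not at hc
  obtain ⟨δ, hδ, hδ₁, H⟩ := exists_fork_of_lt (s₀ := s₀) V Φ X h
  have hN : (0 : ℝ) < (tip W s₀ h).2 + 1 := by positivity
  refine ⟨min δ (ε / ((tip W s₀ h).2 + 1)), lt_min hδ (by positivity), fun h' hh' => ?_⟩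
  obtain ⟨h', rfl⟩ := pathState_surjective V Φ W s₀ h'
  have hr : ∀ x ∈ X, pathDist V Φ W s₀ x h h' ≤
      (pathModel V Φ W s₀).stateDist X (pathState V Φ W s₀ h) (pathState V Φ W s₀ h') :=
    fun x hx => pathDist_le_stateDist V Φ W s₀ h h' hx
  have hr₀ : 0 ≤ (pathModel V Φ W s₀).stateDist X (pathState V Φ W s₀ h)
      (pathState V Φ W s₀ h') := dist_nonneg
  have hrδ := hh'.trans_le (min_le_left _ _)
  have hrε := (lt_div_iff₀' hN).1 (hh'.trans_le (min_le_right _ _))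
  set r := (pathModel V Φ W s₀).stateDist X (pathState V Φ W s₀ h) (pathState V Φ W s₀ h')
  obtain ⟨p, a, b, ha, hb, hz, hab⟩ := H h' fun x hx => (hr x hx).trans_lt hrδ
  rw [pathModel_stateDist_lt_iff V Φ W s₀ hε]
  intro y hy
  -- The rest of `h` fixes `X`, so the atom at the tip already holds at the fork.
  have hp : KDep X {y} ∈ p.1.1 := by
    have := (hQ.height_agree hX a p hz).kdep {y} (by simpa using hY hy)
    rw [ha] at this
    exact this.2 (hXy y hy)
  have hr₁ := hrδ.trans_le hδ₁
  obtain ⟨h₁, hN₁⟩ := hQ.height_le_mul_of_kdep hX hc hr₀ hr₁ (hY hy) a p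
    (fun x hx => (le_max_left _ _).trans ((hab x).symm.trans_le (hr x hx))) hp
  obtain ⟨h₂, -⟩ := hQ.height_le_mul_of_kdep hX hc hr₀ hr₁ (hY hy) b p
    (fun x hx => (le_max_right _ _).trans ((hab x).symm.trans_le (hr x hx))) hp
  rw [ha] at hN₁
  rw [← hN₁] at h₁ h₂
  rw [hab y]
  exact (max_le h₁ h₂).trans_lt hrε

/-- Truth in the model over a quasi-model is membership in the type at the tip of the path. -/
theorem sat_iff (ψ : Formula Var ar) (hψ : ψ ∈ Φ) (h : Path W) :
    (pathModel V Φ W s₀).Sat ψ (pathState V Φ W s₀ h) ↔ ψ ∈ (tip W s₀ h).1.1 := by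
  have drefl (X : Finset Var) (s : W) : DRel V Φ X s s := fun Z _ _ => .refl _
  have krefl (X : Finset Var) (s : W) : KRel V Φ X s s := fun Z _ _ => .refl _
  induction ψ generalizing h with
  | pred P xs =>
    constructor
    · rintro ⟨ys, h', hΦ, hm, heq⟩
      -- The tags on the values identify the variables.
      obtain rfl : xs = ys := funext fun i => congrArg Prod.fst (heq i)
      classical
      refine ((hQ.agree_tip (Z := Finset.univ.image xs) ?_ ?_).pred P xs hΦ (by simp)).2 hm
      · simpa [Finset.image_subset_iff] using hQ.subClosed.pred P xs hψ
      · intro z hz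
        obtain ⟨i, -, rfl⟩ := Finset.mem_image.1 hz
        exact pathClass_eq_iff.1 (heq i)
    · exact fun hm => ⟨xs, h, hψ, hm, fun i => rfl⟩
  | neg ψ ih =>
    rw [(hQ.isType _ (tip W s₀ h).1.2).neg ψ hψ, ← propext (ih (hQ.subClosed.neg ψ hψ) h)]
    rfl
  | and ψ χ ih₁ ih₂ =>
    obtain ⟨h₁, h₂⟩ := hQ.subClosed.and ψ χ hψ
    rw [(hQ.isType _ (tip W s₀ h).1.2).and ψ χ hψ, ← propext (ih₁ h₁ h),
      ← propext (ih₂ h₂ h)]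
    rfl
  | D X ψ ih =>
    obtain ⟨hX, hψ'⟩ := hQ.subClosed.d X ψ hψ
    constructor
    · intro hs
      by_contra hn
      obtain ⟨t, ht, hR, hψt⟩ := hQ.d _ (tip W s₀ h).1.2 X ψ hψ hn
      have := hs (pathState V Φ W s₀ <| h ++ [(.det X, ⟨t, ht⟩, (tip W s₀ h).2)])
        ((pathModel_joint_eq_iff V Φ W s₀).2 fun x hx => by
          rw [pathDist_append]
          exact hQ.weight_det hX (t := ⟨t, ht⟩) hR hx)
      rw [propext (ih hψ' _), tip_append] at this
      exact hψt this
    · intro hm h' hh'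
      obtain ⟨h', rfl⟩ := pathState_surjective V Φ W s₀ h'
      rw [pathModel_joint_eq_iff] at hh'
      rw [propext (ih hψ' _)]
      exact (hQ.isType _ (tip W s₀ h').1.2).d X ψ hψ (((hQ.agree_tip hX hh').d ψ hψ).1 hm)
  | Dep X Y =>
    obtain ⟨hX, hY⟩ := hQ.subClosed.dep X Y hψ
    have hs := hQ.isType _ (tip W s₀ h).1.2
    constructor
    · intro hsat
      refine (hs.depLike.iff_forall X hX Y hY).2 fun y hy => ?_
      by_contra hn
      -- An edge back to the same type: it fixes `X` and moves `y` by 1.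
      have := hsat (pathState V Φ W s₀ <| h ++ [(.det X, tip W s₀ h)])
        ((pathModel_joint_eq_iff V Φ W s₀).2 fun x hx => by
          rw [pathDist_append]
          exact hQ.weight_det hX (drefl X _) hx)
      have := (pathModel_joint_eq_iff V Φ W s₀).1 this y hy
      rw [pathDist_append, hQ.weight_det_of_not_dep hX (hY hy) hn] at this
      exact one_ne_zero this
    · intro hm h' hh'
      obtain ⟨h', rfl⟩ := pathState_surjective V Φ W s₀ h'
      rw [pathModel_joint_eq_iff] at hh' ⊢
      intro y hy
      have hXy := (hs.depLike.iff_forall X hX Y hY).1 hm y hy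
      obtain ⟨p, a, b, ha, hb, hab⟩ := exists_fork (s₀ := s₀) V Φ h h'
      have ha₀ : ∀ x ∈ X, height (weight V Φ W x) p a = 0 := fun x hx => le_antisymm
        ((le_max_left _ _).trans ((hab x).symm.trans (hh' x hx)).le)
        (height_nonneg (weight_nonneg x) _ _)
      have hb₀ : ∀ x ∈ X, height (weight V Φ W x) p b = 0 := fun x hx => le_antisymm
        ((le_max_right _ _).trans ((hab x).symm.trans (hh' x hx)).le)
        (height_nonneg (weight_nonneg x) _ _)
      have hp : Dep X {y} ∈ p.1.1 := by
        have := (hQ.height_agree hX a p ha₀).dep {y} (by simpa using hY hy)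
        rw [ha] at this
        exact this.2 hXy
      rw [hab, hQ.height_eq_zero_of_dep hX (hY hy) a p ha₀ hp,
        hQ.height_eq_zero_of_dep hX (hY hy) b p hb₀ hp, max_self]
  | K X ψ ih =>
    obtain ⟨hX, hψ'⟩ := hQ.subClosed.k X ψ hψ
    rw [MetricModel.sat_K_iff]
    constructor
    · rintro ⟨ε, hε, hs⟩
      by_contra hn
      obtain ⟨t, ht, hR, hψt⟩ := hQ.k _ (tip W s₀ h).1.2 X ψ hψ hn
      obtain ⟨n, hn⟩ := exists_nat_one_div_lt hε
      have := hs (pathState V Φ W s₀ <| h ++ [(.know X n, ⟨t, ht⟩, (tip W s₀ h).2)])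
        ((pathModel_stateDist_lt_iff V Φ W s₀ hε).2 fun x hx => by
          rw [pathDist_append]
          exact (hQ.weight_know_le hX (t := ⟨t, ht⟩) hR hx n).trans_lt hn)
      rw [propext (ih hψ' _), tip_append] at this
      exact hψt this
    · intro hm
      obtain ⟨δ, hδ, H⟩ := hQ.exists_inherit_tip (s₀ := s₀) hX h
      refine ⟨δ, hδ, fun h' hh' => ?_⟩
      obtain ⟨h', rfl⟩ := pathState_surjective V Φ W s₀ h'
      rw [pathModel_stateDist_lt_iff V Φ W s₀ hδ] at hh'
      rw [propext (ih hψ' _)]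
      exact (hQ.isType _ (tip W s₀ h').1.2).k X ψ hψ ((H h' hh').k ψ hψ hm)
  | KDep X Y =>
    obtain ⟨hX, hY⟩ := hQ.subClosed.kdep X Y hψ
    have hs := hQ.isType _ (tip W s₀ h).1.2
    rw [MetricModel.sat_KDep_iff]
    constructor
    · rintro ⟨ρ, hρ, H⟩
      refine (hs.kdepLike.iff_forall X hX Y hY).2 fun y hy => ?_
      by_contra hny
      obtain ⟨δ, hδ, H⟩ := H _ (by rwa [MetricModel.stateDist_self]) 1 one_pos
      obtain ⟨n, hn⟩ := exists_nat_one_div_lt hδ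
      -- The `n`-th small change back to the same type: `X` moves by less than `δ`, but `y` by 1.
      have := H (pathState V Φ W s₀ <| h ++ [(.know X n, tip W s₀ h)])
        ((pathModel_stateDist_lt_iff V Φ W s₀ hδ).2 fun x hx => by
          rw [pathDist_append]
          exact (hQ.weight_know_le hX (krefl X _) hx n).trans_lt hn)
      have := (pathModel_stateDist_lt_iff V Φ W s₀ one_pos).1 this y hy
      rw [pathDist_append, hQ.weight_know_of_not_kdep hX (hY hy) hny] at this
      exact lt_irrefl _ this
    · intro hm
      obtain ⟨δ, hδ, H⟩ := hQ.exists_inherit_tip (s₀ := s₀) hX h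
      refine ⟨δ, hδ, fun h' hh' => ?_⟩
      obtain ⟨h', rfl⟩ := pathState_surjective V Φ W s₀ h'
      refine hQ.contDep hX hY ?_
      rw [pathModel_stateDist_lt_iff V Φ W s₀ hδ] at hh'
      exact (H h' hh').kdep Y hY hm
  | UDep X Y =>
    obtain ⟨hX, hY⟩ := hQ.subClosed.udep X Y hψ
    have hs := hQ.isType _ (tip W s₀ h).1.2
    constructor
    · intro hsat
      refine (hs.udepLike.iff_forall X hX Y hY).2 fun y hy => ?_
      by_contra hny
      obtain ⟨δ, hδ, H⟩ := hsat 1 one_pos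
      obtain ⟨n, hn⟩ := exists_nat_one_div_lt hδ
      -- First set the modulus to `n`, keeping the type; the `n`-th small change from there moves
      -- `X` by at most 1/(n+1) < `δ` and `y` by 1. The choice of `n` depends on `δ`, so only
      -- uniformity is refuted.
      have htip : tip W s₀ (h ++ [(.det ∅, (tip W s₀ h).1, n)]) = ((tip W s₀ h).1, n) := by simp
      have := H (pathState V Φ W s₀ <| h ++ [(.det ∅, (tip W s₀ h).1, n)])
        (pathState V Φ W s₀ <|
          h ++ [(.det ∅, (tip W s₀ h).1, n)] ++ [(.know X n, (tip W s₀ h).1, n)])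
        ((pathModel_stateDist_lt_iff V Φ W s₀ hδ).2 fun x hx => by
          rw [pathDist_append, htip]
          exact (hQ.weight_know_le (p := ((tip W s₀ h).1, n)) hX (krefl X _) hx n).trans_lt hn)
      have := (pathModel_stateDist_lt_iff V Φ W s₀ one_pos).1 this y hy
      rw [pathDist_append, htip,
        hQ.weight_know_of_not_udep (p := ((tip W s₀ h).1, n)) hX (hY hy) hny] at this
      exact lt_irrefl _ this
    · intro hm ε hε
      -- Below distance 1 uniform dependence does not increase distances.
      refine ⟨min ε 1, lt_min hε one_pos, fun h₁ h₂ hd => ?_⟩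
      obtain ⟨h₁, rfl⟩ := pathState_surjective V Φ W s₀ h₁
      obtain ⟨h₂, rfl⟩ := pathState_surjective V Φ W s₀ h₂
      have hr : ∀ x ∈ X, pathDist V Φ W s₀ x h₁ h₂ ≤
          (pathModel V Φ W s₀).stateDist X (pathState V Φ W s₀ h₁) (pathState V Φ W s₀ h₂) :=
        fun x hx => pathDist_le_stateDist V Φ W s₀ h₁ h₂ hx
      have hr₀ : 0 ≤ (pathModel V Φ W s₀).stateDist X (pathState V Φ W s₀ h₁)
          (pathState V Φ W s₀ h₂) := dist_nonneg
      set r := (pathModel V Φ W s₀).stateDist X (pathState V Φ W s₀ h₁) (pathState V Φ W s₀ h₂)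
      rw [pathModel_stateDist_lt_iff V Φ W s₀ hε]
      intro y hy
      obtain ⟨p, a, b, -, -, hab⟩ := exists_fork (s₀ := s₀) V Φ h₁ h₂
      -- Uniform dependence atoms are the same in all types, so no relation between the fork and `h`
      -- is needed.
      have hp : UDep X {y} ∈ p.1.1 := hQ.udep _ (tip W s₀ h).1.2 _ p.1.2 X hX _
        (by simpa using hY hy) ((hs.udepLike.iff_forall X hX Y hY).1 hm y hy)
      have hr₁ := hd.trans_le (min_le_right _ _)
      rw [hab y]
      refine (max_le ?_ ?_).trans_lt (hd.trans_le (min_le_left _ _))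
      · exact hQ.height_le_of_udep hX hr₀ hr₁ (hY hy) a p
          (fun x hx => (le_max_left _ _).trans ((hab x).symm.trans_le (hr x hx))) hp
      · exact hQ.height_le_of_udep hX hr₀ hr₁ (hY hy) b p
          (fun x hx => (le_max_right _ _).trans ((hab x).symm.trans_le (hr x hx))) hp

end QuasiModel

end Model

end LUD

namespace LUD

/-! ### Quasi-models coded by numbers

Sets of numbers are coded by their binary digits: a type is coded by the set of the Gödel numbers of
its elements, a quasi-model by the set of the codes of its types. -/

namespace Coded

/-- The number `i` belongs to the set coded by `m`. -/
def Mem (i m : ℕ) : Prop := m.testBit i = true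

/-- Inclusion of coded sets. -/
def Sub (X v : ℕ) : Prop := ∀ i < X, Mem i X → Mem i v

/-- The Gödel number of a formula with the tag `k` and two arguments. -/
def node (k X Y : ℕ) : ℕ := Nat.pair k (Nat.pair X Y)

/-- The list of numbers with a given code. -/
def list (l : ℕ) : List ℕ := (Encodable.decode (α := List ℕ) l).getD []

/-- Coded version of `LUD.Agree`. -/
def Agree (v p Z s t : ℕ) : Prop :=
  (∀ Y < v + 1, Sub Y v → (Mem (node 4 Z Y) s ↔ Mem (node 4 Z Y) t)) ∧
  (∀ Y < v + 1, Sub Y v → (Mem (node 6 Z Y) s ↔ Mem (node 6 Z Y) t)) ∧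
  (∀ c < p, Mem (node 3 Z c) p → (Mem (node 3 Z c) s ↔ Mem (node 3 Z c) t)) ∧
  (∀ c < p, Mem (node 5 Z c) p → (Mem (node 5 Z c) s ↔ Mem (node 5 Z c) t)) ∧
  (∀ P < p, ∀ l < p, Mem (node 0 P l) p → (∀ y ∈ list l, Mem y Z) →
    (Mem (node 0 P l) s ↔ Mem (node 0 P l) t))

/-- Coded version of `LUD.Inherit`. -/
def Inherit (v p Z s t : ℕ) : Prop :=
  (∀ Y < v + 1, Sub Y v → Mem (node 6 Z Y) s → Mem (node 6 Z Y) t) ∧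
  (∀ c < p, Mem (node 5 Z c) p → Mem (node 5 Z c) s → Mem (node 5 Z c) t)

/-- Coded version of `LUD.DRel`. -/
def DRel (v p X s t : ℕ) : Prop :=
  ∀ Z < v + 1, Sub Z v → Mem (node 4 X Z) s → Agree v p Z s t

/-- Coded version of `LUD.KRel`. -/
def KRel (v p X s t : ℕ) : Prop :=
  ∀ Z < v + 1, Sub Z v → Mem (node 6 X Z) s → Inherit v p Z s t

/-- Coded version of `LUD.DepLike`, for the dependence atoms with the tag `k` in `s`. -/
def DepLike (v k s : ℕ) : Prop :=
  (∀ X < v + 1, Sub X v → ∀ Y < v + 1, Sub Y v →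
    (Mem (node k X Y) s ↔ ∀ y < Y, Mem y Y → Mem (node k X (2 ^ y)) s)) ∧
  (∀ X < v + 1, Sub X v → ∀ x < X, Mem x X → Mem (node k X (2 ^ x)) s) ∧
  (∀ X < v + 1, Sub X v → ∀ Y < v + 1, Sub Y v → ∀ Z < v + 1, Sub Z v →
    Mem (node k X Y) s → Mem (node k Y Z) s → Mem (node k X Z) s)

/-- Coded version of `LUD.SubClosed`. -/
def SubClosed (v p : ℕ) : Prop :=
  (∀ P < p, ∀ l < p, Mem (node 0 P l) p → ∀ y ∈ list l, Mem y v) ∧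
  (∀ c < p, Mem (Nat.pair 1 c) p → Mem c p) ∧
  (∀ c < p, ∀ d < p, Mem (node 2 c d) p → Mem c p ∧ Mem d p) ∧
  (∀ X < p, ∀ c < p, Mem (node 3 X c) p → Sub X v ∧ Mem c p) ∧
  (∀ X < p, ∀ Y < p, Mem (node 4 X Y) p → Sub X v ∧ Sub Y v) ∧
  (∀ X < p, ∀ c < p, Mem (node 5 X c) p → Sub X v ∧ Mem c p) ∧
  (∀ X < p, ∀ Y < p, Mem (node 6 X Y) p → Sub X v ∧ Sub Y v) ∧
  (∀ X < p, ∀ Y < p, Mem (node 7 X Y) p → Sub X v ∧ Sub Y v)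

/-- Coded version of `LUD.IsType`. -/
def IsType (v p s : ℕ) : Prop :=
  (∀ c < p, Mem (Nat.pair 1 c) p → (Mem (Nat.pair 1 c) s ↔ ¬ Mem c s)) ∧
  (∀ c < p, ∀ d < p, Mem (node 2 c d) p → (Mem (node 2 c d) s ↔ Mem c s ∧ Mem d s)) ∧
  (∀ X < p, ∀ c < p, Mem (node 3 X c) p → Mem (node 3 X c) s → Mem c s) ∧
  (∀ X < p, ∀ c < p, Mem (node 5 X c) p → Mem (node 5 X c) s → Mem c s) ∧
  DepLike v 4 s ∧ DepLike v 6 s ∧ DepLike v 7 s ∧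
  (∀ X < v + 1, Sub X v → ∀ Y < v + 1, Sub Y v → Mem (node 6 X Y) s → Mem (node 4 X Y) s) ∧
  (∀ X < v + 1, Sub X v → ∀ Y < v + 1, Sub Y v → Mem (node 7 X Y) s → Mem (node 6 X Y) s) ∧
  (∀ X < v + 1, Sub X v → ∀ Y < v + 1, Sub Y v → Mem (node 4 0 Y) s → Mem (node 7 X Y) s)

/-- Coded version of `LUD.QuasiModel`. -/
def QuasiModel (v p w : ℕ) : Prop :=
  SubClosed v p ∧ (∀ s < w, Mem s w → IsType v p s) ∧
  (∀ s < w, Mem s w → ∀ X < p, ∀ c < p, Mem (node 3 X c) p → ¬ Mem (node 3 X c) s →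
    ∃ t < w, Mem t w ∧ DRel v p X s t ∧ ¬ Mem c t) ∧
  (∀ s < w, Mem s w → ∀ X < p, ∀ c < p, Mem (node 5 X c) p → ¬ Mem (node 5 X c) s →
    ∃ t < w, Mem t w ∧ KRel v p X s t ∧ ¬ Mem c t) ∧
  (∀ s < w, Mem s w → ∀ t < w, Mem t w → DRel v p 0 s t) ∧
  (∀ s < w, Mem s w → ∀ t < w, Mem t w → ∀ X < v + 1, Sub X v → ∀ Y < v + 1, Sub Y v →
    Mem (node 7 X Y) s → Mem (node 7 X Y) t)

/-- The quasi-model with the code `(v, p, w)` refutes the formula with the Gödel number `n`. -/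
def Refutes (n v p w : ℕ) : Prop :=
  QuasiModel v p w ∧ Mem n p ∧ ∃ s < w, Mem s w ∧ ¬ Mem n s

/-- A bound for the Gödel numbers of the formulas that matter for the refutation of the formula
with the Gödel number `n`. -/
def bound (n : ℕ) : ℕ := n + 1 + node 8 (2 ^ n) (2 ^ n)

/-- The formula with the Gödel number `n` is refuted by a quasi-model of bounded size. -/
def Refutable (n : ℕ) : Prop :=
  ∃ v < 2 ^ n, ∃ p < 2 ^ (n + 1), ∃ w < 2 ^ 2 ^ bound n, Refutes n v p w

/-! ### Primitive recursiveness -/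

section Primrec

variable {α : Type} [Primcodable α]

theorem primrec_id' : Primrec fun a : α => a := Primrec.id

theorem primrec_fst {β γ : Type} [Primcodable β] [Primcodable γ] {f : α → β × γ}
    (hf : Primrec f) : Primrec fun a => (f a).1 := Primrec.fst.comp hf

theorem primrec_snd {β γ : Type} [Primcodable β] [Primcodable γ] {f : α → β × γ}
    (hf : Primrec f) : Primrec fun a => (f a).2 := Primrec.snd.comp hf

theorem primrec_add {f g : α → ℕ} (hf : Primrec f) (hg : Primrec g) :
    Primrec fun a => f a + g a := Primrec.nat_add.comp hf hg

theorem primrec_pair {f g : α → ℕ} (hf : Primrec f) (hg : Primrec g) :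
    Primrec fun a => Nat.pair (f a) (g a) := Primrec₂.natPair.comp hf hg

theorem primrec_pow {f g : α → ℕ} (hf : Primrec f) (hg : Primrec g) :
    Primrec fun a => f a ^ g a := by
  have h : Primrec₂ ((· ^ ·) : ℕ → ℕ → ℕ) := Primrec₂.unpaired'.1 Nat.Primrec.pow
  exact h.comp hf hg

theorem primrecPred_mem {f g : α → ℕ} (hf : Primrec f) (hg : Primrec g) :
    PrimrecPred fun a => Mem (f a) (g a) := by
  have h : PrimrecPred fun a => g a / 2 ^ f a % 2 = 1 :=
    Primrec.eq.comp (Primrec.nat_mod.comp (Primrec.nat_div.comp hg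
      (primrec_pow (.const 2) hf)) (.const 2)) (.const 1)
  exact h.of_eq fun a => by simp [Mem, Nat.testBit_eq_decide_div_mod_eq]

theorem primrecPred_imp {p q : α → Prop} (hp : PrimrecPred p) (hq : PrimrecPred q) :
    PrimrecPred fun a => p a → q a := by
  classical
  exact (hp.not.or hq).of_eq fun a => imp_iff_not_or.symm

theorem primrecPred_iff {p q : α → Prop} (hp : PrimrecPred p) (hq : PrimrecPred q) :
    PrimrecPred fun a => p a ↔ q a :=
  ((primrecPred_imp hp hq).and (primrecPred_imp hq hp)).of_eq fun _ =>
    iff_iff_implies_and_implies.symm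

theorem primrecPred_forall_lt {R : α → ℕ → Prop} {f : α → ℕ} (hf : Primrec f)
    (hR : PrimrecPred fun q : α × ℕ => R q.1 q.2) : PrimrecPred fun a => ∀ x < f a, R a x := by
  have h : PrimrecRel fun (x : ℕ) (a : α) => R a x := hR.primrecRel.swap
  exact (h.forall_mem_list.comp (Primrec.list_range.comp hf) .id).of_eq (by simp)

theorem primrecPred_exists_lt {R : α → ℕ → Prop} {f : α → ℕ} (hf : Primrec f)
    (hR : PrimrecPred fun q : α × ℕ => R q.1 q.2) : PrimrecPred fun a => ∃ x < f a, R a x := by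
  have h : PrimrecRel fun (x : ℕ) (a : α) => R a x := hR.primrecRel.swap
  exact (h.exists_mem_list.comp (Primrec.list_range.comp hf) .id).of_eq (by simp)

theorem primrecPred_forall_mem_list {R : α → ℕ → Prop} {f : α → ℕ} (hf : Primrec f)
    (hR : PrimrecPred fun q : α × ℕ => R q.1 q.2) :
    PrimrecPred fun a => ∀ x ∈ list (f a), R a x := by
  have h : PrimrecRel fun (x : ℕ) (a : α) => R a x := hR.primrecRel.swap
  exact h.forall_mem_list.comp
    (Primrec.option_getD.comp (Primrec.decode.comp hf) (.const [])) .id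

theorem primrecPred_sub {f g : α → ℕ} (hf : Primrec f) (hg : Primrec g) :
    PrimrecPred fun a => Sub (f a) (g a) :=
  primrecPred_forall_lt hf (primrecPred_imp (primrecPred_mem .snd (hf.comp .fst))
    (primrecPred_mem .snd (hg.comp .fst)))

theorem primrec_node {f g h : α → ℕ} (hf : Primrec f) (hg : Primrec g) (hh : Primrec h) :
    Primrec fun a => node (f a) (g a) (h a) :=
  Primrec₂.natPair.comp hf (Primrec₂.natPair.comp hg hh)

theorem primrec_bound {f : α → ℕ} (hf : Primrec f) : Primrec fun a => bound (f a) := by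
  unfold bound
  exact Primrec.nat_add.comp (Primrec.nat_add.comp hf (.const 1))
    (primrec_node (.const 8) (primrec_pow (.const 2) hf) (primrec_pow (.const 2) hf))

theorem primrecPred_refutable : PrimrecPred Refutable := by
  change PrimrecPred fun n => Refutable n
  unfold Refutable Refutes QuasiModel IsType SubClosed DepLike KRel DRel Inherit Agree
  -- The condition is built from bounded quantifiers, connectives and bit tests, so the proof
  -- follows its syntax; reducible transparency keeps `Mem`, `Sub`, `node` and `bound` folded.
  repeat' with_reducible first
    | exact primrec_id'
    | exact Primrec.const _
    | exact Primrec.fst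
    | exact Primrec.snd
    | apply primrecPred_exists_lt
    | apply primrecPred_forall_lt
    | apply primrecPred_forall_mem_list
    | apply primrecPred_mem
    | apply primrecPred_sub
    | apply PrimrecPred.not
    | apply PrimrecPred.and
    | apply primrecPred_iff
    | apply primrecPred_imp
    | apply primrec_node
    | apply primrec_bound
    | apply primrec_pow
    | apply primrec_pair
    | apply primrec_add
    | apply primrec_fst
    | apply primrec_snd

end Primrec

end Coded

end LUD

namespace LUD

open Formula

namespace Coded

/-! ### Numbers as finite sets of numbers, and the bounds on their elements. -/

theorem Mem.lt {i m : ℕ} (h : Mem i m) : i < m :=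
  Nat.lt_two_pow_self.trans_le (Nat.ge_two_pow_of_testBit h)

theorem exists_forall_mem_iff (B : ℕ) (P : ℕ → Prop) :
    ∃ m < 2 ^ B, ∀ i, Mem i m ↔ i < B ∧ P i := by
  classical
  refine ⟨∑ i ∈ (Finset.range B).filter P, 2 ^ i, ?_, fun i => ?_⟩
  · exact Nat.geomSum_lt le_rfl fun i hi => by simpa using (Finset.mem_filter.1 hi).1
  · rw [Mem, ← Nat.mem_bitIndices, ← List.mem_toFinset, Finset.toFinset_bitIndices_sum_two_pow]
    simp

theorem ext {m m' : ℕ} (h : ∀ i, Mem i m ↔ Mem i m') : m = m' :=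
  Nat.eq_of_testBit_eq fun i => Bool.eq_iff_iff.2 (h i)

theorem sub_iff {X v : ℕ} : Sub X v ↔ ∀ i, Mem i X → Mem i v :=
  ⟨fun h i hi => h i hi.lt hi, fun h i _ => h i⟩

theorem Sub.lt {X v : ℕ} (h : Sub X v) : X < v + 1 := by
  have : X = X &&& v := ext fun i => by
    have := sub_iff.1 h i
    simp only [Mem, Nat.testBit_and, Bool.and_eq_true] at this ⊢
    tauto
  rw [this]
  exact Nat.lt_succ_of_le Nat.and_le_right

/-- Pairing dominates its arguments and a set dominates its elements, so quantifiers over the parts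
of formulas in `p` may be bounded by `p`. -/
theorem node_lt {k X Y m : ℕ} (h : Mem (node k X Y) m) : X < m ∧ Y < m :=
  ⟨(Nat.left_le_pair X Y).trans_lt ((Nat.right_le_pair k _).trans_lt h.lt),
    (Nat.right_le_pair X Y).trans_lt ((Nat.right_le_pair k _).trans_lt h.lt)⟩

theorem pair_lt {k c m : ℕ} (h : Mem (Nat.pair k c) m) : c < m :=
  (Nat.right_le_pair k c).trans_lt h.lt

@[simp] theorem list_encode (l : List ℕ) : list (Encodable.encode l) = l := by
  simp [list]

variable {Var Pred : Type u} [Encodable Var] [Encodable Pred] {ar : Pred → ℕ}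

theorem mem_codeSet {X : Finset Var} {i : ℕ} :
    Mem i (codeSet X) ↔ ∃ x ∈ X, Encodable.encode x = i := by
  have : codeSet X = ∑ n ∈ X.map ⟨Encodable.encode, Encodable.encode_injective⟩, 2 ^ n := by
    simp [codeSet]
  rw [this, Mem, ← Nat.mem_bitIndices, ← List.mem_toFinset, Finset.toFinset_bitIndices_sum_two_pow]
  simp

theorem encode_mem_codeSet {X : Finset Var} {x : Var} :
    Mem (Encodable.encode x) (codeSet X) ↔ x ∈ X := by
  simp [mem_codeSet]

@[simp] theorem codeSet_singleton (x : Var) : codeSet {x} = 2 ^ Encodable.encode x := by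
  simp [codeSet]

@[simp] theorem codeSet_empty : codeSet (∅ : Finset Var) = 0 := by
  simp [codeSet]

/-! ### From coded quasi-models to quasi-models -/

section Decode

/-- The set of formulas with Gödel numbers in the set coded by `m`. -/
def formulas (ar : Pred → ℕ) (m : ℕ) : Set (Formula Var ar) := {ψ | Mem ψ.code m}

variable {v p : ℕ} {V : Finset Var} (hV : ∀ x, x ∈ V ↔ Mem (Encodable.encode x) v)
include hV

theorem sub_codeSet_iff {X : Finset Var} : Sub (codeSet X) v ↔ X ⊆ V := by
  rw [sub_iff]
  constructor
  · exact fun h x hx => (hV x).2 (h _ (encode_mem_codeSet.2 hx))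
  · intro h i hi
    obtain ⟨x, hx, rfl⟩ := mem_codeSet.1 hi
    exact (hV x).1 (h hx)

theorem codeSet_lt {X : Finset Var} (h : X ⊆ V) : codeSet X < v + 1 :=
  ((sub_codeSet_iff hV).2 h).lt

theorem Agree.decode {Z : Finset Var} {s t : ℕ} (h : Agree v p (codeSet Z) s t) :
    LUD.Agree V (formulas ar p) Z (formulas ar s) (formulas ar t) where
  dep _ hY := h.1 _ (codeSet_lt hV hY) ((sub_codeSet_iff hV).2 hY)
  kdep _ hY := h.2.1 _ (codeSet_lt hV hY) ((sub_codeSet_iff hV).2 hY)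
  d _ hψ := h.2.2.1 _ (node_lt hψ).2 hψ
  k _ hψ := h.2.2.2.1 _ (node_lt hψ).2 hψ
  pred P xs hP hxs := by
    refine h.2.2.2.2 _ (node_lt hP).1 _ (node_lt hP).2 hP fun y hy => ?_
    obtain ⟨i, rfl⟩ : ∃ i, Encodable.encode (xs i) = y := by simpa [List.mem_ofFn] using hy
    exact encode_mem_codeSet.2 (hxs i)

theorem Inherit.decode {Z : Finset Var} {s t : ℕ} (h : Inherit v p (codeSet Z) s t) :
    LUD.Inherit V (formulas ar p) Z (formulas ar s) (formulas ar t) where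
  kdep _ hY := h.1 _ (codeSet_lt hV hY) ((sub_codeSet_iff hV).2 hY)
  k _ hψ := h.2 _ (node_lt hψ).2 hψ

theorem DRel.decode {X : Finset Var} {s t : ℕ} (h : DRel v p (codeSet X) s t) :
    LUD.DRel V (formulas ar p) X (formulas ar s) (formulas ar t) := fun _ hZ hs =>
  (h _ (codeSet_lt hV hZ) ((sub_codeSet_iff hV).2 hZ) hs).decode hV

theorem KRel.decode {X : Finset Var} {s t : ℕ} (h : KRel v p (codeSet X) s t) :
    LUD.KRel V (formulas ar p) X (formulas ar s) (formulas ar t) := fun _ hZ hs =>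
  (h _ (codeSet_lt hV hZ) ((sub_codeSet_iff hV).2 hZ) hs).decode hV

theorem DepLike.decode {k s : ℕ} (h : DepLike v k s) (R : Finset Var → Finset Var → Prop)
    (hR : ∀ X Y, R X Y ↔ Mem (node k (codeSet X) (codeSet Y)) s) : LUD.DepLike V R where
  iff_forall X hX Y hY := by
    rw [hR, h.1 _ (codeSet_lt hV hX) ((sub_codeSet_iff hV).2 hX) _ (codeSet_lt hV hY)
      ((sub_codeSet_iff hV).2 hY)]
    constructor
    · intro h' y hy
      rw [hR, codeSet_singleton]
      have := encode_mem_codeSet.2 hy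
      exact h' _ this.lt this
    · intro h' y _ hy
      obtain ⟨x, hx, rfl⟩ := mem_codeSet.1 hy
      rw [← codeSet_singleton, ← hR]
      exact h' x hx
  refl X hX x hx := by
    rw [hR, codeSet_singleton]
    have := encode_mem_codeSet.2 hx
    exact h.2.1 _ (codeSet_lt hV hX) ((sub_codeSet_iff hV).2 hX) _ this.lt this
  trans X hX Y hY Z hZ := by
    simp only [hR]
    exact h.2.2 _ (codeSet_lt hV hX) ((sub_codeSet_iff hV).2 hX) _ (codeSet_lt hV hY)
      ((sub_codeSet_iff hV).2 hY) _ (codeSet_lt hV hZ) ((sub_codeSet_iff hV).2 hZ)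

theorem SubClosed.decode (h : SubClosed v p) : LUD.SubClosed V (formulas ar p) where
  pred P xs hP i := by
    refine (hV _).2 (h.1 _ (node_lt hP).1 _ (node_lt hP).2 hP _ ?_)
    rw [list_encode, List.mem_ofFn]
    exact ⟨i, rfl⟩
  neg ψ hψ := h.2.1 _ (pair_lt hψ) hψ
  and ψ χ hψ := h.2.2.1 _ (node_lt hψ).1 _ (node_lt hψ).2 hψ
  d X ψ hψ := by
    rw [← sub_codeSet_iff hV]
    exact h.2.2.2.1 _ (node_lt hψ).1 _ (node_lt hψ).2 hψ
  dep X Y hψ := by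
    rw [← sub_codeSet_iff hV, ← sub_codeSet_iff hV]
    exact h.2.2.2.2.1 _ (node_lt hψ).1 _ (node_lt hψ).2 hψ
  k X ψ hψ := by
    rw [← sub_codeSet_iff hV]
    exact h.2.2.2.2.2.1 _ (node_lt hψ).1 _ (node_lt hψ).2 hψ
  kdep X Y hψ := by
    rw [← sub_codeSet_iff hV, ← sub_codeSet_iff hV]
    exact h.2.2.2.2.2.2.1 _ (node_lt hψ).1 _ (node_lt hψ).2 hψ
  udep X Y hψ := by
    rw [← sub_codeSet_iff hV, ← sub_codeSet_iff hV]
    exact h.2.2.2.2.2.2.2 _ (node_lt hψ).1 _ (node_lt hψ).2 hψ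

theorem IsType.decode {s : ℕ} (h : IsType v p s) :
    LUD.IsType V (formulas ar p) (formulas ar s) := by
  obtain ⟨h₁, h₂, h₃, h₄, h₅, h₆, h₇, h₈, h₉, h₁₀⟩ := h
  exact
  { neg := fun ψ hψ => h₁ _ (pair_lt hψ) hψ
    and := fun ψ χ hψ => h₂ _ (node_lt hψ).1 _ (node_lt hψ).2 hψ
    d := fun X ψ hψ => h₃ _ (node_lt hψ).1 _ (node_lt hψ).2 hψ
    k := fun X ψ hψ => h₄ _ (node_lt hψ).1 _ (node_lt hψ).2 hψ
    depLike := h₅.decode hV _ fun _ _ => Iff.rfl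
    kdepLike := h₆.decode hV _ fun _ _ => Iff.rfl
    udepLike := h₇.decode hV _ fun _ _ => Iff.rfl
    dep_of_kdep := fun X hX Y hY => h₈ _ (codeSet_lt hV hX) ((sub_codeSet_iff hV).2 hX) _
      (codeSet_lt hV hY) ((sub_codeSet_iff hV).2 hY)
    kdep_of_udep := fun X hX Y hY => h₉ _ (codeSet_lt hV hX) ((sub_codeSet_iff hV).2 hX) _
      (codeSet_lt hV hY) ((sub_codeSet_iff hV).2 hY)
    udep_of_const := fun X hX Y hY => h₁₀ _ (codeSet_lt hV hX) ((sub_codeSet_iff hV).2 hX) _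
      (codeSet_lt hV hY) ((sub_codeSet_iff hV).2 hY) }

theorem QuasiModel.decode {w : ℕ} (h : QuasiModel v p w) :
    LUD.QuasiModel V (formulas ar p) (formulas ar '' {s | Mem s w}) := by
  obtain ⟨h₁, h₂, h₃, h₄, h₅, h₆⟩ := h
  refine ⟨h₁.decode hV, ?_, ?_, ?_, ?_, ?_⟩
  · rintro _ ⟨s, hs, rfl⟩
    exact (h₂ s hs.lt hs).decode hV
  · rintro _ ⟨s, hs, rfl⟩ X ψ hψ hn
    obtain ⟨t, -, ht, hR, hψt⟩ := h₃ s hs.lt hs _ (node_lt hψ).1 _ (node_lt hψ).2 hψ hn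
    exact ⟨_, ⟨t, ht, rfl⟩, hR.decode hV, hψt⟩
  · rintro _ ⟨s, hs, rfl⟩ X ψ hψ hn
    obtain ⟨t, -, ht, hR, hψt⟩ := h₄ s hs.lt hs _ (node_lt hψ).1 _ (node_lt hψ).2 hψ hn
    exact ⟨_, ⟨t, ht, rfl⟩, hR.decode hV, hψt⟩
  · rintro _ ⟨s, hs, rfl⟩ _ ⟨t, ht, rfl⟩
    have := h₅ s hs.lt hs t ht.lt ht
    rw [← codeSet_empty (Var := Var)] at this
    exact this.decode hV
  · rintro _ ⟨s, hs, rfl⟩ _ ⟨t, ht, rfl⟩ X hX Y hY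
    exact h₆ s hs.lt hs t ht.lt ht _ (codeSet_lt hV hX) ((sub_codeSet_iff hV).2 hX) _
      (codeSet_lt hV hY) ((sub_codeSet_iff hV).2 hY)

end Decode

/-- Digits of `v` that number no variable are dropped; the coded conditions on them are merely
superfluous. -/
theorem exists_vars (Var : Type u) [Encodable Var] (v : ℕ) :
    ∃ V : Finset Var, ∀ x, x ∈ V ↔ Mem (Encodable.encode x) v := by
  classical
  refine ⟨((Finset.range v).filter fun i => Mem i v).preimage Encodable.encode
    Encodable.encode_injective.injOn, fun x => ?_⟩
  simpa using fun h : Mem _ v => h.lt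

/-! ### From quasi-models to coded quasi-models -/

section Encode

variable {B v p : ℕ} {V : Finset Var} {Φ : Set (Formula Var ar)}

/-- The number `s` codes the part of the set `σ` of formulas with Gödel numbers below `B`. -/
def Codes (B s : ℕ) (σ : Set (Formula Var ar)) : Prop :=
  ∀ i, Mem i s ↔ i < B ∧ ∃ ψ ∈ σ, code ψ = i

theorem Codes.mem_iff {s : ℕ} {σ : Set (Formula Var ar)} (h : Codes B s σ) {ψ : Formula Var ar}
    (hψ : ψ.code < B) : Mem ψ.code s ↔ ψ ∈ σ := by
  rw [h]
  constructor
  · rintro ⟨-, χ, hχ, he⟩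
    rwa [← code_injective he]
  · exact fun h => ⟨hψ, ψ, h, rfl⟩

/-! ### Reading off the shape of a formula from its Gödel number. -/

theorem code_eq_pred {ψ : Formula Var ar} {P l : ℕ} (h : ψ.code = node 0 P l) :
    ∃ P' xs, ψ = pred P' xs ∧ Encodable.encode P' = P ∧
      list l = List.ofFn fun i => Encodable.encode (xs i) := by
  cases ψ <;> simp only [code, node, Nat.pair_eq_pair] at h <;> try omega
  exact ⟨_, _, rfl, h.2.1, by rw [← h.2.2, list_encode]⟩

theorem code_eq_neg {ψ : Formula Var ar} {c : ℕ} (h : ψ.code = Nat.pair 1 c) :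
    ∃ χ, ψ = neg χ ∧ χ.code = c := by
  cases ψ <;> simp only [code, Nat.pair_eq_pair] at h <;> try omega
  exact ⟨_, rfl, h.2⟩

theorem code_eq_and {ψ : Formula Var ar} {c d : ℕ} (h : ψ.code = node 2 c d) :
    ∃ χ ξ, ψ = Formula.and χ ξ ∧ χ.code = c ∧ ξ.code = d := by
  cases ψ <;> simp only [code, node, Nat.pair_eq_pair] at h <;> try omega
  exact ⟨_, _, rfl, h.2⟩

theorem code_eq_D {ψ : Formula Var ar} {X c : ℕ} (h : ψ.code = node 3 X c) :
    ∃ X' χ, ψ = D X' χ ∧ codeSet X' = X ∧ χ.code = c := by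
  cases ψ <;> simp only [code, node, Nat.pair_eq_pair] at h <;> try omega
  exact ⟨_, _, rfl, h.2⟩

theorem code_eq_Dep {ψ : Formula Var ar} {X Y : ℕ} (h : ψ.code = node 4 X Y) :
    ∃ X' Y', ψ = Dep X' Y' ∧ codeSet X' = X ∧ codeSet Y' = Y := by
  cases ψ <;> simp only [code, node, Nat.pair_eq_pair] at h <;> try omega
  exact ⟨_, _, rfl, h.2⟩

theorem code_eq_K {ψ : Formula Var ar} {X c : ℕ} (h : ψ.code = node 5 X c) :
    ∃ X' χ, ψ = K X' χ ∧ codeSet X' = X ∧ χ.code = c := by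
  cases ψ <;> simp only [code, node, Nat.pair_eq_pair] at h <;> try omega
  exact ⟨_, _, rfl, h.2⟩

theorem code_eq_KDep {ψ : Formula Var ar} {X Y : ℕ} (h : ψ.code = node 6 X Y) :
    ∃ X' Y', ψ = KDep X' Y' ∧ codeSet X' = X ∧ codeSet Y' = Y := by
  cases ψ <;> simp only [code, node, Nat.pair_eq_pair] at h <;> try omega
  exact ⟨_, _, rfl, h.2⟩

theorem code_eq_UDep {ψ : Formula Var ar} {X Y : ℕ} (h : ψ.code = node 7 X Y) :
    ∃ X' Y', ψ = UDep X' Y' ∧ codeSet X' = X ∧ codeSet Y' = Y := by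
  cases ψ <;> simp only [code, node, Nat.pair_eq_pair] at h <;> try omega
  exact ⟨_, _, rfl, h.2⟩

/-- The numbers `v` and `p` code the set `V` of variables and the set `Φ` of formulas, and `B`
bounds the Gödel numbers of `Φ` and of the dependence atoms over `V`. -/
structure Setup (B v p : ℕ) (V : Finset Var) (Φ : Set (Formula Var ar)) : Prop where
  vars : v = codeSet V
  mem_iff : ∀ i, Mem i p ↔ ∃ ψ ∈ Φ, code ψ = i
  lt_bound : ∀ ψ ∈ Φ, code ψ < B
  dep_lt_bound : ∀ X ⊆ V, ∀ Y ⊆ V, ∀ k < 8, node k (codeSet X) (codeSet Y) < B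

namespace Setup

variable (hS : Setup B v p V Φ)
include hS

theorem mem_vars (x : Var) : x ∈ V ↔ Mem (Encodable.encode x) v := by
  rw [hS.vars, encode_mem_codeSet]

/-- Since `v` codes exactly `V`, the coded quantifiers over subsets of `v` range over the subsets of
`V` and nothing else. -/
theorem exists_codeSet {X : ℕ} (h : Sub X v) : ∃ X' ⊆ V, codeSet X' = X := by
  classical
  refine ⟨V.filter fun x => Mem (Encodable.encode x) X, Finset.filter_subset _ _,
    ext fun i => ?_⟩
  rw [mem_codeSet]
  constructor
  · rintro ⟨x, hx, rfl⟩
    exact (Finset.mem_filter.1 hx).2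
  · intro hi
    have := sub_iff.1 h i hi
    rw [hS.vars] at this
    obtain ⟨x, hx, rfl⟩ := mem_codeSet.1 this
    exact ⟨x, Finset.mem_filter.2 ⟨hx, hi⟩, rfl⟩

variable {s t : ℕ} {σ τ : Set (Formula Var ar)} (hs : Codes B s σ) (ht : Codes B t τ)
include hs

theorem mem_form {ψ : Formula Var ar} (hψ : ψ ∈ Φ) : Mem ψ.code s ↔ ψ ∈ σ :=
  hs.mem_iff (hS.lt_bound ψ hψ)

theorem mem_dep {X Y : Finset Var} (hX : X ⊆ V) (hY : Y ⊆ V) :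
    Mem (node 4 (codeSet X) (codeSet Y)) s ↔ Dep X Y ∈ σ :=
  hs.mem_iff (ψ := Dep X Y) (hS.dep_lt_bound X hX Y hY 4 (by norm_num))

theorem mem_kdep {X Y : Finset Var} (hX : X ⊆ V) (hY : Y ⊆ V) :
    Mem (node 6 (codeSet X) (codeSet Y)) s ↔ KDep X Y ∈ σ :=
  hs.mem_iff (ψ := KDep X Y) (hS.dep_lt_bound X hX Y hY 6 (by norm_num))

theorem mem_udep {X Y : Finset Var} (hX : X ⊆ V) (hY : Y ⊆ V) :
    Mem (node 7 (codeSet X) (codeSet Y)) s ↔ UDep X Y ∈ σ :=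
  hs.mem_iff (ψ := UDep X Y) (hS.dep_lt_bound X hX Y hY 7 (by norm_num))

omit hs in
theorem form_of_mem {i : ℕ} (h : Mem i p) : ∃ ψ ∈ Φ, code ψ = i := (hS.mem_iff i).1 h

omit hs in
theorem mem_of_form {ψ : Formula Var ar} (h : ψ ∈ Φ) : Mem ψ.code p := (hS.mem_iff _).2 ⟨ψ, h, rfl⟩

include ht in
theorem agree {Z : Finset Var} (hZ : Z ⊆ V) (h : LUD.Agree V Φ Z σ τ) :
    Agree v p (codeSet Z) s t := by
  refine ⟨?_, ?_, ?_, ?_, ?_⟩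
  · rintro _ - hY'
    obtain ⟨Y, hY, rfl⟩ := hS.exists_codeSet hY'
    rw [hS.mem_dep hs hZ hY, hS.mem_dep ht hZ hY]
    exact h.dep Y hY
  · rintro _ - hY'
    obtain ⟨Y, hY, rfl⟩ := hS.exists_codeSet hY'
    rw [hS.mem_kdep hs hZ hY, hS.mem_kdep ht hZ hY]
    exact h.kdep Y hY
  · rintro c - hc
    obtain ⟨ψ, hψ, he⟩ := hS.form_of_mem hc
    rw [← he, hS.mem_form hs hψ, hS.mem_form ht hψ]
    obtain ⟨Z', χ, rfl, hZ', rfl⟩ := code_eq_D he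
    obtain rfl := codeSet_injective hZ'
    exact h.d χ hψ
  · rintro c - hc
    obtain ⟨ψ, hψ, he⟩ := hS.form_of_mem hc
    rw [← he, hS.mem_form hs hψ, hS.mem_form ht hψ]
    obtain ⟨Z', χ, rfl, hZ', rfl⟩ := code_eq_K he
    obtain rfl := codeSet_injective hZ'
    exact h.k χ hψ
  · rintro P - l - hP hl
    obtain ⟨ψ, hψ, he⟩ := hS.form_of_mem hP
    rw [← he, hS.mem_form hs hψ, hS.mem_form ht hψ]
    obtain ⟨P', xs, rfl, -, hxs⟩ := code_eq_pred he
    refine h.pred P' xs hψ fun i => encode_mem_codeSet.1 (hl _ ?_)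
    rw [hxs, List.mem_ofFn]
    exact ⟨i, rfl⟩

include ht in
theorem inherit {Z : Finset Var} (hZ : Z ⊆ V) (h : LUD.Inherit V Φ Z σ τ) :
    Inherit v p (codeSet Z) s t := by
  refine ⟨?_, ?_⟩
  · rintro _ - hY'
    obtain ⟨Y, hY, rfl⟩ := hS.exists_codeSet hY'
    rw [hS.mem_kdep hs hZ hY, hS.mem_kdep ht hZ hY]
    exact h.kdep Y hY
  · rintro c - hc
    obtain ⟨ψ, hψ, he⟩ := hS.form_of_mem hc
    rw [← he, hS.mem_form hs hψ, hS.mem_form ht hψ]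
    obtain ⟨Z', χ, rfl, hZ', rfl⟩ := code_eq_K he
    obtain rfl := codeSet_injective hZ'
    exact h.k χ hψ

include ht in
theorem dRel {X : Finset Var} (hX : X ⊆ V) (h : LUD.DRel V Φ X σ τ) :
    DRel v p (codeSet X) s t := by
  rintro _ - hZ' hm
  obtain ⟨Z, hZ, rfl⟩ := hS.exists_codeSet hZ'
  rw [hS.mem_dep hs hX hZ] at hm
  exact hS.agree hs ht hZ (h Z hZ hm)

include ht in
theorem kRel {X : Finset Var} (hX : X ⊆ V) (h : LUD.KRel V Φ X σ τ) :
    KRel v p (codeSet X) s t := by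
  rintro _ - hZ' hm
  obtain ⟨Z, hZ, rfl⟩ := hS.exists_codeSet hZ'
  rw [hS.mem_kdep hs hX hZ] at hm
  exact hS.inherit hs ht hZ (h Z hZ hm)

omit hs in
theorem depLike {k : ℕ} {R : Finset Var → Finset Var → Prop} (h : LUD.DepLike V R)
    (hR : ∀ X ⊆ V, ∀ Y ⊆ V, Mem (node k (codeSet X) (codeSet Y)) s ↔ R X Y) :
    DepLike v k s := by
  refine ⟨?_, ?_, ?_⟩
  · rintro _ - hX' _ - hY'
    obtain ⟨X, hX, rfl⟩ := hS.exists_codeSet hX'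
    obtain ⟨Y, hY, rfl⟩ := hS.exists_codeSet hY'
    rw [hR X hX Y hY, h.iff_forall X hX Y hY]
    constructor
    · intro h' y _ hy
      obtain ⟨x, hx, rfl⟩ := mem_codeSet.1 hy
      rw [← codeSet_singleton, hR X hX _ (by simpa using hY hx)]
      exact h' x hx
    · intro h' y hy
      rw [← hR X hX _ (by simpa using hY hy), codeSet_singleton]
      have := encode_mem_codeSet.2 hy
      exact h' _ this.lt this
  · rintro _ - hX' x - hx'
    obtain ⟨X, hX, rfl⟩ := hS.exists_codeSet hX'
    obtain ⟨x, hx, rfl⟩ := mem_codeSet.1 hx'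
    rw [← codeSet_singleton, hR X hX _ (by simpa using hX hx)]
    exact h.refl X hX x hx
  · rintro _ - hX' _ - hY' _ - hZ'
    obtain ⟨X, hX, rfl⟩ := hS.exists_codeSet hX'
    obtain ⟨Y, hY, rfl⟩ := hS.exists_codeSet hY'
    obtain ⟨Z, hZ, rfl⟩ := hS.exists_codeSet hZ'
    rw [hR X hX Y hY, hR Y hY Z hZ, hR X hX Z hZ]
    exact h.trans X hX Y hY Z hZ

omit hs in
theorem subClosed (h : LUD.SubClosed V Φ) : SubClosed v p := by
  have sub {X : Finset Var} (hX : X ⊆ V) : Sub (codeSet X) v :=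
    (sub_codeSet_iff hS.mem_vars).2 hX
  refine ⟨?_, ?_, ?_, ?_, ?_, ?_, ?_, ?_⟩
  · rintro P - l - hP y hy
    obtain ⟨ψ, hψ, he⟩ := hS.form_of_mem hP
    obtain ⟨P', xs, rfl, -, hxs⟩ := code_eq_pred he
    rw [hxs, List.mem_ofFn] at hy
    obtain ⟨i, rfl⟩ := hy
    exact (hS.mem_vars _).1 (h.pred P' xs hψ i)
  · rintro c - hc
    obtain ⟨ψ, hψ, he⟩ := hS.form_of_mem hc
    obtain ⟨χ, rfl, rfl⟩ := code_eq_neg he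
    exact hS.mem_of_form (h.neg χ hψ)
  · rintro c - d - hc
    obtain ⟨ψ, hψ, he⟩ := hS.form_of_mem hc
    obtain ⟨χ, ξ, rfl, rfl, rfl⟩ := code_eq_and he
    exact ⟨hS.mem_of_form (h.and χ ξ hψ).1, hS.mem_of_form (h.and χ ξ hψ).2⟩
  · rintro X - c - hc
    obtain ⟨ψ, hψ, he⟩ := hS.form_of_mem hc
    obtain ⟨X, χ, rfl, rfl, rfl⟩ := code_eq_D he
    exact ⟨sub (h.d X χ hψ).1, hS.mem_of_form (h.d X χ hψ).2⟩
  · rintro X - c - hc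
    obtain ⟨ψ, hψ, he⟩ := hS.form_of_mem hc
    obtain ⟨X, Y, rfl, rfl, rfl⟩ := code_eq_Dep he
    exact ⟨sub (h.dep X Y hψ).1, sub (h.dep X Y hψ).2⟩
  · rintro X - c - hc
    obtain ⟨ψ, hψ, he⟩ := hS.form_of_mem hc
    obtain ⟨X, χ, rfl, rfl, rfl⟩ := code_eq_K he
    exact ⟨sub (h.k X χ hψ).1, hS.mem_of_form (h.k X χ hψ).2⟩
  · rintro X - c - hc
    obtain ⟨ψ, hψ, he⟩ := hS.form_of_mem hc
    obtain ⟨X, Y, rfl, rfl, rfl⟩ := code_eq_KDep he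
    exact ⟨sub (h.kdep X Y hψ).1, sub (h.kdep X Y hψ).2⟩
  · rintro X - c - hc
    obtain ⟨ψ, hψ, he⟩ := hS.form_of_mem hc
    obtain ⟨X, Y, rfl, rfl, rfl⟩ := code_eq_UDep he
    exact ⟨sub (h.udep X Y hψ).1, sub (h.udep X Y hψ).2⟩

theorem isType (hΦ : LUD.SubClosed V Φ) (h : LUD.IsType V Φ σ) : IsType v p s := by
  refine ⟨?_, ?_, ?_, ?_, ?_, ?_, ?_, ?_, ?_, ?_⟩
  · rintro c - hc
    obtain ⟨ψ, hψ, he⟩ := hS.form_of_mem hc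
    rw [← he, hS.mem_form hs hψ]
    obtain ⟨χ, rfl, rfl⟩ := code_eq_neg he
    rw [hS.mem_form hs (hΦ.neg χ hψ)]
    exact h.neg χ hψ
  · rintro c - d - hc
    obtain ⟨ψ, hψ, he⟩ := hS.form_of_mem hc
    rw [← he, hS.mem_form hs hψ]
    obtain ⟨χ, ξ, rfl, rfl, rfl⟩ := code_eq_and he
    rw [hS.mem_form hs (hΦ.and χ ξ hψ).1, hS.mem_form hs (hΦ.and χ ξ hψ).2]
    exact h.and χ ξ hψ
  · rintro X - c - hc
    obtain ⟨ψ, hψ, he⟩ := hS.form_of_mem hc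
    rw [← he, hS.mem_form hs hψ]
    obtain ⟨X, χ, rfl, rfl, rfl⟩ := code_eq_D he
    rw [hS.mem_form hs (hΦ.d X χ hψ).2]
    exact h.d X χ hψ
  · rintro X - c - hc
    obtain ⟨ψ, hψ, he⟩ := hS.form_of_mem hc
    rw [← he, hS.mem_form hs hψ]
    obtain ⟨X, χ, rfl, rfl, rfl⟩ := code_eq_K he
    rw [hS.mem_form hs (hΦ.k X χ hψ).2]
    exact h.k X χ hψ
  · exact hS.depLike h.depLike fun X hX Y hY => hS.mem_dep hs hX hY
  · exact hS.depLike h.kdepLike fun X hX Y hY => hS.mem_kdep hs hX hY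
  · exact hS.depLike h.udepLike fun X hX Y hY => hS.mem_udep hs hX hY
  · rintro _ - hX' _ - hY'
    obtain ⟨X, hX, rfl⟩ := hS.exists_codeSet hX'
    obtain ⟨Y, hY, rfl⟩ := hS.exists_codeSet hY'
    rw [hS.mem_dep hs hX hY, hS.mem_kdep hs hX hY]
    exact h.dep_of_kdep X hX Y hY
  · rintro _ - hX' _ - hY'
    obtain ⟨X, hX, rfl⟩ := hS.exists_codeSet hX'
    obtain ⟨Y, hY, rfl⟩ := hS.exists_codeSet hY'
    rw [hS.mem_kdep hs hX hY, hS.mem_udep hs hX hY]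
    exact h.kdep_of_udep X hX Y hY
  · rintro _ - hX' _ - hY'
    obtain ⟨X, hX, rfl⟩ := hS.exists_codeSet hX'
    obtain ⟨Y, hY, rfl⟩ := hS.exists_codeSet hY'
    rw [← codeSet_empty (Var := Var), hS.mem_dep hs (by simp) hY, hS.mem_udep hs hX hY]
    exact h.udep_of_const X hX Y hY

omit hs in
-- Types may be infinite sets, but every condition mentions only formulas of `Φ` and dependence
-- atoms over `V`, all below `B`, so truncation preserves it. Distinct types may share a code.
theorem quasiModel {w : ℕ} {W : Set (Set (Formula Var ar))}
    (hw : ∀ i, Mem i w ↔ ∃ σ ∈ W, Codes B i σ) (hW : ∀ σ ∈ W, ∃ s, Codes B s σ)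
    (h : LUD.QuasiModel V Φ W) : QuasiModel v p w := by
  refine ⟨hS.subClosed h.subClosed, ?_, ?_, ?_, ?_, ?_⟩
  · rintro s - hs
    obtain ⟨σ, hσ, hs⟩ := (hw s).1 hs
    exact hS.isType hs h.subClosed (h.isType σ hσ)
  · rintro s - hs X - c - hc hn
    obtain ⟨σ, hσ, hs⟩ := (hw s).1 hs
    obtain ⟨ψ, hψ, he⟩ := hS.form_of_mem hc
    rw [← he, hS.mem_form hs hψ] at hn
    obtain ⟨X, χ, rfl, rfl, rfl⟩ := code_eq_D he
    obtain ⟨hX, hχ⟩ := h.subClosed.d X χ hψ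
    obtain ⟨τ, hτ, hR, hm⟩ := h.d σ hσ X χ hψ hn
    obtain ⟨t, ht⟩ := hW τ hτ
    have htw := (hw t).2 ⟨τ, hτ, ht⟩
    exact ⟨t, htw.lt, htw, hS.dRel hs ht hX hR, by rwa [hS.mem_form ht hχ]⟩
  · rintro s - hs X - c - hc hn
    obtain ⟨σ, hσ, hs⟩ := (hw s).1 hs
    obtain ⟨ψ, hψ, he⟩ := hS.form_of_mem hc
    rw [← he, hS.mem_form hs hψ] at hn
    obtain ⟨X, χ, rfl, rfl, rfl⟩ := code_eq_K he
    obtain ⟨hX, hχ⟩ := h.subClosed.k X χ hψ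
    obtain ⟨τ, hτ, hR, hm⟩ := h.k σ hσ X χ hψ hn
    obtain ⟨t, ht⟩ := hW τ hτ
    have htw := (hw t).2 ⟨τ, hτ, ht⟩
    exact ⟨t, htw.lt, htw, hS.kRel hs ht hX hR, by rwa [hS.mem_form ht hχ]⟩
  · rintro s - hs t - ht
    obtain ⟨σ, hσ, hs⟩ := (hw s).1 hs
    obtain ⟨τ, hτ, ht⟩ := (hw t).1 ht
    rw [← codeSet_empty (Var := Var)]
    exact hS.dRel hs ht (by simp) (h.all σ hσ τ hτ)
  · rintro s - hs t - ht _ - hX' _ - hY'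
    obtain ⟨σ, hσ, hs⟩ := (hw s).1 hs
    obtain ⟨τ, hτ, ht⟩ := (hw t).1 ht
    obtain ⟨X, hX, rfl⟩ := hS.exists_codeSet hX'
    obtain ⟨Y, hY, rfl⟩ := hS.exists_codeSet hY'
    rw [hS.mem_udep hs hX hY, hS.mem_udep ht hX hY]
    exact h.udep σ hσ τ hτ X hX Y hY

end Setup

end Encode

/-! ### Bounds for the Gödel numbers -/

theorem code_le_of_mem_subformulas {φ ψ : Formula Var ar} (h : ψ ∈ φ.subformulas) :
    ψ.code ≤ φ.code := by
  induction φ with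
  | pred P xs => rw [show ψ = pred P xs from h]
  | Dep X Y => rw [show ψ = Dep X Y from h]
  | KDep X Y => rw [show ψ = KDep X Y from h]
  | UDep X Y => rw [show ψ = UDep X Y from h]
  | neg φ ih =>
    rcases h with rfl | h
    · exact le_rfl
    · exact (ih h).trans (Nat.right_le_pair _ _)
  | and φ χ ih₁ ih₂ =>
    rcases h with rfl | h | h
    · exact le_rfl
    · exact (ih₁ h).trans ((Nat.left_le_pair _ _).trans (Nat.right_le_pair _ _))
    · exact (ih₂ h).trans ((Nat.right_le_pair _ _).trans (Nat.right_le_pair _ _))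
  | D X φ ih =>
    rcases h with rfl | h
    · exact le_rfl
    · exact (ih h).trans ((Nat.right_le_pair _ _).trans (Nat.right_le_pair _ _))
  | K X φ ih =>
    rcases h with rfl | h
    · exact le_rfl
    · exact (ih h).trans ((Nat.right_le_pair _ _).trans (Nat.right_le_pair _ _))

theorem lt_encode_list {l : List ℕ} {y : ℕ} (h : y ∈ l) : y < Encodable.encode l := by
  induction l with
  | nil => simp at h
  | cons a l ih =>
    rw [Encodable.encode_list_cons]
    rcases List.mem_cons.1 h with rfl | h
    · exact Nat.lt_succ_of_le (Nat.left_le_pair _ _)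
    · exact (ih h).trans_le ((Nat.right_le_pair _ _).trans (Nat.le_succ _))

theorem encode_lt_of_mem_vars [DecidableEq Var] {φ : Formula Var ar} {x : Var}
    (h : x ∈ φ.vars) : Encodable.encode x < φ.code := by
  have lt_left {X : Finset Var} (h : x ∈ X) (k Y : ℕ) :
      Encodable.encode x < Nat.pair k (Nat.pair (codeSet X) Y) :=
    (encode_mem_codeSet.2 h).lt.trans_le ((Nat.left_le_pair _ _).trans (Nat.right_le_pair _ _))
  have lt_right {n : ℕ} (h : Encodable.encode x < n) (k Y : ℕ) :
      Encodable.encode x < Nat.pair k (Nat.pair Y n) :=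
    h.trans_le ((Nat.right_le_pair _ _).trans (Nat.right_le_pair _ _))
  induction φ with
  | pred P xs =>
    obtain ⟨i, -, rfl⟩ := Finset.mem_image.1 h
    exact lt_right (lt_encode_list (List.mem_ofFn.2 ⟨i, rfl⟩)) _ _
  | neg φ ih => exact (ih h).trans_le (Nat.right_le_pair _ _)
  | and φ χ ih₁ ih₂ =>
    rcases Finset.mem_union.1 h with h | h
    · exact (ih₁ h).trans_le ((Nat.left_le_pair _ _).trans (Nat.right_le_pair _ _))
    · exact lt_right (ih₂ h) _ _
  | D X φ ih =>
    rcases Finset.mem_union.1 h with h | h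
    · exact lt_left h _ _
    · exact lt_right (ih h) _ _
  | K X φ ih =>
    rcases Finset.mem_union.1 h with h | h
    · exact lt_left h _ _
    · exact lt_right (ih h) _ _
  | Dep X Y | KDep X Y | UDep X Y =>
    rcases Finset.mem_union.1 h with h | h
    · exact lt_left h _ _
    · exact lt_right (encode_mem_codeSet.2 h).lt _ _

theorem node_lt_node {k k' X X' Y Y' : ℕ} (hk : k < k') (hX : X < X') (hY : Y < Y') :
    node k X Y < node k' X' Y' :=
  (Nat.pair_lt_pair_left _ hk).trans (Nat.pair_lt_pair_right _
    ((Nat.pair_lt_pair_left _ hX).trans (Nat.pair_lt_pair_right _ hY)))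

/-- A formula that is refuted in a quasi-model is refuted in a quasi-model of bounded size. -/
theorem refutable_of_quasiModel [DecidableEq Var] {φ : Formula Var ar}
    {W : Set (Set (Formula Var ar))} (hQ : LUD.QuasiModel φ.vars φ.subformulas W)
    (hW : ∃ σ ∈ W, φ ∉ σ) : Refutable φ.code := by
  obtain ⟨v, hv, hv'⟩ := exists_forall_mem_iff φ.code
    fun i => ∃ x ∈ φ.vars, Encodable.encode x = i
  obtain ⟨p, hp, hp'⟩ := exists_forall_mem_iff (φ.code + 1)
    fun i => ∃ ψ ∈ φ.subformulas, code ψ = i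
  choose num hnum hnum' using fun σ : Set (Formula Var ar) =>
    exists_forall_mem_iff (bound φ.code) fun i => ∃ ψ ∈ σ, code ψ = i
  obtain ⟨w, hw, hw'⟩ := exists_forall_mem_iff (2 ^ bound φ.code)
    fun i => ∃ σ ∈ W, Codes (bound φ.code) i σ
  have hvV : v = codeSet φ.vars := ext fun i => by
    rw [hv', mem_codeSet, and_iff_right_iff_imp]
    rintro ⟨x, hx, rfl⟩
    exact encode_lt_of_mem_vars hx
  -- Variables of `φ` are numbered below its Gödel number, so sets of them have codes below `2 ^
  -- φ.code`. With tags below 8, this is what the second summand of `bound` covers.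
  have lt_pow {X : Finset Var} (hX : X ⊆ φ.vars) : codeSet X < 2 ^ φ.code :=
    (Finset.sum_le_sum_of_subset hX).trans_lt (hvV.symm.trans_lt hv)
  have hS : Setup (bound φ.code) v p φ.vars φ.subformulas := by
    refine ⟨hvV, fun i => ?_, fun ψ hψ => ?_, fun X hX Y hY k hk => ?_⟩
    · rw [hp', and_iff_right_iff_imp]
      rintro ⟨ψ, hψ, rfl⟩
      exact Nat.lt_succ_of_le (code_le_of_mem_subformulas hψ)
    · exact (Nat.lt_succ_of_le (code_le_of_mem_subformulas hψ)).trans_le (Nat.le_add_right _ _)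
    · exact (node_lt_node hk (lt_pow hX) (lt_pow hY)).trans_le (Nat.le_add_left _ _)
  have hcodes (σ : Set (Formula Var ar)) : Codes (bound φ.code) (num σ) σ := hnum' σ
  have hmem : ∀ i, Mem i w ↔ ∃ σ ∈ W, Codes (bound φ.code) i σ := fun i => by
    rw [hw', and_iff_right_iff_imp]
    rintro ⟨σ, -, hi⟩
    -- A code of `σ` is unique, hence is `num σ`, which is below `2 ^ bound φ.code`.
    rw [show i = num σ from ext fun j => (hi j).trans (hcodes σ j).symm]
    exact hnum σ
  obtain ⟨σ, hσ, hφσ⟩ := hW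
  have hσw := (hmem _).2 ⟨σ, hσ, hcodes σ⟩
  refine ⟨v, hv, p, hp, w, hw, hS.quasiModel hmem (fun σ _ => ⟨_, hcodes σ⟩) hQ,
    hS.mem_of_form (self_mem_subformulas φ), num σ, hσw.lt, hσw, ?_⟩
  rwa [hS.mem_form (hcodes σ) (self_mem_subformulas φ)]

end Coded

/-! ### The main results -/

variable {Var Pred : Type u} {ar : Pred → ℕ}

/-- A formula that is refuted in a quasi-model is refuted in a pseudo-locally Lipschitz model. -/
theorem QuasiModel.exists_model {V : Finset Var} {Φ : Set (Formula Var ar)}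
    {W : Set (Set (Formula Var ar))} (hQ : QuasiModel V Φ W) {φ : Formula Var ar} (hφ : φ ∈ Φ)
    (hW : ∃ s ∈ W, φ ∉ s) :
    ∃ M : MetricModel Var ar, M.IsPseudoLocallyLipschitz ∧ ¬ M.Valid φ := by
  obtain ⟨s, hs, hφs⟩ := hW
  refine ⟨pathModel V Φ W ⟨s, hs⟩, pathModel_isPseudoLocallyLipschitz _, fun hv => hφs ?_⟩
  exact (hQ.sat_iff φ hφ []).1 (hv (pathState V Φ W ⟨s, hs⟩ []))

theorem exists_model_of_not_provable [DecidableEq Var] {φ : Formula Var ar}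
    (h : ¬ Provable φ) : ∃ M : MetricModel Var ar, M.IsPseudoLocallyLipschitz ∧ ¬ M.Valid φ := by
  obtain ⟨W, hQ, hW⟩ := exists_quasiModel h
  exact hQ.exists_model (self_mem_subformulas φ) hW

theorem provable_iff_metricValid [DecidableEq Var] (φ : Formula Var ar) :
    Provable φ ↔ MetricValid φ := by
  refine ⟨fun h M => M.sat_of_provable h, fun h => ?_⟩
  by_contra hn
  obtain ⟨M, -, hM⟩ := exists_model_of_not_provable hn
  exact hM (h M)

theorem provable_iff_concreteValid [DecidableEq Var] (φ : Formula Var ar) :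
    Provable φ ↔ ConcreteValid φ := by
  refine ⟨fun h M => M.toMetricModel.sat_of_provable h, fun h => ?_⟩
  by_contra hn
  obtain ⟨M, -, hM⟩ := exists_model_of_not_provable hn
  exact hM fun s => (M.sat_toAssignment φ s).1 (h M.toConcrete _)

theorem provable_iff_lipschitzValid [DecidableEq Var] (φ : Formula Var ar) :
    Provable φ ↔ LipschitzValid φ := by
  refine ⟨fun h M _ => M.sat_of_provable h, fun h => ?_⟩
  by_contra hn
  obtain ⟨M, hL, hM⟩ := exists_model_of_not_provable hn
  exact hM (h M hL)

/-- Any coded quasi-model refuting the number decodes to a genuine one, whatever `v` and `p` are;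
the size bounds serve only the converse, which goes through completeness because its quasi-model
comes from unprovability. -/
theorem refutable_iff [DecidableEq Var] [Encodable Var] [Encodable Pred] (φ : Formula Var ar) :
    Coded.Refutable φ.code ↔ ¬ MetricValid φ := by
  constructor
  · rintro ⟨v, -, p, -, w, -, hQ, hφ, s, -, hs, hφs⟩ hv
    obtain ⟨V, hV⟩ := Coded.exists_vars Var v
    obtain ⟨M, -, hM⟩ := (hQ.decode hV).exists_model (φ := φ) hφ ⟨_, ⟨s, hs, rfl⟩, hφs⟩
    exact hM (hv M)
  · intro h
    rw [← provable_iff_metricValid] at h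
    obtain ⟨W, hQ, hW⟩ := exists_quasiModel h
    exact Coded.refutable_of_quasiModel hQ hW

theorem decidableFormulas_metricValid [DecidableEq Var] [Encodable Var] [Encodable Pred] :
    DecidableFormulas fun φ : Formula Var ar => MetricValid φ := by
  classical
  refine ⟨fun n => decide (¬ Coded.Refutable n), Coded.primrecPred_refutable.not.decide.to_comp,
    fun φ => ?_⟩
  rw [decide_eq_true_iff, refutable_iff, not_not]

end LUD

theorem mainTheorem2 {Var Pred : Type u} [DecidableEq Var] (ar : Pred → ℕ) :
    (∀ φ : LUD.Formula Var ar, LUD.Provable φ ↔ LUD.MetricValid φ) ∧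
    (∀ φ : LUD.Formula Var ar, LUD.Provable φ ↔ LUD.ConcreteValid φ) ∧
    (∀ φ : LUD.Formula Var ar, LUD.Provable φ ↔ LUD.LipschitzValid φ) ∧
    (∀ [Encodable Var] [Encodable Pred],
      LUD.DecidableFormulas (fun φ : LUD.Formula Var ar => LUD.MetricValid φ)) := by
  exact ⟨LUD.provable_iff_metricValid, LUD.provable_iff_concreteValid,
    LUD.provable_iff_lipschitzValid, LUD.decidableFormulas_metricValid⟩
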